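/- Let $n\ge 2$ and let $E$ be an $n$-dimensional Euclidean space with scalar product $\langle\cdot,\cdot\rangle$ (identified with its dual) and unit sphere $\mathbb S^*$, equipped with its Lebesgue (surface) measure $\mathfrak m$. Let $K\in\mathcal K^\infty_+$, i.e. $K\subset E$ is a convex body with the origin in its interior and with $C^\infty$-smooth boundary of strictly positive curvature. Let $h_K(y)=\max_{x\in K}\langle y,x\rangle$ be its support function. For $u\in C^2(\mathbb S^*)$ let $D^2u$ denote the restriction to the tangent spaces of $\mathbb S^*$ of the second derivative of the $1$-homogeneous extension of $u$ to $E$. Let $$\Delta_K z=((D^2h_K)^{-1})^{ij}D^2_{ij}(z\,h_K)-(n-1)z,\qquad z\in C^2(\mathbb S^*),$$ be the Hilbert--Brunn--Minkowski operator, and let $\nu_K=h_K\det(D^2h_K)\,\mathfrak m$, which is $n$ times the cone-volume measure of $K$. Denote also by $-\Delta_K$ the self-adjoint extension to $L^2(\nu_K)$ of $-\Delta_K$ on $C^2(\mathbb S^*)$, namely its closure. Then the first (smallest) non-zero eigenvalue of $-\Delta_K$ is $\lambda_1=n-1$. Its eigenspace in $L^2(\nu_K)$ is exactly $n$-dimensional,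 and it is spanned by the functions $\langle x^*_K,\xi\rangle=\langle\cdot,\xi\rangle/h_K$, $\xi\in E$, where $x^*_K(\theta)=\theta/h_K(\theta)$ for $\theta\in\mathbb S^*$. -/

import Mathlib

noncomputable section

namespace HilbertBrunnMinkowski

open MeasureTheory Metric
open scoped ContDiff

/-- The support function `h_K(y) = max_{x ∈ K} ⟨y, x⟩` (the dual of `E` is identified with `E`
through the scalar product). -/
def supportFun {E : Type*} [NormedAddCommGroup E] [InnerProductSpace ℝ E]
    (K : ConvexBody E) (y : E) : ℝ :=
  sSup ((fun x : E => inner ℝ y x) '' (K : Set E))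

/-- The class `𝒦^∞_+`: convex bodies with the origin in the interior, with `C^∞` boundary of strictly
positive curvature. Near each boundary point `K` is the sublevel set `{ρ ≤ 0}` of a `C^∞` function
with nonzero differential, and the second fundamental form of `∂K` with respect to the outer
normal, which is `D²ρ / |Dρ|` on the tangent space `ker Dρ`, is positive definite. -/
structure IsSmoothPos {E : Type*} [NormedAddCommGroup E] [InnerProductSpace ℝ E]
    (K : ConvexBody E) : Prop where
  zero_mem_interior : (0 : E) ∈ interior (K : Set E)
  smooth_boundary : ∀ x ∈ frontier (K : Set E), ∃ (U : Set E) (ρ : E → ℝ),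
    IsOpen U ∧ x ∈ U ∧ ContDiffOn ℝ ∞ ρ U ∧ (K : Set E) ∩ U = {y ∈ U | ρ y ≤ 0} ∧
    fderiv ℝ ρ x ≠ 0 ∧
    ∀ u : E, u ≠ 0 → fderiv ℝ ρ x u = 0 → 0 < fderiv ℝ (fderiv ℝ ρ) x u u

/-- The `1`-homogeneous extension to `E` of a function on the unit sphere. -/
def homExt {E : Type*} [NormedAddCommGroup E] [InnerProductSpace ℝ E]
    (u : sphere (0 : E) 1 → ℝ) (x : E) : ℝ :=
  open Classical in
  if hx : x = 0 then 0
  else ‖x‖ * u ⟨‖x‖⁻¹ • x, by simp [norm_smul, norm_ne_zero_iff.mpr hx]⟩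

/-- `z ∈ C²(𝕊)`: the homogeneous extension is `C²` away from the origin. -/
def IsC2 {E : Type*} [NormedAddCommGroup E] [InnerProductSpace ℝ E]
    (z : sphere (0 : E) 1 → ℝ) : Prop :=
  ContDiffOn ℝ 2 (homExt z) {0}ᶜ

/-- The tangent space `T_θ 𝕊 = θ^⊥` of the unit sphere. -/
abbrev tangent {E : Type*} [NormedAddCommGroup E] [InnerProductSpace ℝ E]
    (θ : sphere (0 : E) 1) : Submodule ℝ E :=
  (Submodule.span ℝ {(θ : E)})ᗮ

/-- The tensor `D²u` at `θ`: the restriction to `T_θ 𝕊` of the second derivative at `θ` of the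
`1`-homogeneous extension of `u`, as an endomorphism of the Euclidean space `T_θ 𝕊`, so that
`⟨D²u(θ) v, w⟩` is the second derivative in the directions `v, w`. -/
def hess {E : Type*} [NormedAddCommGroup E] [InnerProductSpace ℝ E] [FiniteDimensional ℝ E]
    (u : sphere (0 : E) 1 → ℝ) (θ : sphere (0 : E) 1) : Module.End ℝ (tangent θ) :=
  (((tangent θ).orthogonalProjectionOnto ∘L fderiv ℝ (gradient (homExt u)) θ ∘L
    (tangent θ).subtypeL : tangent θ →L[ℝ] tangent θ) : tangent θ →ₗ[ℝ] tangent θ)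

/-- The support function restricted to the unit sphere. -/
def supp {E : Type*} [NormedAddCommGroup E] [InnerProductSpace ℝ E]
    (K : ConvexBody E) (θ : sphere (0 : E) 1) : ℝ :=
  supportFun K θ

/-- The Hilbert--Brunn--Minkowski operator
`Δ_K z = ((D²h_K)⁻¹)^{ij} D²_{ij}(z h_K) - (n - 1) z` on functions on the unit sphere. -/
def laplacian {E : Type*} [NormedAddCommGroup E] [InnerProductSpace ℝ E] [FiniteDimensional ℝ E]
    (K : ConvexBody E) (z : sphere (0 : E) 1 → ℝ) (θ : sphere (0 : E) 1) : ℝ :=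
  LinearMap.trace ℝ (tangent θ)
      (Ring.inverse (hess (supp K) θ) * hess (fun η => z η * supp K η) θ)
    - ((Module.finrank ℝ E : ℝ) - 1) * z θ

/-- The centro-affine volume measure `ν_K = h_K det(D²h_K) 𝔪 = n V_K` on the unit sphere, where `𝔪`
is the Lebesgue measure on the sphere and `V_K` the cone-volume measure. -/
def nu {E : Type*} [NormedAddCommGroup E] [InnerProductSpace ℝ E] [FiniteDimensional ℝ E]
    [MeasurableSpace E] [BorelSpace E] (K : ConvexBody E) : Measure (sphere (0 : E) 1) :=
  (volume : Measure E).toSphere.withDensity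
    (fun θ => ENNReal.ofReal (supp K θ * LinearMap.det (hess (supp K) θ)))

/-- The graph in `L²(ν_K) × L²(ν_K)` of the self-adjoint extension of `-Δ_K` from `C²(𝕊)`. As `-Δ_K` is
essentially self-adjoint on `C²(𝕊)`, this extension is the closure of the operator, i.e. its graph
is the closure of the graph `{(z, -Δ_K z) ; z ∈ C²(𝕊)}`. -/
def negLaplacianGraph {E : Type*} [NormedAddCommGroup E] [InnerProductSpace ℝ E]
    [FiniteDimensional ℝ E] [MeasurableSpace E] [BorelSpace E] (K : ConvexBody E) :
    Submodule ℝ (Lp ℝ 2 (nu K) × Lp ℝ 2 (nu K)) :=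
  (Submodule.span ℝ {p : Lp ℝ 2 (nu K) × Lp ℝ 2 (nu K) | ∃ z : sphere (0 : E) 1 → ℝ, IsC2 z ∧
    p.1 =ᵐ[nu K] z ∧ p.2 =ᵐ[nu K] fun θ => -laplacian K z θ}).topologicalClosure

/-- The eigenspace `{f ; -Δ_K f = c f}` of the self-adjoint operator `-Δ_K` on `L²(ν_K)`. -/
def eigenspace {E : Type*} [NormedAddCommGroup E] [InnerProductSpace ℝ E]
    [FiniteDimensional ℝ E] [MeasurableSpace E] [BorelSpace E] (K : ConvexBody E) (c : ℝ) :
    Submodule ℝ (Lp ℝ 2 (nu K)) :=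
  (negLaplacianGraph K).comap (LinearMap.prod LinearMap.id (c • LinearMap.id))

/-- `c` is an eigenvalue of the self-adjoint operator `-Δ_K` on `L²(ν_K)`. -/
def IsEigenvalue {E : Type*} [NormedAddCommGroup E] [InnerProductSpace ℝ E]
    [FiniteDimensional ℝ E] [MeasurableSpace E] [BorelSpace E] (K : ConvexBody E) (c : ℝ) : Prop :=
  eigenspace K c ≠ ⊥

/-- The function `⟨x*_K, ξ⟩ = ⟨·, ξ⟩ / h_K` on the unit sphere; here `x*_K(θ) = θ / h_K(θ)` is the
centro-affine conormal of `∂K`. -/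
def lin {E : Type*} [NormedAddCommGroup E] [InnerProductSpace ℝ E]
    (K : ConvexBody E) (ξ : E) (θ : sphere (0 : E) 1) : ℝ :=
  inner ℝ ((supp K θ)⁻¹ • (θ : E)) ξ

end HilbertBrunnMinkowski

end

/-! Write h for the support function and, for z in C², put Tz = Δ_K z + (n-1)z, the trace of
(D²h)⁻¹D²(zh) (`hessTrace`). The whole argument rests on one variational identity, a form of the
symmetry of mixed volumes: ∫ h (d/dt) det D²(h + tu) at t = 0 equals (n-1) ∫ u det D²h, integrals
over the sphere (`integral_detDeriv_fullHess`). It comes from the fact that the Jacobian determinant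
is a null Lagrangian (`integral_detDeriv_eq_zero`), applied to cut-off gradients of h²/2 and hu and
read in polar coordinates.

The identity is used in three ways. With u = zh it computes the mean of Tz, so eigenfunctions with
non-zero eigenvalue are orthogonal to constants. With u = z²h it gives nonnegativity of -Δ_K. With h
+ su in place of h, its coefficient of s is the integrated Bochner formula ∫ |D²(zh)|² = ∫ (Tz)² -
(n-2) ∫ z Tz (`integral_hessSq`), the norm being taken with respect to D²h. As D²(zh) lives on an
(n-1)-dimensional space, (Tz)² ≤ (n-1)|D²(zh)|² pointwise; for n ≥ 3 this yields (n-1) ∫ z Tz ≤ ∫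
(Tz)², which excludes eigenvalues strictly between 0 and n-1. For n = 2 the Bochner formula carries
no information, and Minkowski's inequality (∫ 1)(∫ z Tz) ≤ (∫ z)² replaces it
(`integral_mul_hessTrace_le_sq`); it follows from Wirtinger's inequality on the circle.

If z = ⟨·,ξ⟩/h then zh is linear and Tz = 0, so z is an eigenfunction for n-1. Conversely, an
element f of that eigenspace is a limit in L² of C² functions z_k with Tz_k → 0. Bochner's formula
gives D²(z_k h) → 0 in L², and a Poincaré inequality for the gradient of z_k h
(`exists_lintegral_sub_inner_le`) makes z_k close in L¹ to functions ⟨·,ξ_k⟩/h. These form a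
finite-dimensional, hence closed, space, which therefore contains f (`exists_eq_linLp`).

No elliptic regularity and no spectral theorem enter: every inequality is a closed condition on the
graph, checked on C² functions only (`of_mem_negLaplacianGraph`). That h is C² with D²h positive
definite on tangent spaces is deduced from the inverse function theorem applied to the Lagrange
conditions for the maximizer (`hasFDerivAt_supportPt`). -/

noncomputable section

namespace HilbertBrunnMinkowski

open MeasureTheory Metric
open scoped ContDiff

set_option linter.unusedSectionVars false

/-! ### Polynomial families and determinants -/

section PolynomialFamilies

open Polynomial

/-- A family of real polynomials with continuous coefficients. -/
def ContinuousCoeff {α : Type*} [TopologicalSpace α] (p : α → ℝ[X]) : Prop :=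
  ∀ k, Continuous fun x => (p x).coeff k

variable {α : Type*} [TopologicalSpace α]

lemma ContinuousCoeff.mul {p q : α → ℝ[X]} (hp : ContinuousCoeff p) (hq : ContinuousCoeff q) :
    ContinuousCoeff fun x => p x * q x := by
  intro k
  simp only [coeff_mul]
  exact continuous_finsetSum _ fun i _ => (hp _).mul (hq _)

lemma ContinuousCoeff.sum {ι : Type*} {s : Finset ι} {p : ι → α → ℝ[X]}
    (hp : ∀ i, ContinuousCoeff (p i)) : ContinuousCoeff fun x => ∑ i ∈ s, p i x := by
  intro k
  simp only [finsetSum_coeff]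
  exact continuous_finsetSum _ fun i _ => hp i k

lemma ContinuousCoeff.prod {ι : Type*} {s : Finset ι} {p : ι → α → ℝ[X]}
    (hp : ∀ i, ContinuousCoeff (p i)) : ContinuousCoeff fun x => ∏ i ∈ s, p i x := by
  classical
  induction s using Finset.induction_on with
  | empty => intro k; simpa using continuous_const
  | insert a s ha ih => simpa [Finset.prod_insert ha] using (hp a).mul ih

/-- The polynomial `det (A + X B)`. -/
def detPoly {n : ℕ} (A B : Matrix (Fin n) (Fin n) ℝ) : ℝ[X] :=
  Matrix.det ((X : ℝ[X]) • B.map C + A.map C)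

variable {n : ℕ}

lemma continuousCoeff_detPoly {A B : α → Matrix (Fin n) (Fin n) ℝ} (hA : Continuous A)
    (hB : Continuous B) : ContinuousCoeff fun x => detPoly (A x) (B x) := by
  simp only [detPoly, Matrix.det_apply']
  refine ContinuousCoeff.sum fun σ => ContinuousCoeff.mul (fun k => continuous_const)
    (ContinuousCoeff.prod fun i k => ?_)
  simp only [Matrix.add_apply, Matrix.smul_apply, Matrix.map_apply, smul_eq_mul, coeff_add]
  rcases k with _ | k
  · simp only [mul_coeff_zero, coeff_X_zero, zero_mul, coeff_C_zero, zero_add]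
    exact hA.matrix_elem _ _
  · simp only [coeff_X_mul, coeff_C, Nat.add_eq_zero_iff, one_ne_zero, and_false, if_false,
      add_zero]
    split_ifs
    exacts [hB.matrix_elem _ _, continuous_const]

lemma eval_detPoly (A B : Matrix (Fin n) (Fin n) ℝ) (t : ℝ) :
    (detPoly A B).eval t = (A + t • B).det := by
  rw [detPoly, ← coe_evalRingHom, RingHom.map_det]
  congr 1
  ext i j
  simp [add_comm (A i j), mul_comm t]

lemma natDegree_detPoly_le (A B : Matrix (Fin n) (Fin n) ℝ) : (detPoly A B).natDegree ≤ n := by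
  exact (natDegree_det_X_add_C_le B A).trans (Fintype.card_fin n).le

lemma coeff_zero_detPoly (A B : Matrix (Fin n) (Fin n) ℝ) : (detPoly A B).coeff 0 = A.det :=
    coeff_det_X_add_C_zero B A

lemma coeff_top_detPoly (A B : Matrix (Fin n) (Fin n) ℝ) : (detPoly A B).coeff n = B.det := by
  simpa [detPoly] using coeff_det_X_add_C_card B A

/-- The derivative of the determinant at `A` in the direction `B`. -/
def detDeriv (A B : Matrix (Fin n) (Fin n) ℝ) : ℝ := (detPoly A B).coeff 1

lemma hasDerivAt_det_add_smul (A B : Matrix (Fin n) (Fin n) ℝ) :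
    HasDerivAt (fun t : ℝ => (A + t • B).det) (detDeriv A B) 0 := by
  have h := (detPoly A B).hasDerivAt 0
  rw [← coeff_zero_eq_eval_zero, coeff_derivative] at h
  simpa [eval_detPoly, detDeriv] using h

/-- Jacobi's formula: factor out A and use that det(1 + tM) has derivative tr M at 0. -/
lemma detDeriv_eq {A : Matrix (Fin n) (Fin n) ℝ} (hA : A.det ≠ 0) (B : Matrix (Fin n) (Fin n) ℝ) :
    detDeriv A B = A.det * (A⁻¹ * B).trace := by
  refine (hasDerivAt_det_add_smul A B).unique ?_
  have h1 : ∀ t : ℝ, (A + t • B).det = A.det * (1 + t • (A⁻¹ * B)).det := fun t => by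
    rw [← Matrix.det_mul, mul_add, mul_one, Matrix.mul_smul, ← mul_assoc,
      Matrix.mul_nonsing_inv _ (isUnit_iff_ne_zero.2 hA), one_mul]
  simp only [h1]
  refine HasDerivAt.const_mul _ ?_
  refine (hasDerivAt_det_add_smul 1 (A⁻¹ * B)).congr_deriv ?_
  have h2 := Matrix.derivative_det_one_add_X_smul (A⁻¹ * B)
  rw [← coeff_zero_eq_eval_zero, coeff_derivative] at h2
  simp only [detDeriv, detPoly]
  rw [← h2]
  simp [add_comm, Matrix.smul_eq_diagonal_mul]

lemma detDeriv_zero_right (A : Matrix (Fin n) (Fin n) ℝ) : detDeriv A 0 = 0 := by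
  have h := hasDerivAt_det_add_smul A 0
  simp only [smul_zero, add_zero] at h
  exact h.unique (hasDerivAt_const _ _)

end PolynomialFamilies

/-! ### Integrals of polynomial families -/

section PolynomialIntegral

open Polynomial

variable {α : Type*} [MeasurableSpace α]

/-- If the integral of a polynomial family is constant near `0`, then the integrals of the
coefficients of positive degree vanish. -/
lemma integral_coeff_eq_zero {μ : Measure α} {p : α → ℝ[X]} {N : ℕ}
    (hN : ∀ x, (p x).natDegree ≤ N) (hp : ∀ k, Integrable (fun x => (p x).coeff k) μ) {δ c : ℝ}
    (hδ : 0 < δ) (h : ∀ s : ℝ, |s| < δ → ∫ x, (p x).eval s ∂μ = c) {k : ℕ} (hk : k ≠ 0) :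
    ∫ x, (p x).coeff k ∂μ = 0 := by
  have hzero : ∀ j, N < j → ∀ x, (p x).coeff j = 0 := fun j hj x =>
    coeff_eq_zero_of_natDegree_lt ((hN x).trans_lt hj)
  -- P is the polynomial s ↦ ∫ p_x(s) dμ(x). It agrees with the constant c on an interval, hence
  -- everywhere.
  let P : ℝ[X] := ∑ j ∈ Finset.range (N + 1), monomial j (∫ x, (p x).coeff j ∂μ)
  have hP : P = C c := by
    refine eq_of_infinite_eval_eq _ _ ((Set.Ioo_infinite hδ).mono fun s hs => ?_)
    have h1 := h s (abs_lt.2 ⟨by linarith [hs.1], hs.2⟩)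
    have h2 : ∀ x, (p x).eval s = ∑ j ∈ Finset.range (N + 1), (p x).coeff j * s ^ j := fun x =>
      eval_eq_sum_range' (Nat.lt_succ_of_le (hN x)) s
    simp only [h2] at h1
    rw [integral_finsetSum _ fun j _ => (hp j).mul_const _] at h1
    simp only [Set.mem_ofPred_eq, P, eval_finsetSum, eval_monomial, eval_C]
    rw [← h1]
    exact Finset.sum_congr rfl fun j _ => (integral_mul_const _ _).symm
  rcases lt_or_ge N k with hNk | hNk
  · simp [hzero k hNk]
  have h3 : P.coeff k = ∫ x, (p x).coeff k ∂μ := by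
    simp only [P, finsetSum_coeff, coeff_monomial]
    rw [Finset.sum_ite_eq' , if_pos (Finset.mem_range.2 (Nat.lt_succ_of_le hNk))]
  rw [← h3, hP, coeff_C, if_neg hk]

end PolynomialIntegral

/-! ### The Jacobian determinant is a null Lagrangian -/

section NullLagrangian

variable {E : Type*} [NormedAddCommGroup E] [InnerProductSpace ℝ E] [FiniteDimensional ℝ E]
  [MeasurableSpace E] [BorelSpace E]

/-- The integral of the Jacobian of the perturbation `x ↦ x + s Y x` of the identity. -/
lemma exists_integral_det_one_add {Y : E → E} (hY : ContDiff ℝ 1 Y) {R : ℝ}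
    (hR : ∀ x, x ∉ ball (0 : E) R → Y x = 0) (hYc : HasCompactSupport Y) :
    ∃ δ > 0, ∀ s : ℝ, |s| < δ →
      ∫ x in ball (0 : E) R, (1 + s • fderiv ℝ Y x).det = volume.real (ball (0 : E) R) := by
  obtain ⟨L, hL⟩ := hY.lipschitzWith_of_hasCompactSupport hYc one_ne_zero
  have hdet : ∀ᶠ T : E →L[ℝ] E in nhds 0, 0 < (1 + T).det := by
    have hc : ContinuousAt (fun T : E →L[ℝ] E => (1 + T).det) 0 :=
      (ContinuousLinearMap.continuous_det.comp (continuous_const.add continuous_id)).continuousAt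
    refine hc.eventually (lt_mem_nhds ?_)
    simp [ContinuousLinearMap.det]
  obtain ⟨ε, hε, hεdet⟩ := Metric.eventually_nhds_iff.1 hdet
  have hL1 : (0 : ℝ) < L + 1 := by positivity
  -- |s| L < 1 makes sY a contraction, so that x ↦ x + sY(x) is bijective; |s| L < ε keeps its
  -- Jacobian positive. Dividing by L + 1 avoids the case L = 0.
  refine ⟨min 1 ε / (L + 1), by positivity, fun s hs => ?_⟩
  have hs' : |s| * (L + 1) < min 1 ε := by rwa [lt_div_iff₀ hL1] at hs
  have hsL : |s| * L < min 1 ε := lt_of_le_of_lt (by nlinarith [abs_nonneg s]) hs'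
  set Ψ : E → E := fun x => x + s • Y x with hΨ
  have hfd : ∀ x, HasFDerivAt Ψ (1 + s • fderiv ℝ Y x) x := fun x =>
    (hasFDerivAt_id x).add (((hY.differentiable one_ne_zero) x).hasFDerivAt.const_smul s)
  have hpos : ∀ x, 0 < (1 + s • fderiv ℝ Y x).det := fun x => by
    refine hεdet ?_
    rw [dist_zero_right, norm_smul, Real.norm_eq_abs]
    calc |s| * ‖fderiv ℝ Y x‖ ≤ |s| * L := by
          gcongr; exact norm_fderiv_le_of_lipschitz ℝ hL
      _ < ε := hsL.trans_le (min_le_right _ _)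
  have happ : ApproximatesLinearOn Ψ ((ContinuousLinearEquiv.refl ℝ E : E ≃L[ℝ] E) : E →L[ℝ] E)
      Set.univ (‖s‖₊ * L) := by
    rintro x - y -
    have h1 := hL.dist_le_mul x y
    rw [dist_eq_norm, dist_eq_norm] at h1
    have h2 : Ψ x - Ψ y - ((ContinuousLinearEquiv.refl ℝ E : E ≃L[ℝ] E) : E →L[ℝ] E) (x - y)
        = s • (Y x - Y y) := by
      simp [hΨ, smul_sub]; abel
    rw [h2, norm_smul]
    push_cast
    rw [mul_assoc]
    gcongr
  have hc : Subsingleton E ∨ ‖s‖₊ * L <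
      ‖(((ContinuousLinearEquiv.refl ℝ E).symm : E ≃L[ℝ] E) : E →L[ℝ] E)‖₊⁻¹ := by
    rcases subsingleton_or_nontrivial E with h | h
    · exact Or.inl h
    · right
      have : ‖(((ContinuousLinearEquiv.refl ℝ E).symm : E ≃L[ℝ] E) : E →L[ℝ] E)‖₊ = 1 := by
        have : (((ContinuousLinearEquiv.refl ℝ E).symm : E ≃L[ℝ] E) : E →L[ℝ] E)
          = ContinuousLinearMap.id ℝ E := rfl
        rw [this]; ext; simp
      rw [this, inv_one, ← NNReal.coe_lt_coe]
      push_cast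
      exact hsL.trans_le (min_le_left _ _)
  have hinj : Function.Injective Ψ := Set.injOn_univ.1 (happ.injOn hc)
  have hsurj : Function.Surjective Ψ := happ.surjective hc
  have hout : ∀ x, x ∉ ball (0 : E) R → Ψ x = x := fun x hx => by simp [hΨ, hR x hx]
  -- A bijection which is the identity outside the ball maps the ball onto itself; the change of
  -- variables formula then evaluates the integral as the volume of the ball.
  have himg : Ψ '' ball (0 : E) R = ball 0 R := by
    apply Set.Subset.antisymm
    · rintro _ ⟨x, hx, rfl⟩
      by_contra hn
      exact hn ((hinj (hout _ hn)).symm ▸ hx)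
    · intro y hy
      obtain ⟨x, rfl⟩ := hsurj y
      refine ⟨x, ?_, rfl⟩
      by_contra hn
      exact hn (hout x hn ▸ hy)
  have key := integral_image_eq_integral_abs_det_fderiv_smul volume
    (measurableSet_ball (x := (0 : E)) (ε := R)) (fun x _ => (hfd x).hasFDerivWithinAt)
    hinj.injOn (fun _ => (1 : ℝ))
  rw [himg] at key
  simp only [smul_eq_mul, mul_one, abs_of_pos (hpos _)] at key
  rw [← key]
  simp

variable {n : ℕ} (b : Module.Basis (Fin n) ℝ E)

/-- The matrix of an endomorphism in the basis `b`. -/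
abbrev matOf (T : E →L[ℝ] E) : Matrix (Fin n) (Fin n) ℝ := LinearMap.toMatrix b b (T : E →ₗ[ℝ] E)

lemma det_matOf (T : E →L[ℝ] E) : (matOf b T).det = T.det := by
  simp [matOf, ContinuousLinearMap.det, LinearMap.det_toMatrix]

lemma continuous_matOf : Continuous (matOf b) := by
  have : matOf b = ((LinearMap.toMatrix b b).toLinearMap ∘ₗ
    (ContinuousLinearMap.coeLM ℝ : (E →L[ℝ] E) →ₗ[ℝ] (E →ₗ[ℝ] E))) := rfl
  rw [this]
  exact LinearMap.continuous_of_finiteDimensional _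

lemma integrableOn_ball_of_continuous {f : E → ℝ} (hf : Continuous f) (R : ℝ) :
    IntegrableOn f (ball (0 : E) R) :=
  (hf.continuousOn.integrableOn_compact (isCompact_closedBall 0 R)).mono_set ball_subset_closedBall

/-- det(1 + sDY) is a polynomial in s with coefficient det DY in degree n, and its integral does not
depend on s near 0. Since n ≥ 1, the integral of that coefficient vanishes. -/
lemma integral_det_fderiv_eq_zero [Nontrivial E] (b : Module.Basis (Fin n) ℝ E) {Y : E → E} (hY : ContDiff ℝ 1 Y) {R : ℝ}
    (hR : ∀ x, x ∉ ball (0 : E) R → Y x = 0) (hYc : HasCompactSupport Y) :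
    ∫ x in ball (0 : E) R, (fderiv ℝ Y x).det = 0 := by
  have hn : n ≠ 0 := by
    rw [← Module.finrank_eq_card_basis b |>.trans (Fintype.card_fin n)]
    exact Module.finrank_pos.ne'
  obtain ⟨δ, hδ, h⟩ := exists_integral_det_one_add hY hR hYc
  have hcont : Continuous fun x => matOf b (fderiv ℝ Y x) :=
    (continuous_matOf b).comp (hY.continuous_fderiv one_ne_zero)
  have key := integral_coeff_eq_zero (μ := volume.restrict (ball (0 : E) R))
    (p := fun x => detPoly 1 (matOf b (fderiv ℝ Y x))) (N := n) (fun x => natDegree_detPoly_le _ _)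
    (fun k => integrableOn_ball_of_continuous
      (continuousCoeff_detPoly continuous_const hcont k) R) hδ
    (c := volume.real (ball (0 : E) R)) (fun s hs => ?_) hn
  · simpa only [coeff_top_detPoly, det_matOf] using key
  · rw [← h s hs]
    congr 1
    ext x
    rw [eval_detPoly, ← det_matOf b]
    congr 1
    simp [matOf, LinearMap.toMatrix_one]

/-- The linearized Jacobian determinant of compactly supported fields has zero integral. -/
lemma integral_detDeriv_eq_zero [Nontrivial E] {Y Z : E → E} (hY : ContDiff ℝ 1 Y)
    (hZ : ContDiff ℝ 1 Z) {R : ℝ} (hYR : ∀ x, x ∉ ball (0 : E) R → Y x = 0)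
    (hZR : ∀ x, x ∉ ball (0 : E) R → Z x = 0) :
    ∫ x in ball (0 : E) R, detDeriv (matOf b (fderiv ℝ Y x)) (matOf b (fderiv ℝ Z x)) = 0 := by
  have hcY : Continuous fun x => matOf b (fderiv ℝ Y x) :=
    (continuous_matOf b).comp (hY.continuous_fderiv one_ne_zero)
  have hcZ : Continuous fun x => matOf b (fderiv ℝ Z x) :=
    (continuous_matOf b).comp (hZ.continuous_fderiv one_ne_zero)
  -- The previous lemma applies to Y + sZ for every s; the coefficient of s is extracted.
  refine integral_coeff_eq_zero (μ := volume.restrict (ball (0 : E) R))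
    (p := fun x => detPoly (matOf b (fderiv ℝ Y x)) (matOf b (fderiv ℝ Z x))) (N := n)
    (fun x => natDegree_detPoly_le _ _)
    (fun k => integrableOn_ball_of_continuous (continuousCoeff_detPoly hcY hcZ k) R) one_pos
    (c := 0) (fun s _ => ?_) one_ne_zero
  have hYZ : ∀ x, x ∉ ball (0 : E) R → (Y + s • Z) x = 0 := fun x hx => by
    simp [hYR x hx, hZR x hx]
  rw [← integral_det_fderiv_eq_zero b (hY.add (hZ.const_smul s)) hYZ
    (HasCompactSupport.intro (isCompact_closedBall 0 R) fun x hx => hYZ x fun h =>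
      hx (ball_subset_closedBall h))]
  congr 1
  ext x
  have hd : fderiv ℝ (fun x => Y x + s • Z x) x = fderiv ℝ Y x + s • fderiv ℝ Z x := by
    rw [fderiv_fun_add (g := fun x => s • Z x) (hY.differentiable one_ne_zero x)
      ((hZ.differentiable one_ne_zero x).const_smul s), fderiv_fun_const_smul
      (hZ.differentiable one_ne_zero x)]
  rw [eval_detPoly, hd, ← det_matOf b]
  simp [matOf]

end NullLagrangian

/-! ### Integration in polar coordinates -/

section Polar

open Set ENNReal

variable {E : Type*} [NormedAddCommGroup E] [InnerProductSpace ℝ E] [FiniteDimensional ℝ E]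
  [MeasurableSpace E] [BorelSpace E] [Nontrivial E]

lemma homeomorphUnitSphereProd_reconstruct (x : ({0}ᶜ : Set E)) :
    ((homeomorphUnitSphereProd E x).2 : ℝ) • ((homeomorphUnitSphereProd E x).1 : E) = x := by
  have hx : ‖(x : E)‖ ≠ 0 := norm_ne_zero_iff.2 x.2
  simp [smul_smul, hx]

lemma integral_polar {F : E → ℝ} (hF : Integrable F) :
    ∫ x, F x = ∫ θ : sphere (0 : E) 1, ∫ r in Ioi (0 : ℝ),
      r ^ (Module.finrank ℝ E - 1) * F (r • (θ : E)) ∂volume ∂(volume : Measure E).toSphere := by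
  set G : sphere (0 : E) 1 × Ioi (0 : ℝ) → ℝ := fun p => F ((p.2 : ℝ) • (p.1 : E)) with hG
  have hmp := (volume : Measure E).measurePreserving_homeomorphUnitSphereProd
  have hcomp : ∀ x : ({0}ᶜ : Set E), G (homeomorphUnitSphereProd E x) = F x := fun x => by
    rw [hG]; dsimp only; rw [homeomorphUnitSphereProd_reconstruct]
  have hint : Integrable G ((volume : Measure E).toSphere.prod
      (.volumeIoiPow (Module.finrank ℝ E - 1))) := by
    rw [← hmp.integrable_comp_emb (Homeomorph.measurableEmbedding _)]
    have : G ∘ homeomorphUnitSphereProd E = F ∘ Subtype.val := funext hcomp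
    rw [this]
    exact (integrableOn_iff_comap_subtypeVal (by measurability)).1 hF.integrableOn
  calc ∫ x, F x = ∫ x : ({(0 : E)}ᶜ : Set E), F x ∂(Measure.comap Subtype.val volume) := by
        rw [integral_subtype_comap (measurableSet_singleton _).compl F,
          restrict_compl_singleton]
    _ = ∫ p, G p ∂((volume : Measure E).toSphere.prod
          (.volumeIoiPow (Module.finrank ℝ E - 1))) := by
        rw [← hmp.integral_comp (Homeomorph.measurableEmbedding _) G]
        exact integral_congr_ae (.of_forall fun x => (hcomp x).symm)
    _ = _ := by
        rw [integral_prod _ hint]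
        refine integral_congr_ae (.of_forall fun θ => ?_)
        simp only [Measure.volumeIoiPow, ENNReal.ofReal]
        rw [integral_withDensity_eq_integral_smul,
          integral_subtype_comap measurableSet_Ioi
            fun a ↦ Real.toNNReal (a ^ (Module.finrank ℝ E - 1)) • F (a • (θ : E)),
          setIntegral_congr_fun measurableSet_Ioi fun x hx ↦ ?_]
        · rw [NNReal.smul_def, Real.coe_toNNReal _ (pow_nonneg (le_of_lt hx) _), smul_eq_mul]
        · exact (measurable_subtype_coe.pow_const _).real_toNNReal

lemma lintegral_polar {F : E → ℝ≥0∞} (hF : Measurable F) :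
    ∫⁻ x, F x = ∫⁻ θ : sphere (0 : E) 1, ∫⁻ r in Ioi (0 : ℝ),
      .ofReal (r ^ (Module.finrank ℝ E - 1)) * F (r • (θ : E)) ∂volume
        ∂(volume : Measure E).toSphere := by
  set G : sphere (0 : E) 1 × Ioi (0 : ℝ) → ℝ≥0∞ := fun p => F ((p.2 : ℝ) • (p.1 : E)) with hG
  have hmp := (volume : Measure E).measurePreserving_homeomorphUnitSphereProd
  have hcomp : ∀ x : ({0}ᶜ : Set E), G (homeomorphUnitSphereProd E x) = F x := fun x => by
    rw [hG]; dsimp only; rw [homeomorphUnitSphereProd_reconstruct]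
  have hGm : Measurable G := hF.comp (by fun_prop)
  calc ∫⁻ x, F x = ∫⁻ x : ({(0 : E)}ᶜ : Set E), F x ∂(Measure.comap Subtype.val volume) := by
        rw [lintegral_subtype_comap (measurableSet_singleton _).compl F,
          restrict_compl_singleton]
    _ = ∫⁻ p, G p ∂((volume : Measure E).toSphere.prod
          (.volumeIoiPow (Module.finrank ℝ E - 1))) := by
        rw [← hmp.lintegral_comp hGm]
        exact lintegral_congr fun x => (hcomp x).symm
    _ = _ := by
        rw [lintegral_prod _ hGm.aemeasurable]
        refine lintegral_congr fun θ => ?_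
        simp only [Measure.volumeIoiPow]
        rw [lintegral_withDensity_eq_lintegral_mul _ (by fun_prop)
          (g := fun y => G (θ, y)) (hGm.comp measurable_prodMk_left),
          ← lintegral_subtype_comap measurableSet_Ioi]
        rfl

/-- Integration of a function which is a product of a function of a positive `1`-homogeneous function
and of a `0`-homogeneous function. -/
lemma integral_radial {F : E → ℝ} (hF : Integrable F) {f w : sphere (0 : E) 1 → ℝ}
    (hf : ∀ θ, 0 < f θ) {κ : ℝ → ℝ}
    (h : ∀ θ : sphere (0 : E) 1, ∀ r : ℝ, 0 < r → F (r • (θ : E)) = κ (r * f θ) * w θ) :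
    ∫ x, F x = (∫ s in Ioi (0 : ℝ), s ^ (Module.finrank ℝ E - 1) * κ s) *
      ∫ θ, w θ / f θ ^ Module.finrank ℝ E ∂(volume : Measure E).toSphere := by
  rw [integral_polar hF, ← integral_const_mul]
  refine integral_congr_ae (.of_forall fun θ => ?_)
  dsimp only
  have hn : Module.finrank ℝ E = (Module.finrank ℝ E - 1) + 1 :=
    (Nat.succ_pred_eq_of_pos Module.finrank_pos).symm
  set m := Module.finrank ℝ E - 1
  have hfθ := (hf θ).ne'
  have h1 : ∀ r ∈ Ioi (0 : ℝ), r ^ m * F (r • (θ : E))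
      = (w θ / f θ ^ m) * ((r * f θ) ^ m * κ (r * f θ)) := fun r hr => by
    rw [h θ r hr, mul_pow]; field_simp
  -- The substitution s = r f(θ) makes the radial integral independent of θ and leaves the factor
  -- f(θ)⁻ⁿ.
  rw [setIntegral_congr_fun measurableSet_Ioi h1, integral_const_mul,
    integral_comp_mul_right_Ioi (fun s => s ^ m * κ s) 0 (hf θ), zero_mul, hn, smul_eq_mul]
  field_simp
  ring

end Polar

/-! ### Matrix algebra -/

section MatrixAlgebra

open Matrix

variable {n : ℕ}

/-- The value V depends only on the position A and the velocity A', so the derivative along any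
curve equals the one along the line A + tA', which defines `detDeriv`. -/
lemma exists_hasDerivAt_det (A A' : Matrix (Fin n) (Fin n) ℝ) :
    ∃ V : ℝ, ∀ (P : ℝ → Matrix (Fin n) (Fin n) ℝ) (t : ℝ), P t = A →
      (∀ i j, HasDerivAt (fun s => P s i j) (A' i j) t) → HasDerivAt (fun s => (P s).det) V t := by
  refine ⟨∑ σ : Equiv.Perm (Fin n), ((Equiv.Perm.sign σ : ℤ) : ℝ) *
    ∑ i, (∏ j ∈ Finset.univ.erase i, A (σ j) j) • A' (σ i) i, fun P t hP h => ?_⟩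
  simp only [Matrix.det_apply']
  refine HasDerivAt.fun_sum fun σ _ => HasDerivAt.const_mul _ ?_
  have := HasDerivAt.fun_finsetProd (u := Finset.univ) fun i _ => h (σ i) i
  simpa only [hP] using this

/-- The derivative of the determinant along a curve of matrices. -/
lemma hasDerivAt_det {P : ℝ → Matrix (Fin n) (Fin n) ℝ} {P' : Matrix (Fin n) (Fin n) ℝ} {t : ℝ}
    (h : ∀ i j, HasDerivAt (fun s => P s i j) (P' i j) t) :
    HasDerivAt (fun s => (P s).det) (detDeriv (P t) P') t := by
  obtain ⟨V, hV⟩ := exists_hasDerivAt_det (P t) P'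
  have h1 : HasDerivAt (fun s : ℝ => (P t + s • P').det) V 0 := by
    refine hV _ _ (by simp) fun i j => ?_
    simpa using ((hasDerivAt_id (0 : ℝ)).mul_const (P' i j)).const_add (P t i j)
  rw [(hasDerivAt_det_add_smul _ _).unique h1]
  exact hV P t rfl h

lemma detDeriv_add (A B B' : Matrix (Fin n) (Fin n) ℝ) :
    detDeriv A (B + B') = detDeriv A B + detDeriv A B' := by
  have key : ∀ D, detDeriv A D = ∑ σ : Equiv.Perm (Fin n), ((Equiv.Perm.sign σ : ℤ) : ℝ) *
    ∑ i, (∏ j ∈ Finset.univ.erase i, A (σ j) j) • D (σ i) i := fun D => by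
    refine (hasDerivAt_det_add_smul A D).unique ?_
    simp only [Matrix.det_apply']
    refine HasDerivAt.fun_sum fun σ _ => HasDerivAt.const_mul _ ?_
    have := HasDerivAt.fun_finsetProd (u := Finset.univ) (x := (0 : ℝ))
      (f := fun i s => (A + s • D) (σ i) i) (f' := fun i => D (σ i) i) fun i _ => by
        simpa using ((hasDerivAt_id (0 : ℝ)).mul_const (D (σ i) i)).const_add (A (σ i) i)
    simpa using this
  simp only [key, Matrix.add_apply, smul_add, Finset.sum_add_distrib, mul_add]

lemma detDeriv_smul (A B : Matrix (Fin n) (Fin n) ℝ) (c : ℝ) :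
    detDeriv A (c • B) = c * detDeriv A B := by
  have h := (hasDerivAt_det_add_smul A B)
  have h1 : HasDerivAt (fun t : ℝ => (A + (t * c) • B).det) (detDeriv A B * c) 0 := by
    have h2 : HasDerivAt (fun t : ℝ => (A + t • B).det) (detDeriv A B) ((fun t : ℝ => t * c) 0) := by
      simpa using h
    have h3 := h2.comp (0 : ℝ) ((hasDerivAt_id (0 : ℝ)).mul_const c)
    rw [one_mul] at h3
    exact h3
  have h3 := hasDerivAt_det_add_smul A (c • B)
  simp only [smul_smul] at h3
  rw [h3.unique h1, mul_comm]

/-! The factorization `M = Rᵀ R` of a positive definite matrix. -/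

open scoped MatrixOrder in
lemma exists_isUnit_transpose_mul_self {M : Matrix (Fin n) (Fin n) ℝ} (hM : M.PosDef) :
    ∃ R : Matrix (Fin n) (Fin n) ℝ, IsUnit R ∧ M = Rᵀ * R := by
  obtain ⟨R, hR⟩ := CStarAlgebra.nonneg_iff_eq_star_mul_self.mp hM.posSemidef.nonneg
  have hR' : M = Rᵀ * R := by simpa [star_eq_conjTranspose] using hR
  refine ⟨R, ?_, hR'⟩
  have h1 := (Matrix.isUnit_iff_isUnit_det _).1 hM.isUnit
  rw [hR', Matrix.det_mul] at h1
  exact (Matrix.isUnit_iff_isUnit_det _).2 (isUnit_of_mul_isUnit_right h1)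

/-- The congruence by R reduces M to the identity: B' = R⁻ᵀBR⁻¹ is symmetric and conjugate to M⁻¹B,
so the trace of the square of M⁻¹B is the squared Frobenius norm of B'. The trace inequalities below
thereby reduce to the Euclidean case. -/
lemma exists_symmetric_conj {M : Matrix (Fin n) (Fin n) ℝ} (hM : M.PosDef)
    {B : Matrix (Fin n) (Fin n) ℝ} (hB : Bᵀ = B) :
    ∃ R B' : Matrix (Fin n) (Fin n) ℝ, M = Rᵀ * R ∧ B = Rᵀ * B' * R ∧
      (M⁻¹ * B * (M⁻¹ * B)).trace = ∑ i, ∑ j, B' i j ^ 2 := by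
  obtain ⟨R, hR, hMR⟩ := exists_isUnit_transpose_mul_self hM
  have hRd := (Matrix.isUnit_iff_isUnit_det _).1 hR
  have hRd' : IsUnit Rᵀ.det := by rwa [Matrix.det_transpose]
  refine ⟨R, Rᵀ⁻¹ * B * R⁻¹, hMR, ?_, ?_⟩
  · rw [mul_assoc, mul_assoc, Matrix.nonsing_inv_mul _ hRd, mul_one,
      Matrix.mul_nonsing_inv_cancel_left _ _ hRd']
  · set B' := Rᵀ⁻¹ * B * R⁻¹ with hB'
    have hsymm : B'ᵀ = B' := by
      rw [hB', Matrix.transpose_mul, Matrix.transpose_mul, hB, Matrix.transpose_nonsing_inv,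
        Matrix.transpose_nonsing_inv, Matrix.transpose_transpose, mul_assoc]
    have h1 : M⁻¹ * B * (M⁻¹ * B) = R⁻¹ * (B' * B' * R) := by
      rw [hB', hMR, Matrix.mul_inv_rev]
      simp only [mul_assoc]
      rw [Matrix.nonsing_inv_mul _ hRd, mul_one]
    rw [h1, Matrix.trace_mul_comm, mul_assoc, Matrix.mul_nonsing_inv _ hRd, mul_one]
    nth_rewrite 2 [← hsymm]
    simp [Matrix.trace, Matrix.mul_apply, pow_two]

lemma trace_inv_mul_sq_nonneg {M : Matrix (Fin n) (Fin n) ℝ} (hM : M.PosDef)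
    {B : Matrix (Fin n) (Fin n) ℝ} (hB : Bᵀ = B) : 0 ≤ (M⁻¹ * B * (M⁻¹ * B)).trace := by
  obtain ⟨R, B', -, -, h⟩ := exists_symmetric_conj hM hB
  rw [h]
  positivity

/-- In the variables Rv and Rw this is the Cauchy–Schwarz inequality used twice: for the pairing of
Rv with B'Rw, then for each row of B'. -/
lemma sq_dotProduct_mulVec_le {M : Matrix (Fin n) (Fin n) ℝ} (hM : M.PosDef)
    {B : Matrix (Fin n) (Fin n) ℝ} (hB : Bᵀ = B) (v w : Fin n → ℝ) :
    (v ⬝ᵥ B *ᵥ w) ^ 2 ≤ (v ⬝ᵥ M *ᵥ v) * (w ⬝ᵥ M *ᵥ w) * (M⁻¹ * B * (M⁻¹ * B)).trace := by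
  obtain ⟨R, B', hM', hB', h⟩ := exists_symmetric_conj hM hB
  rw [h]
  have hq : ∀ x, x ⬝ᵥ M *ᵥ x = ∑ i, (R *ᵥ x) i ^ 2 := fun x => by
    rw [hM', ← mulVec_mulVec, dotProduct_mulVec, vecMul_transpose]
    simp [dotProduct, pow_two]
  have hb : v ⬝ᵥ B *ᵥ w = ∑ i, (R *ᵥ v) i * (B' *ᵥ (R *ᵥ w)) i := by
    rw [hB', ← mulVec_mulVec, ← mulVec_mulVec, dotProduct_mulVec, vecMul_transpose]
    rfl
  rw [hq, hq, hb, mul_assoc]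
  refine (Finset.sum_mul_sq_le_sq_mul_sq Finset.univ (R *ᵥ v) (B' *ᵥ (R *ᵥ w))).trans ?_
  gcongr
  rw [mul_comm, Finset.sum_mul]
  refine Finset.sum_le_sum fun i _ => ?_
  exact Finset.sum_mul_sq_le_sq_mul_sq Finset.univ (B' i) (R *ᵥ w)

/-- Apply the nonnegativity of the trace of the square to B - τM, where τ is the mean of the
eigenvalues of M⁻¹B. -/
lemma sq_trace_le {M : Matrix (Fin n) (Fin n) ℝ} (hM : M.PosDef)
    {B : Matrix (Fin n) (Fin n) ℝ} (hB : Bᵀ = B) (hn : 0 < n) :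
    (M⁻¹ * B).trace ^ 2 ≤ n * (M⁻¹ * B * (M⁻¹ * B)).trace := by
  set τ : ℝ := (M⁻¹ * B).trace / n with hτ
  have hn' : (0 : ℝ) < n := by exact_mod_cast hn
  have hMs : Mᵀ = M := by simpa [Matrix.IsHermitian] using hM.isHermitian
  have h1 := trace_inv_mul_sq_nonneg hM (B := B - τ • M) (by simp [hB, hMs])
  have h2 : M⁻¹ * (B - τ • M) = M⁻¹ * B - τ • (1 : Matrix (Fin n) (Fin n) ℝ) := by
    rw [mul_sub, Matrix.mul_smul, Matrix.nonsing_inv_mul _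
      ((Matrix.isUnit_iff_isUnit_det _).1 hM.isUnit)]
  rw [h2] at h1
  have h3 : ((M⁻¹ * B - τ • (1 : Matrix (Fin n) (Fin n) ℝ)) *
      (M⁻¹ * B - τ • (1 : Matrix (Fin n) (Fin n) ℝ))).trace
      = (M⁻¹ * B * (M⁻¹ * B)).trace - 2 * τ * (M⁻¹ * B).trace + τ ^ 2 * n := by
    simp only [sub_mul, mul_sub, Matrix.smul_mul, Matrix.mul_smul, one_mul, mul_one,
      Matrix.trace_sub, Matrix.trace_smul, Matrix.trace_one, Fintype.card_fin, smul_eq_mul]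
    ring
  rw [h3] at h1
  have h4 : (M⁻¹ * B).trace = τ * n := by rw [hτ]; field_simp
  rw [h4] at h1 ⊢
  nlinarith

/-- The sharpened Cauchy--Schwarz inequality for a symmetric matrix with a kernel. -/
lemma sq_trace_le_of_mulVec_eq_zero {M : Matrix (Fin n) (Fin n) ℝ} (hM : M.PosDef)
    {B : Matrix (Fin n) (Fin n) ℝ} (hB : Bᵀ = B) (hn : 2 ≤ n) {t : Fin n → ℝ}
    (ht : t ⬝ᵥ t = 1) (hMt : M *ᵥ t = t) (hBt : B *ᵥ t = 0) :
    (M⁻¹ * B).trace ^ 2 ≤ (n - 1) * (M⁻¹ * B * (M⁻¹ * B)).trace := by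
  have hn' : (2 : ℝ) ≤ n := by exact_mod_cast hn
  have hMu := (Matrix.isUnit_iff_isUnit_det _).1 hM.isUnit
  have hMs : Mᵀ = M := by simpa [Matrix.IsHermitian] using hM.isHermitian
  set q := (M⁻¹ * B).trace with hq
  -- τ is the mean of the eigenvalues of M⁻¹B apart from the eigenvalue 0 on t. Adding τ t⊗t puts τ
  -- in place of that 0, and the n-dimensional inequality for the new matrix becomes the one with n
  -- - 1.
  set τ : ℝ := q / (n - 1) with hτ
  have hMit : M⁻¹ *ᵥ t = t := by
    conv_lhs => rw [← hMt]
    rw [mulVec_mulVec, Matrix.nonsing_inv_mul _ hMu, one_mulVec]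
  have htMi : t ᵥ* M⁻¹ = t := by
    rw [← mulVec_transpose, Matrix.transpose_nonsing_inv, hMs, hMit]
  have htB : t ᵥ* B = 0 := by rw [← mulVec_transpose, hB, hBt]
  have h1 := sq_trace_le hM (B := B + τ • vecMulVec t t) (by simp [hB, transpose_vecMulVec])
    (by omega)
  have h2 : M⁻¹ * (B + τ • vecMulVec t t) = M⁻¹ * B + τ • vecMulVec t t := by
    rw [mul_add, Matrix.mul_smul, mul_vecMulVec, hMit]
  have h3 : (M⁻¹ * B + τ • vecMulVec t t) * (M⁻¹ * B + τ • vecMulVec t t)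
      = M⁻¹ * B * (M⁻¹ * B) + τ ^ 2 • vecMulVec t t := by
    simp only [mul_add, add_mul, Matrix.smul_mul, Matrix.mul_smul]
    rw [mul_vecMulVec, ← mulVec_mulVec, hBt, mulVec_zero, zero_vecMulVec, vecMulVec_mul,
      ← vecMul_vecMul, htMi, htB, vecMulVec_zero, vecMulVec_mul_vecMulVec, ht, one_smul]
    simp [pow_two, smul_smul]
  have h4 : (vecMulVec t t).trace = 1 := by rw [trace_vecMulVec, ht]
  rw [h2, h3, Matrix.trace_add, Matrix.trace_add, Matrix.trace_smul, Matrix.trace_smul, h4,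
    ← hq] at h1
  simp only [smul_eq_mul, mul_one] at h1
  have h5 : q = τ * (n - 1) := by rw [hτ]; field_simp [show (n : ℝ) - 1 ≠ 0 by linarith]
  rw [h5] at h1 ⊢
  have h6 : 0 ≤ n * ((M⁻¹ * B * (M⁻¹ * B)).trace - τ ^ 2 * (n - 1)) := by nlinarith
  have h7 : 0 ≤ (M⁻¹ * B * (M⁻¹ * B)).trace - τ ^ 2 * (n - 1) :=
    nonneg_of_mul_nonneg_right h6 (by linarith)
  nlinarith

lemma det_one_add_vecMulVec (u v : Fin n → ℝ) : (1 + vecMulVec u v).det = 1 + v ⬝ᵥ u := by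
  rw [vecMulVec_eq Unit, det_one_add_replicateCol_mul_replicateRow]

/-- The determinant of the Hessian of `f² / 2` for a `1`-homogeneous function `f`, in terms of the
restriction of the Hessian `S` of `f` to the orthogonal complement of `t`. -/
lemma det_smul_add_vecMulVec {S : Matrix (Fin n) (Fin n) ℝ} (hS : Sᵀ = S) {t a : Fin n → ℝ}
    {f : ℝ} (hf : f ≠ 0) (ht : t ⬝ᵥ t = 1) (hSt : S *ᵥ t = 0) (ha : a ⬝ᵥ t = f) :
    (vecMulVec a a + f • S).det = f ^ (n + 1) * (S + vecMulVec t t).det := by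
  have htS : t ᵥ* S = 0 := by rw [← mulVec_transpose, hS, hSt]
  -- Since a/f = t + c with c orthogonal to t, the shear W = 1 + t⊗c has determinant 1, fixes S
  -- under congruence and satisfies Wᵀt = a/f. Congruence by W thus turns f² t⊗t into a⊗a.
  set c : Fin n → ℝ := f⁻¹ • a - t with hc
  have htc : t ⬝ᵥ c = 0 := by
    rw [hc, dotProduct_sub, dotProduct_smul, dotProduct_comm, ha, ht, smul_eq_mul,
      inv_mul_cancel₀ hf, sub_self]
  have htc' : t + c = f⁻¹ • a := by rw [hc]; abel
  set W : Matrix (Fin n) (Fin n) ℝ := 1 + vecMulVec t c with hW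
  have hdetW : W.det = 1 := by rw [hW, det_one_add_vecMulVec, dotProduct_comm, htc, add_zero]
  have hSW : S * W = S := by
    rw [hW, mul_add, mul_one, mul_vecMulVec, hSt, zero_vecMulVec, add_zero]
  have hWS : Wᵀ * S = S := by
    have := congrArg Matrix.transpose hSW
    rwa [Matrix.transpose_mul, hS] at this
  have htW : t ᵥ* W = f⁻¹ • a := by
    rw [hW, vecMul_add, vecMul_one, vecMul_vecMulVec, ht, one_smul, htc']
  have hWt : Wᵀ *ᵥ t = f⁻¹ • a := by rw [mulVec_transpose, htW]
  have h1 : vecMulVec a a + f • S = Wᵀ * (f • S + f ^ 2 • vecMulVec t t) * W := by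
    rw [mul_add Wᵀ, add_mul _ _ W, Matrix.mul_smul, Matrix.smul_mul, hWS, hSW, Matrix.mul_smul,
      Matrix.smul_mul, mul_vecMulVec, vecMulVec_mul, hWt, htW, add_comm]
    congr 1
    ext i j
    simp only [vecMulVec_apply, Matrix.smul_apply, Pi.smul_apply, smul_eq_mul]
    field_simp
  -- The left factor has determinant fⁿ·f, whence the exponent n + 1.
  have h2 : f • S + f ^ 2 • vecMulVec t t
      = (f • (1 + vecMulVec ((f - 1) • t) t)) * (S + vecMulVec t t) := by
    rw [Matrix.smul_mul, mul_add, add_mul, add_mul, one_mul, one_mul, vecMulVec_mul, htS,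
      vecMulVec_zero, vecMulVec_mul_vecMulVec, ht]
    ext i j
    simp only [Matrix.add_apply, Matrix.smul_apply, vecMulVec_apply, Pi.smul_apply, smul_eq_mul,
      Matrix.zero_apply]
    ring
  rw [h1, Matrix.det_mul, Matrix.det_mul, Matrix.det_transpose, hdetW, h2, Matrix.det_mul,
    Matrix.det_smul, det_one_add_vecMulVec, dotProduct_smul, ht, Fintype.card_fin]
  simp only [smul_eq_mul]
  ring

/-- The linearization of `det_smul_add_vecMulVec`. -/
lemma detDeriv_smul_add_vecMulVec {S B : Matrix (Fin n) (Fin n) ℝ} (hS : Sᵀ = S) (hB : Bᵀ = B)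
    {t a c : Fin n → ℝ} {f g : ℝ} (hf : 0 < f) (ht : t ⬝ᵥ t = 1) (hSt : S *ᵥ t = 0)
    (hBt : B *ᵥ t = 0) (ha : a ⬝ᵥ t = f) (hc : c ⬝ᵥ t = g) :
    detDeriv (vecMulVec a a + f • S) (vecMulVec a c + vecMulVec c a + f • B + g • S)
      = (n + 1) * f ^ n * g * (S + vecMulVec t t).det
        + f ^ (n + 1) * detDeriv (S + vecMulVec t t) B := by
  set P : ℝ → Matrix (Fin n) (Fin n) ℝ := fun s =>
    vecMulVec (a + s • c) (a + s • c) + (f + s * g) • (S + s • B) with hP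
  have hlin : ∀ x y : ℝ, HasDerivAt (fun s : ℝ => x + s * y) y 0 := fun x y => by
    simpa using ((hasDerivAt_id (0 : ℝ)).mul_const y).const_add x
  have h1 := hasDerivAt_det (P := P) (t := 0)
    (P' := vecMulVec a c + vecMulVec c a + f • B + g • S) fun i j => by
      have h := ((hlin (a i) (c i)).mul (hlin (a j) (c j))).add
        ((hlin f g).mul (hlin (S i j) (B i j)))
      refine (h.congr_of_eventuallyEq (.of_forall fun s => ?_)).congr_deriv ?_
      · simp [hP, vecMulVec_apply, mul_add]
      · simp [vecMulVec_apply]; ring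
  have hP0 : P 0 = vecMulVec a a + f • S := by simp [hP]
  rw [hP0] at h1
  refine h1.unique ?_
  have h2 : HasDerivAt (fun s : ℝ => (f + s * g) ^ (n + 1) * (S + vecMulVec t t + s • B).det)
      ((n + 1) * f ^ n * g * (S + vecMulVec t t).det
        + f ^ (n + 1) * detDeriv (S + vecMulVec t t) B) 0 := by
    refine (((hlin f g).pow (n + 1)).mul (hasDerivAt_det_add_smul (S + vecMulVec t t) B)).congr_deriv
      ?_
    simp
  refine h2.congr_of_eventuallyEq ?_
  have hev : ∀ᶠ s : ℝ in nhds 0, f + s * g ≠ 0 := by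
    have : ContinuousAt (fun s : ℝ => f + s * g) 0 := by fun_prop
    exact this.eventually_ne (by simpa using hf.ne')
  filter_upwards [hev] with s hs
  have h3 := det_smul_add_vecMulVec (S := S + s • B) (by simp [hS, hB]) (t := t) (a := a + s • c)
    hs ht (by simp [add_mulVec, smul_mulVec, hSt, hBt]) (by simp [add_dotProduct, ha, hc])
  rw [hP]
  dsimp only
  rw [h3]
  congr 2
  abel

/-- As xᵀH = f aᵀ, one has H + s p⊗a = (1 + (s/f) p⊗x)H, whose determinant is affine in s. In the
application H = D²(f²/2) and a = ∇f, and the hypothesis on x is Euler's identity. -/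
lemma detDeriv_vecMulVec {H : Matrix (Fin n) (Fin n) ℝ} (hH : Hᵀ = H) {x p a : Fin n → ℝ} {f : ℝ}
    (hf : f ≠ 0) (hx : H *ᵥ x = f • a) :
    detDeriv H (vecMulVec p a) = H.det * (x ⬝ᵥ p) / f := by
  refine (hasDerivAt_det_add_smul H _).unique ?_
  have h1 : ∀ s : ℝ, (H + s • vecMulVec p a).det = (1 + s * ((x ⬝ᵥ p) / f)) * H.det := fun s => by
    have hxH : x ᵥ* H = f • a := by rw [← mulVec_transpose, hH, hx]
    have h2 : H + s • vecMulVec p a = (1 + vecMulVec ((s / f) • p) x) * H := by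
      rw [add_mul, one_mul, vecMulVec_mul, hxH]
      congr 1
      ext i j
      simp only [Matrix.smul_apply, vecMulVec_apply, Pi.smul_apply, smul_eq_mul]
      field_simp
    rw [h2, Matrix.det_mul, det_one_add_vecMulVec, dotProduct_smul, smul_eq_mul]
    ring
  simp only [h1]
  refine (((((hasDerivAt_id (0 : ℝ)).mul_const ((x ⬝ᵥ p) / f)).const_add 1).mul_const
    H.det)).congr_deriv ?_
  ring

open Polynomial in
/-- The second coefficient of the determinant. -/
lemma two_mul_coeff_two_detPoly {A : Matrix (Fin n) (Fin n) ℝ} (hA : A.det ≠ 0)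
    (B : Matrix (Fin n) (Fin n) ℝ) :
    2 * (detPoly A B).coeff 2 =
      A.det * ((A⁻¹ * B).trace ^ 2 - (A⁻¹ * B * (A⁻¹ * B)).trace) := by
  set D := A⁻¹ * B with hD
  have h1 : detPoly A B = Polynomial.C A.det * detPoly 1 D := by
    refine Polynomial.funext fun t => ?_
    rw [eval_mul, eval_C, eval_detPoly, eval_detPoly, ← Matrix.det_mul, mul_add, mul_one,
      Matrix.mul_smul, hD, ← mul_assoc, Matrix.mul_nonsing_inv _ (isUnit_iff_ne_zero.2 hA), one_mul]
  have h2 : detPoly 1 (-D) = (detPoly 1 D).comp (Polynomial.C (-1) * X) := by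
    refine Polynomial.funext fun t => ?_
    simp [eval_detPoly]
  -- The coefficient of t² in det(1 + tD) det(1 - tD) = det(1 - t²D²) reads 2e₂ - (tr D)² = -tr(D²),
  -- where e₂ is the second coefficient of det(1 + tD).
  have h3 : detPoly 1 D * detPoly 1 (-D) = expand ℝ 2 (detPoly 1 (-(D * D))) := by
    refine Polynomial.funext fun t => ?_
    rw [eval_mul, expand_eval, eval_detPoly, eval_detPoly, eval_detPoly, ← Matrix.det_mul]
    congr 1
    simp only [smul_neg, mul_add, add_mul, mul_one, one_mul, Matrix.mul_neg, Matrix.smul_mul,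
      Matrix.mul_smul, smul_smul]
    rw [pow_two]
    abel
  have htr : ∀ M : Matrix (Fin n) (Fin n) ℝ, (detPoly 1 M).coeff 1 = M.trace := fun M => by
    have := detDeriv_eq (A := 1) (by simp) M
    simpa [detDeriv] using this
  have hc0 : ∀ M : Matrix (Fin n) (Fin n) ℝ, (detPoly 1 M).coeff 0 = 1 := fun M => by
    simp [coeff_zero_detPoly]
  have hc2 : (detPoly 1 (-D)).coeff 2 = (detPoly 1 D).coeff 2 := by
    rw [h2, comp_C_mul_X_coeff]; simp
  have h4 := congrArg (fun p => p.coeff 2) h3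
  simp only [coeff_mul, Finset.Nat.antidiagonal_succ, Finset.Nat.antidiagonal_zero,
    Finset.map_singleton, Finset.sum_cons, Finset.map_cons, Finset.sum_singleton,
    Function.Embedding.prodMap, Function.Embedding.coeFn_mk, Prod.map] at h4
  have h5 : (expand ℝ 2 (detPoly 1 (-(D * D)))).coeff 2 = -(D * D).trace := by
    have := coeff_expand_mul (p := 2) (by norm_num) (detPoly 1 (-(D * D))) 1
    rw [one_mul] at this
    rw [this, htr, Matrix.trace_neg]
  rw [h5] at h4
  simp only [Function.Embedding.refl_apply, Nat.succ_eq_add_one, zero_add, Nat.reduceAdd, hc0, htr,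
    hc2, Matrix.trace_neg] at h4
  rw [h1, coeff_C_mul]
  linear_combination A.det * h4

end MatrixAlgebra

/-! ### Calculus of homogeneous functions -/

section Homogeneous

open Matrix

variable {E : Type*} [NormedAddCommGroup E] [InnerProductSpace ℝ E]

/-- `1`-homogeneous functions which are `C²` away from the origin. -/
structure HomC2 (f : E → ℝ) : Prop where
  contDiffOn : ContDiffOn ℝ 2 f {0}ᶜ
  hom : ∀ r : ℝ, 0 < r → ∀ x, f (r • x) = r * f x

lemma fderiv_smul_of_homogeneous {G : Type*} [NormedAddCommGroup G] [NormedSpace ℝ G] {g : E → G}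
    {r : ℝ} {k : ℕ} (h : ∀ x, g (r • x) = r ^ k • g x) (x : E) :
    r • fderiv ℝ g (r • x) = r ^ k • fderiv ℝ g x := by
  rw [← fderiv_comp_smul]
  simp only [h]
  exact congrFun (fderiv_const_smul_field (r ^ k) (f := g)) x

lemma contDiffAt_fderiv {f : E → ℝ} (hf : ContDiffOn ℝ 2 f {0}ᶜ) {x : E} (hx : x ≠ 0) :
    ContDiffAt ℝ 1 (fderiv ℝ f) x :=
  (hf.contDiffAt (isOpen_compl_singleton.mem_nhds hx)).fderiv_right (by norm_num)

lemma differentiableAt_of_contDiffOn {f : E → ℝ} (hf : ContDiffOn ℝ 2 f {0}ᶜ) {x : E}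
    (hx : x ≠ 0) : DifferentiableAt ℝ f x :=
  (hf.contDiffAt (isOpen_compl_singleton.mem_nhds hx)).differentiableAt (by norm_num)

/-- The second derivative of a product. -/
lemma fderiv_fderiv_mul {f g : E → ℝ} (hf : ContDiffOn ℝ 2 f {0}ᶜ) (hg : ContDiffOn ℝ 2 g {0}ᶜ)
    {x : E} (hx : x ≠ 0) (v w : E) :
    fderiv ℝ (fderiv ℝ fun y => f y * g y) x v w =
      f x * fderiv ℝ (fderiv ℝ g) x v w + fderiv ℝ f x v * fderiv ℝ g x w
        + fderiv ℝ g x v * fderiv ℝ f x w + g x * fderiv ℝ (fderiv ℝ f) x v w := by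
  have h1 : (fderiv ℝ fun y => f y * g y) =ᶠ[nhds x]
      fun y => f y • fderiv ℝ g y + g y • fderiv ℝ f y := by
    filter_upwards [isOpen_compl_singleton.mem_nhds hx] with y hy
    exact fderiv_fun_mul (differentiableAt_of_contDiffOn hf hy)
      (differentiableAt_of_contDiffOn hg hy)
  have hf0 := differentiableAt_of_contDiffOn hf hx
  have hg0 := differentiableAt_of_contDiffOn hg hx
  have hf1 := (contDiffAt_fderiv hf hx).differentiableAt one_ne_zero
  have hg1 := (contDiffAt_fderiv hg hx).differentiableAt one_ne_zero
  rw [h1.fderiv_eq, fderiv_fun_add (f := fun y => f y • fderiv ℝ g y)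
      (g := fun y => g y • fderiv ℝ f y) (hf0.smul hg1) (hg0.smul hf1), fderiv_fun_smul hf0 hg1,
    fderiv_fun_smul hg0 hf1]
  simp
  ring

lemma fderiv_fderiv_symm {f : E → ℝ} (hf : ContDiffOn ℝ 2 f {0}ᶜ) {x : E} (hx : x ≠ 0) (v w : E) :
    fderiv ℝ (fderiv ℝ f) x v w = fderiv ℝ (fderiv ℝ f) x w v := by
  have h := (hf.contDiffAt (isOpen_compl_singleton.mem_nhds hx)).isSymmSndFDerivAt (by simp)
  exact h.eq v w

/-- Euler's identity. -/
lemma fderiv_self_of_homogeneous {f : E → ℝ} {k : ℕ} {x : E} (hf : DifferentiableAt ℝ f x)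
    (h : ∀ r : ℝ, 0 < r → f (r • x) = r ^ k * f x) : fderiv ℝ f x x = k * f x := by
  have h1 : HasDerivAt (fun r : ℝ => f (r • x)) (fderiv ℝ f x x) 1 := by
    have h2 : HasDerivAt (fun r : ℝ => r • x) x 1 := by
      simpa using (hasDerivAt_id (1 : ℝ)).smul_const x
    have h3 : HasFDerivAt f (fderiv ℝ f x) ((fun r : ℝ => r • x) 1) := by
      simpa using hf.hasFDerivAt
    exact h3.comp_hasDerivAt (1 : ℝ) h2
  have h4 : HasDerivAt (fun r : ℝ => r ^ k * f x) (k * f x) 1 := by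
    simpa using (hasDerivAt_pow k (1 : ℝ)).mul_const (f x)
  refine h1.unique (h4.congr_of_eventuallyEq ?_)
  filter_upwards [lt_mem_nhds (zero_lt_one' ℝ)] with r hr using h r hr

/-- Differentiate Euler's identity Df(y)y = k f(y) in the direction v. For k = 1 the position vector
lies in the kernel of D²f. -/
lemma fderiv_fderiv_self_of_homogeneous {f : E → ℝ} {k : ℕ} (hf : ContDiffOn ℝ 2 f {0}ᶜ)
    (h : ∀ r : ℝ, 0 < r → ∀ x, f (r • x) = r ^ k * f x) {x : E} (hx : x ≠ 0) (v : E) :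
    fderiv ℝ (fderiv ℝ f) x v x = (k - 1) * fderiv ℝ f x v := by
  have h1 : (fun y => fderiv ℝ f y y) =ᶠ[nhds x] fun y => (k : ℝ) * f y := by
    filter_upwards [isOpen_compl_singleton.mem_nhds hx] with y hy
    exact fderiv_self_of_homogeneous (differentiableAt_of_contDiffOn hf hy) fun r hr => h r hr y
  have h2 := h1.fderiv_eq (𝕜 := ℝ)
  have hf0 := differentiableAt_of_contDiffOn hf hx
  have hf1 := (contDiffAt_fderiv hf hx).differentiableAt one_ne_zero
  rw [fderiv_clm_apply (u := fun y => y) hf1 differentiableAt_fun_id, fderiv_const_mul hf0] at h2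
  have h3 := congrArg (fun T : E →L[ℝ] ℝ => T v) h2
  simp at h3
  linarith

variable {n : ℕ} (b : OrthonormalBasis (Fin n) ℝ E)

/-- The coordinates of a vector in an orthonormal basis. -/
def coord (x : E) : Fin n → ℝ := fun i => inner ℝ (b i) x

/-- The partial derivatives of a function. -/
def gradCoord (f : E → ℝ) (x : E) : Fin n → ℝ := fun i => fderiv ℝ f x (b i)

/-- The Hessian matrix of a function. -/
def hessMatrix (f : E → ℝ) (x : E) : Matrix (Fin n) (Fin n) ℝ :=
  Matrix.of fun i j => fderiv ℝ (fderiv ℝ f) x (b i) (b j)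

/-- The gradient field of a function. -/
def gradField (f : E → ℝ) (x : E) : E := ∑ i, fderiv ℝ f x (b i) • b i

lemma sum_coord_smul (x : E) : ∑ i, coord b x i • b i = x := b.sum_repr' x

lemma clm_eq_sum_coord (T : E →L[ℝ] ℝ) (x : E) : T x = (fun i => T (b i)) ⬝ᵥ coord b x := by
  conv_lhs => rw [← sum_coord_smul b x]
  simp [dotProduct, mul_comm]

lemma coord_dotProduct (x y : E) : coord b x ⬝ᵥ coord b y = inner ℝ x y := by
  rw [← b.sum_inner_mul_inner x y]
  simp [coord, dotProduct, real_inner_comm]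

lemma gradCoord_dotProduct_coord (f : E → ℝ) (x v : E) :
    gradCoord b f x ⬝ᵥ coord b v = fderiv ℝ f x v := (clm_eq_sum_coord b _ v).symm

lemma hessMatrix_mulVec_coord (f : E → ℝ) (x v : E) :
    hessMatrix b f x *ᵥ coord b v = fun i => fderiv ℝ (fderiv ℝ f) x (b i) v := by
  ext i
  exact (clm_eq_sum_coord b (fderiv ℝ (fderiv ℝ f) x (b i)) v).symm

lemma coord_dotProduct_hessMatrix (f : E → ℝ) (x v w : E) :
    coord b v ⬝ᵥ hessMatrix b f x *ᵥ coord b w = fderiv ℝ (fderiv ℝ f) x v w := by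
  rw [hessMatrix_mulVec_coord, dotProduct_comm]
  exact (clm_eq_sum_coord b ((ContinuousLinearMap.apply ℝ ℝ w).comp (fderiv ℝ (fderiv ℝ f) x))
    v).symm

lemma transpose_hessMatrix {f : E → ℝ} (hf : ContDiffOn ℝ 2 f {0}ᶜ) {x : E} (hx : x ≠ 0) :
    (hessMatrix b f x)ᵀ = hessMatrix b f x := by
  ext i j
  exact fderiv_fderiv_symm hf hx _ _

lemma hessMatrix_mul {f g : E → ℝ} (hf : ContDiffOn ℝ 2 f {0}ᶜ) (hg : ContDiffOn ℝ 2 g {0}ᶜ)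
    {x : E} (hx : x ≠ 0) :
    hessMatrix b (fun y => f y * g y) x = vecMulVec (gradCoord b f x) (gradCoord b g x)
      + vecMulVec (gradCoord b g x) (gradCoord b f x) + f x • hessMatrix b g x
      + g x • hessMatrix b f x := by
  ext i j
  simp only [hessMatrix, Matrix.of_apply, fderiv_fderiv_mul hf hg hx, Matrix.add_apply,
    vecMulVec_apply, gradCoord, Matrix.smul_apply, smul_eq_mul]
  ring

lemma hessMatrix_smul_of_homogeneous {f : E → ℝ} {r : ℝ} (hr : 0 < r) {k : ℕ}
    (h : ∀ x, f (r • x) = r ^ (k + 1) • f x) (x : E) :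
    r • hessMatrix b f (r • x) = r ^ k • hessMatrix b f x := by
  have h1 : ∀ x, fderiv ℝ f (r • x) = r ^ k • fderiv ℝ f x := fun x => by
    have := fderiv_smul_of_homogeneous h x
    rw [pow_succ', mul_smul] at this
    exact smul_right_injective _ hr.ne' this
  have h2 := fderiv_smul_of_homogeneous (g := fderiv ℝ f) h1 x
  ext i j
  have h3 := congrArg (fun T : E →L[ℝ] E →L[ℝ] ℝ => T (b i) (b j)) h2
  simpa [hessMatrix] using h3

lemma continuousOn_hessMatrix {f : E → ℝ} (hf : ContDiffOn ℝ 2 f {0}ᶜ) :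
    ContinuousOn (hessMatrix b f) {0}ᶜ := by
  refine fun x hx => ContinuousAt.continuousWithinAt ?_
  have h := ((contDiffAt_fderiv hf hx).fderiv_right (m := 0) (by simp)).continuousAt
  refine continuousAt_pi.2 fun i => continuousAt_pi.2 fun j => ?_
  exact (h.clm_apply continuousAt_const).clm_apply continuousAt_const

lemma inner_gradField (f : E → ℝ) (x : E) (i : Fin n) :
    inner ℝ (b i) (gradField b f x) = fderiv ℝ f x (b i) := by
  simp [gradField, inner_sum, inner_smul_right, b.inner_eq_ite]

lemma contDiffAt_gradField {f : E → ℝ} (hf : ContDiffOn ℝ 2 f {0}ᶜ) {x : E} (hx : x ≠ 0) :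
    ContDiffAt ℝ 1 (gradField b f) x := by
  refine ContDiffAt.sum fun i _ => ContDiffAt.smul ?_ contDiffAt_const
  exact (contDiffAt_fderiv hf hx).clm_apply contDiffAt_const

lemma matOf_apply [FiniteDimensional ℝ E] (T : E →L[ℝ] E) (i j : Fin n) :
    matOf b.toBasis T i j = inner ℝ (b i) (T (b j)) := by
  simp [matOf, LinearMap.toMatrix_apply, b.repr_apply_apply]

lemma inner_fderiv_gradField {f : E → ℝ} (hf : ContDiffOn ℝ 2 f {0}ᶜ) {x : E} (hx : x ≠ 0)
    (i : Fin n) (v : E) :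
    inner ℝ (b i) (fderiv ℝ (gradField b f) x v) = fderiv ℝ (fderiv ℝ f) x v (b i) := by
  have h1 := ((contDiffAt_gradField b hf hx).differentiableAt one_ne_zero)
  have h2 : fderiv ℝ (fun y => inner ℝ (b i) (gradField b f y)) x v
      = inner ℝ (b i) (fderiv ℝ (gradField b f) x v) := by
    rw [fderiv_inner_apply ℝ (differentiableAt_const _) h1]
    simp
  rw [← h2]
  simp only [inner_gradField]
  have hf1 := (contDiffAt_fderiv hf hx).differentiableAt one_ne_zero
  rw [fderiv_clm_apply hf1 (differentiableAt_const _)]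
  simp

lemma matOf_fderiv_gradField [FiniteDimensional ℝ E] {f : E → ℝ} (hf : ContDiffOn ℝ 2 f {0}ᶜ)
    {x : E} (hx : x ≠ 0) : matOf b.toBasis (fderiv ℝ (gradField b f) x) = hessMatrix b f x := by
  ext i j
  rw [matOf_apply, inner_fderiv_gradField b hf hx, fderiv_fderiv_symm hf hx]
  rfl

end Homogeneous

/-! ### Symmetry of the first variation of the volume -/

section Variation

open Matrix

variable {E : Type*} [NormedAddCommGroup E] [InnerProductSpace ℝ E]

lemma HomC2.zero {f : E → ℝ} (hf : HomC2 f) : f 0 = 0 := by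
  have := hf.hom 2 two_pos 0
  rw [smul_zero] at this
  linarith

lemma HomC2.continuousOn_sphere {f : E → ℝ} (hf : HomC2 f) :
    Continuous fun θ : sphere (0 : E) 1 => f θ :=
  hf.contDiffOn.continuousOn.comp_continuous continuous_subtype_val
    fun θ => ne_zero_of_mem_unit_sphere θ

lemma HomC2.eq_norm_mul {f : E → ℝ} (hf : HomC2 f) {x : E} (hx : x ≠ 0) :
    f x = ‖x‖ * f (‖x‖⁻¹ • x) := by
  have hx' : 0 < ‖x‖ := norm_pos_iff.2 hx
  rw [← hf.hom _ hx', smul_smul, mul_inv_cancel₀ hx'.ne', one_smul]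

lemma HomC2.exists_bounds [FiniteDimensional ℝ E] [Nontrivial E] {f : E → ℝ} (hf : HomC2 f)
    (hpos : ∀ x ≠ 0, 0 < f x) :
    ∃ m M : ℝ, 0 < m ∧ 0 < M ∧ ∀ x, m * ‖x‖ ≤ f x ∧ f x ≤ M * ‖x‖ := by
  have hcomp : CompactSpace (sphere (0 : E) 1) := isCompact_iff_compactSpace.1 (isCompact_sphere 0 1)
  have hne : Nonempty (sphere (0 : E) 1) :=
    (NormedSpace.sphere_nonempty.2 zero_le_one).to_subtype
  obtain ⟨θ₁, -, h1⟩ := isCompact_univ.exists_isMinOn (Set.univ_nonempty (α := sphere (0 : E) 1))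
    hf.continuousOn_sphere.continuousOn
  obtain ⟨θ₂, -, h2⟩ := isCompact_univ.exists_isMaxOn (Set.univ_nonempty (α := sphere (0 : E) 1))
    hf.continuousOn_sphere.continuousOn
  refine ⟨f θ₁, f θ₂, hpos _ (ne_zero_of_mem_unit_sphere _), hpos _ (ne_zero_of_mem_unit_sphere _),
    fun x => ?_⟩
  rcases eq_or_ne x 0 with rfl | hx
  · simp [hf.zero]
  have hx' : ‖x‖ ≠ 0 := norm_ne_zero_iff.2 hx
  set θ : sphere (0 : E) 1 := ⟨‖x‖⁻¹ • x, by simp [norm_smul, hx']⟩ with hθ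
  have h3 : f x = ‖x‖ * f θ := hf.eq_norm_mul hx
  rw [h3, mul_comm (f _), mul_comm (f _)]
  exact ⟨mul_le_mul_of_nonneg_left (h1 (Set.mem_univ θ)) (norm_nonneg x),
    mul_le_mul_of_nonneg_left (h2 (Set.mem_univ θ)) (norm_nonneg x)⟩

variable [FiniteDimensional ℝ E] [Nontrivial E]

lemma HomC2.eventually_lt {f : E → ℝ} (hf : HomC2 f) (hpos : ∀ x ≠ 0, 0 < f x) {a : ℝ}
    (ha : 0 < a) : ∀ᶠ x in nhds (0 : E), f x < a := by
  obtain ⟨m, M, hm, hM, h⟩ := hf.exists_bounds hpos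
  have h1 : ∀ᶠ x in nhds (0 : E), M * ‖x‖ < a := by
    have : ContinuousAt (fun x : E => M * ‖x‖) 0 := by fun_prop
    exact this.eventually_lt_const (by simpa using ha)
  filter_upwards [h1] with x hx using (h x).2.trans_lt hx

variable {F : Type*} [NormedAddCommGroup F] [NormedSpace ℝ F]

/-- The field V may be singular at the origin. There f is small, so the factor ρ(f), which vanishes
for f < a, removes the singularity. -/
lemma contDiff_cutoff {k : WithTop ℕ∞} (hk : k ≤ 2) {f : E → ℝ} (hf : HomC2 f)
    (hpos : ∀ x ≠ 0, 0 < f x)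
    {ρ : ℝ → ℝ} (hρ : ContDiff ℝ k ρ) {a : ℝ} (ha : 0 < a) (hρa : ∀ s < a, ρ s = 0)
    {V : E → F} (hV : ∀ x ≠ 0, ContDiffAt ℝ k V x) : ContDiff ℝ k fun x => ρ (f x) • V x := by
  refine contDiff_iff_contDiffAt.2 fun x => ?_
  rcases eq_or_ne x 0 with rfl | hx
  · refine contDiffAt_const (c := (0 : F)) |>.congr_of_eventuallyEq ?_
    filter_upwards [hf.eventually_lt hpos ha] with y hy
    rw [hρa _ hy, zero_smul]
  · exact (hρ.contDiffAt.comp x ((hf.contDiffOn.contDiffAt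
      (isOpen_compl_singleton.mem_nhds hx)).of_le hk)).smul (hV x hx)

lemma continuous_cutoff {f : E → ℝ} (hf : HomC2 f) (hpos : ∀ x ≠ 0, 0 < f x)
    {ρ : ℝ → ℝ} (hρ : Continuous ρ) {a : ℝ} (ha : 0 < a) (hρa : ∀ s < a, ρ s = 0)
    {V : E → F} (hV : ContinuousOn V {0}ᶜ) : Continuous fun x => ρ (f x) • V x := by
  have := contDiff_cutoff (k := 0) (by norm_num) hf hpos (contDiff_zero.2 hρ) ha hρa
    (V := V) fun x hx => ?_
  · exact this.continuous
  · exact (contDiffOn_zero.2 hV).contDiffAt (isOpen_compl_singleton.mem_nhds hx)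

variable [MeasurableSpace E] [BorelSpace E] {n : ℕ} (b : OrthonormalBasis (Fin n) ℝ E)

/-- The Hessian matrix of a `1`-homogeneous function, modified to be the identity in the radial
direction. -/
def fullHess (f : E → ℝ) (x : E) : Matrix (Fin n) (Fin n) ℝ :=
  hessMatrix b f x + vecMulVec (coord b x) (coord b x)

lemma HomC2.hessMatrix_mulVec_self {f : E → ℝ} (hf : HomC2 f) {x : E} (hx : x ≠ 0) :
    hessMatrix b f x *ᵥ coord b x = 0 := by
  rw [hessMatrix_mulVec_coord]
  ext i
  rw [fderiv_fderiv_self_of_homogeneous (k := 1) hf.contDiffOn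
    (fun r hr y => by simpa using hf.hom r hr y) hx]
  simp

lemma HomC2.gradCoord_dotProduct_self {f : E → ℝ} (hf : HomC2 f) {x : E} (hx : x ≠ 0) :
    gradCoord b f x ⬝ᵥ coord b x = f x := by
  rw [gradCoord_dotProduct_coord, fderiv_self_of_homogeneous (k := 1)
    (differentiableAt_of_contDiffOn hf.contDiffOn hx) fun r hr => by simpa using hf.hom r hr x]
  simp

lemma continuous_coord : Continuous (coord b) := by
  refine continuous_pi fun i => ?_
  exact continuous_const.inner continuous_id

lemma continuousOn_fullHess {f : E → ℝ} (hf : ContDiffOn ℝ 2 f {0}ᶜ) :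
    ContinuousOn (fullHess b f) {0}ᶜ := by
  refine (continuousOn_hessMatrix b hf).add (Continuous.continuousOn ?_)
  exact (continuous_coord b).matrix_vecMulVec (continuous_coord b)

lemma continuousOn_detDeriv {α : Type*} [TopologicalSpace α] {s : Set α}
    {A B : α → Matrix (Fin n) (Fin n) ℝ} (hA : ContinuousOn A s) (hB : ContinuousOn B s) :
    ContinuousOn (fun x => detDeriv (A x) (B x)) s := by
  rw [continuousOn_iff_continuous_domRestrict] at hA hB ⊢
  exact continuousCoeff_detPoly hA hB 1

lemma fderiv_half_sq {f : E → ℝ} {x : E} (hf : DifferentiableAt ℝ f x) :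
    fderiv ℝ (fun y => f y * (2⁻¹ * f y)) x = f x • fderiv ℝ f x := by
  rw [fderiv_fun_mul hf (hf.const_mul _), fderiv_const_mul hf, smul_smul, ← add_smul]
  congr 1
  ring

lemma hessMatrix_half_sq {f : E → ℝ} (hf : ContDiffOn ℝ 2 f {0}ᶜ) {x : E} (hx : x ≠ 0) :
    hessMatrix b (fun y => f y * (2⁻¹ * f y)) x
      = vecMulVec (gradCoord b f x) (gradCoord b f x) + f x • hessMatrix b f x := by
  have h1 : fderiv ℝ (fun y => (2⁻¹ : ℝ) * f y) = fun y => (2⁻¹ : ℝ) • fderiv ℝ f y :=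
    fderiv_const_smul_field (2⁻¹ : ℝ) (f := f)
  have h2 : fderiv ℝ (fun y => (2⁻¹ : ℝ) • fderiv ℝ f y) = fun y =>
      (2⁻¹ : ℝ) • fderiv ℝ (fderiv ℝ f) y :=
    fderiv_const_smul_field (2⁻¹ : ℝ) (f := fderiv ℝ f)
  rw [hessMatrix_mul b hf (contDiffOn_const.mul hf) hx]
  ext i j
  simp only [hessMatrix, gradCoord, h1, h2, Matrix.add_apply, vecMulVec_apply, Matrix.smul_apply,
    Matrix.of_apply, _root_.smul_apply, smul_eq_mul]
  ring

/-- A pair of cutoff functions, the second being `1` near the support of the first. -/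
lemma exists_cutoff_pair : ∃ ρ χ : ℝ → ℝ, ContDiff ℝ 2 ρ ∧ ContDiff ℝ 2 χ ∧ (∀ s, 0 ≤ ρ s) ∧
    ρ 2 = 1 ∧ (∀ s, s ∉ Set.Ioo 1 3 → ρ s = 0) ∧ (∀ s ∈ Set.Ioo (1 / 2) (7 / 2), χ s = 1) ∧
    (∀ s, s ∉ Set.Ioo (1 / 4) 4 → χ s = 0) := by
  let ρ : ContDiffBump (2 : ℝ) := ⟨1 / 2, 1, by norm_num, by norm_num⟩
  let χ : ContDiffBump (2 : ℝ) := ⟨3 / 2, 7 / 4, by norm_num, by norm_num⟩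
  refine ⟨ρ, χ, ρ.contDiff, χ.contDiff, fun s => ρ.nonneg, ρ.one_of_mem_closedBall ?_, fun s hs =>
    ρ.zero_of_le_dist ?_, fun s hs => χ.one_of_mem_closedBall ?_, fun s hs => χ.zero_of_le_dist ?_⟩
  · exact mem_closedBall_self (by norm_num [ρ])
  · rw [Real.dist_eq]
    by_contra hc
    rw [not_le, abs_lt] at hc
    exact hs ⟨by linarith [hc.1], by linarith [hc.2]⟩
  · rw [mem_closedBall, Real.dist_eq, abs_le]
    change -(3 / 2) ≤ _ ∧ _ ≤ (3 / 2 : ℝ)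
    exact ⟨by linarith [hs.1], by linarith [hs.2]⟩
  · rw [Real.dist_eq]
    by_contra hc
    rw [not_le, abs_lt] at hc
    change -(7 / 4) < _ ∧ _ < (7 / 4 : ℝ) at hc
    exact hs ⟨by linarith [hc.1], by linarith [hc.2]⟩

lemma matOf_fderiv_cutoff {f G : E → ℝ} (hf : ContDiffOn ℝ 2 f {0}ᶜ) (hG : ContDiffOn ℝ 2 G {0}ᶜ)
    {ρ : ℝ → ℝ} (hρ : Differentiable ℝ ρ) {x : E} (hx : x ≠ 0) :
    matOf b.toBasis (fderiv ℝ (fun y => ρ (f y) • gradField b G y) x)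
      = ρ (f x) • hessMatrix b G x
        + deriv ρ (f x) • vecMulVec (gradCoord b G x) (gradCoord b f x) := by
  have h1 := (contDiffAt_gradField b hG hx).differentiableAt one_ne_zero
  have hf0 := differentiableAt_of_contDiffOn hf hx
  have h2 : HasFDerivAt (fun y => ρ (f y)) (deriv ρ (f x) • fderiv ℝ f x) x :=
    (hρ (f x)).hasDerivAt.comp_hasFDerivAt x hf0.hasFDerivAt
  have h3 := (h2.smul h1.hasFDerivAt).fderiv
  ext i j
  rw [matOf_apply]
  change inner ℝ (b i) (fderiv ℝ ((fun y => ρ (f y)) • gradField b G) x (b j)) = _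
  rw [h3]
  simp only [_root_.add_apply, _root_.smul_apply,
    ContinuousLinearMap.smulRight_apply, inner_add_right, inner_smul_right, inner_gradField,
    inner_fderiv_gradField b hG hx, Matrix.add_apply, Matrix.smul_apply, vecMulVec_apply, gradCoord,
    smul_eq_mul, hessMatrix, Matrix.of_apply]
  rw [fderiv_fderiv_symm hG hx]
  ring

/-- This is the null Lagrangian identity for Y = χ(f)∇(f²/2) and Z = ρ(f)∇(fg). Where Z lives χ(f) =
1, so Y is a plain gradient. The derivative of Z has a Hessian part and a rank-one part
ρ'(f)∇(fg)⊗∇f; the latter is evaluated through D²(f²/2)x = f∇f and ⟨x, ∇(fg)⟩ = 2fg. -/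
lemma integral_cutoff_eq_zero {f g : E → ℝ} (hf : HomC2 f) (hpos : ∀ x ≠ 0, 0 < f x)
    (hg : HomC2 g) {ρ χ : ℝ → ℝ} (hρ : ContDiff ℝ 2 ρ) (hχ : ContDiff ℝ 2 χ)
    (hρ0 : ∀ s, s ∉ Set.Ioo 1 3 → ρ s = 0) (hχ1 : ∀ s ∈ Set.Ioo (1 / 2) (7 / 2), χ s = 1)
    (hχ0 : ∀ s, s ∉ Set.Ioo (1 / 4) 4 → χ s = 0) :
    ∫ x, (ρ (f x) • detDeriv (hessMatrix b (fun y => f y * (2⁻¹ * f y)) x)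
          (hessMatrix b (fun y => f y * g y) x)
        + deriv ρ (f x) • ((hessMatrix b (fun y => f y * (2⁻¹ * f y)) x).det * (2 * g x))) = 0 := by
  obtain ⟨m, M, hm, hM, hmM⟩ := hf.exists_bounds hpos
  set F : E → ℝ := fun y => f y * (2⁻¹ * f y) with hF
  set G : E → ℝ := fun y => f y * g y with hG
  have hFc : ContDiffOn ℝ 2 F {0}ᶜ := hf.contDiffOn.mul (contDiffOn_const.mul hf.contDiffOn)
  have hGc : ContDiffOn ℝ 2 G {0}ᶜ := hf.contDiffOn.mul hg.contDiffOn
  have hF2 : ∀ r : ℝ, 0 < r → ∀ x, F (r • x) = r ^ 2 * F x := fun r hr x => by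
    simp only [hF, hf.hom r hr]; ring
  have hG2 : ∀ r : ℝ, 0 < r → ∀ x, G (r • x) = r ^ 2 * G x := fun r hr x => by
    simp only [hG, hf.hom r hr, hg.hom r hr]; ring
  have hρd : ∀ s, s ∉ Set.Icc 1 3 → deriv ρ s = 0 := fun s hs => by
    have h1 : ρ =ᶠ[nhds s] fun _ => 0 := by
      filter_upwards [isClosed_Icc.isOpen_compl.mem_nhds hs] with t ht
      exact hρ0 t fun h => ht ⟨h.1.le, h.2.le⟩
    rw [h1.deriv_eq, deriv_const]
  have hbig : ∀ x, x ∉ ball (0 : E) (4 / m) → 4 ≤ f x := fun x hx => by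
    rw [mem_ball_zero_iff, not_lt, div_le_iff₀ hm, mul_comm] at hx
    exact hx.trans (hmM x).1
  have hY : ContDiff ℝ 1 fun x => χ (f x) • gradField b F x :=
    contDiff_cutoff (by norm_num) hf hpos (hχ.of_le (by norm_num)) (a := 1 / 4) (by norm_num)
      (fun s hs => hχ0 s fun h => absurd h.1 (by linarith)) fun x hx => contDiffAt_gradField b hFc hx
  have hX : ContDiff ℝ 1 fun x => ρ (f x) • gradField b G x :=
    contDiff_cutoff (by norm_num) hf hpos (hρ.of_le (by norm_num)) (a := 1) (by norm_num)
      (fun s hs => hρ0 s fun h => absurd h.1 (by linarith)) fun x hx => contDiffAt_gradField b hGc hx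
  have key := integral_detDeriv_eq_zero b.toBasis hY hX (R := 4 / m)
    (fun x hx => by
      rw [hχ0 _ fun h => absurd h.2 (by linarith [hbig x hx]), zero_smul])
    (fun x hx => by
      rw [hρ0 _ fun h => absurd h.2 (by linarith [hbig x hx]), zero_smul])
  rw [← key, ← setIntegral_eq_integral_of_forall_compl_eq_zero (s := ball (0 : E) (4 / m))]
  · refine setIntegral_congr_ae measurableSet_ball ?_
    filter_upwards [compl_mem_ae_iff.2 (measure_singleton (0 : E))] with x hx _
    have hx' : x ≠ 0 := hx
    rw [matOf_fderiv_cutoff b hf.contDiffOn hGc (hρ.differentiable (by norm_num)) hx']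
    by_cases hfx : f x ∈ Set.Icc 1 3
    · have hYF : (fun y => χ (f y) • gradField b F y) =ᶠ[nhds x] gradField b F := by
        have hc : ContinuousAt f x := (differentiableAt_of_contDiffOn hf.contDiffOn hx').continuousAt
        have : Set.Ioo (1 / 2 : ℝ) (7 / 2) ∈ nhds (f x) :=
          Ioo_mem_nhds (by linarith [hfx.1]) (by linarith [hfx.2])
        filter_upwards [hc this] with y hy
        rw [hχ1 _ hy, one_smul]
      rw [hYF.fderiv_eq, matOf_fderiv_gradField b hFc hx', detDeriv_add, detDeriv_smul,
        detDeriv_smul, detDeriv_vecMulVec (transpose_hessMatrix b hFc hx') (x := coord b x)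
          (f := f x) (hpos x hx').ne']
      · rw [dotProduct_comm, gradCoord_dotProduct_coord, fderiv_self_of_homogeneous (k := 2)
          (differentiableAt_of_contDiffOn hGc hx') fun r hr => hG2 r hr x]
        simp only [hG, smul_eq_mul]
        have := (hpos x hx').ne'
        congr 1
        field_simp
        push_cast
        ring
      · rw [hessMatrix_mulVec_coord]
        ext i
        rw [fderiv_fderiv_self_of_homogeneous (k := 2) hFc hF2 hx',
          fderiv_half_sq (differentiableAt_of_contDiffOn hf.contDiffOn hx')]
        simp only [gradCoord, _root_.smul_apply, Pi.smul_apply, smul_eq_mul]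
        push_cast
        ring
    · rw [hρ0 _ fun h => hfx ⟨h.1.le, h.2.le⟩, hρd _ hfx]
      simp [detDeriv_zero_right]
  · intro x hx
    have h4 := hbig x hx
    rw [hρ0 _ fun h => absurd h.2 (by linarith), hρd _ fun h => absurd h.2 (by linarith)]
    simp

/-- The first variation of the volume: for `1`-homogeneous functions `f > 0` and `g`,
`∫ f (d/dt) det (D²(f + t g)) = (n - 1) ∫ g det (D²f)`. -/
theorem integral_detDeriv_fullHess {f g : E → ℝ} (hf : HomC2 f) (hpos : ∀ x ≠ 0, 0 < f x)
    (hg : HomC2 g) :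
    ∫ θ : sphere (0 : E) 1, f θ * detDeriv (fullHess b f θ) (hessMatrix b g θ)
        ∂(volume : Measure E).toSphere
      = ((n : ℝ) - 1) * ∫ θ : sphere (0 : E) 1, g θ * (fullHess b f θ).det
        ∂(volume : Measure E).toSphere := by
  obtain ⟨ρ, χ, hρ, hχ, hρnn, hρ2, hρ0, hχ1, hχ0⟩ := exists_cutoff_pair
  have key := integral_cutoff_eq_zero b hf hpos hg hρ hχ hρ0 hχ1 hχ0
  obtain ⟨m, M, hm, hM, hmM⟩ := hf.exists_bounds hpos
  set F : E → ℝ := fun y => f y * (2⁻¹ * f y) with hF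
  set G : E → ℝ := fun y => f y * g y with hG
  have hFc : ContDiffOn ℝ 2 F {0}ᶜ := hf.contDiffOn.mul (contDiffOn_const.mul hf.contDiffOn)
  have hGc : ContDiffOn ℝ 2 G {0}ᶜ := hf.contDiffOn.mul hg.contDiffOn
  have hn : Module.finrank ℝ E = n := by
    rw [Module.finrank_eq_card_basis b.toBasis, Fintype.card_fin]
  have hn0 : n ≠ 0 := by rw [← hn]; exact Module.finrank_pos.ne'
  obtain ⟨k, rfl⟩ := Nat.exists_eq_succ_of_ne_zero hn0
  have hHess : ∀ {Q : E → ℝ}, (∀ r : ℝ, 0 < r → ∀ x, Q (r • x) = r ^ 2 * Q x) →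
      ∀ r : ℝ, 0 < r → ∀ x, hessMatrix b Q (r • x) = hessMatrix b Q x := fun hQ r hr x => by
    have := hessMatrix_smul_of_homogeneous b hr (k := 1) (fun x => hQ r hr x) x
    rw [pow_one] at this
    exact smul_right_injective _ hr.ne' this
  have hHF := hHess (Q := F) fun r hr x => by simp only [hF, hf.hom r hr]; ring
  have hHG := hHess (Q := G) fun r hr x => by simp only [hG, hf.hom r hr, hg.hom r hr]; ring
  have hρd : ∀ s, s ∉ Set.Icc 1 3 → deriv ρ s = 0 := fun s hs => by
    have h1 : ρ =ᶠ[nhds s] fun _ => 0 := by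
      filter_upwards [isClosed_Icc.isOpen_compl.mem_nhds hs] with t ht
      exact hρ0 t fun h => ht ⟨h.1.le, h.2.le⟩
    rw [h1.deriv_eq, deriv_const]
  have hbig : ∀ x, x ∉ closedBall (0 : E) (4 / m) → 4 ≤ f x := fun x hx => by
    rw [mem_closedBall_zero_iff, not_le, div_lt_iff₀ hm, mul_comm] at hx
    exact hx.le.trans (hmM x).1
  have hcF : ContinuousOn (fun x => (hessMatrix b F x).det) {0}ᶜ :=
    Continuous.comp_continuousOn (continuous_id.matrix_det) (continuousOn_hessMatrix b hFc)
  have hcT := continuousOn_detDeriv (continuousOn_hessMatrix b hFc) (continuousOn_hessMatrix b hGc)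
  have hI1 : Integrable fun x => ρ (f x) • detDeriv (hessMatrix b F x) (hessMatrix b G x) := by
    refine Continuous.integrable_of_hasCompactSupport (continuous_cutoff hf hpos hρ.continuous
      one_pos (fun s hs => hρ0 s fun h => absurd h.1 (by linarith)) hcT)
      (HasCompactSupport.intro (isCompact_closedBall 0 (4 / m)) fun x hx => ?_)
    rw [hρ0 _ fun h => absurd h.2 (by linarith [hbig x hx]), zero_smul]
  have hI2 : Integrable fun x => deriv ρ (f x) • ((hessMatrix b F x).det * (2 * g x)) := by
    refine Continuous.integrable_of_hasCompactSupport (continuous_cutoff hf hpos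
      (hρ.continuous_deriv (by norm_num)) one_pos
      (fun s hs => hρd s fun h => absurd h.1 (by linarith))
      (hcF.mul (continuousOn_const.mul hg.contDiffOn.continuousOn)))
      (HasCompactSupport.intro (isCompact_closedBall 0 (4 / m)) fun x hx => ?_)
    rw [hρd _ fun h => absurd h.2 (by linarith [hbig x hx]), zero_smul]
  have hfpos : ∀ θ : sphere (0 : E) 1, 0 < f θ := fun θ => hpos _ (ne_zero_of_mem_unit_sphere θ)
  -- Hessians of 2-homogeneous functions are 0-homogeneous, so both integrands split into a function
  -- of f and a 0-homogeneous function.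
  rw [integral_add hI1 hI2, integral_radial hI1 (f := fun θ => f θ)
    (w := fun θ => detDeriv (hessMatrix b F θ) (hessMatrix b G θ)) hfpos (κ := ρ) ?_,
    integral_radial hI2 (f := fun θ => f θ)
    (w := fun θ => (hessMatrix b F θ).det * (2 * g θ) / f θ) hfpos (κ := fun s => s * deriv ρ s) ?_]
    at key
  rotate_left
  · intro θ r hr
    rw [hHF r hr, hf.hom r hr, hg.hom r hr]
    have := (hfpos θ).ne'
    simp only [smul_eq_mul]
    field_simp
  · intro θ r hr
    rw [hHF r hr, hHG r hr, hf.hom r hr, smul_eq_mul]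
  rw [hn] at key
  simp only [Nat.succ_eq_add_one, Nat.add_sub_cancel] at key ⊢
  set C : ℝ := ∫ s in Set.Ioi (0 : ℝ), s ^ k * ρ s with hC
  have hcont : Continuous fun s : ℝ => s ^ k * ρ s := (continuous_pow k).mul hρ.continuous
  have hsupp : HasCompactSupport fun s : ℝ => s ^ k * ρ s :=
    HasCompactSupport.intro (isCompact_Icc (a := (1 : ℝ)) (b := 3)) fun s hs => by
      rw [hρ0 s fun h => hs ⟨h.1.le, h.2.le⟩, mul_zero]
  have hCpos : 0 < C := by
    rw [hC, setIntegral_pos_iff_support_of_nonneg_ae]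
    · refine lt_of_lt_of_le ?_ (measure_mono (Set.subset_inter
        (Set.inter_subset_left (s := {s : ℝ | s ^ k * ρ s ≠ 0}) (t := Set.Ioi 0))
        Set.inter_subset_right))
      refine IsOpen.measure_pos _ (IsOpen.inter (isOpen_ne_fun hcont continuous_const) isOpen_Ioi)
        ⟨2, ?_, ?_⟩
      · simp [hρ2]
      · simp
    · filter_upwards [ae_restrict_mem measurableSet_Ioi] with s hs
      exact mul_nonneg (pow_nonneg (le_of_lt hs) _) (hρnn s)
    · exact (hcont.integrable_of_hasCompactSupport hsupp).integrableOn
  -- Integration by parts without boundary terms; here n = k + 1.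
  have hC' : ∫ s in Set.Ioi (0 : ℝ), s ^ k * (s * deriv ρ s) = -((k + 1) * C) := by
    have h1 : ContDiff ℝ 1 fun s : ℝ => s ^ (k + 1) * ρ s :=
      (contDiff_id.pow _).mul (hρ.of_le (by norm_num))
    have h2 : HasCompactSupport fun s : ℝ => s ^ (k + 1) * ρ s :=
      HasCompactSupport.intro (isCompact_Icc (a := (1 : ℝ)) (b := 3)) fun s hs => by
        rw [hρ0 s fun h => hs ⟨h.1.le, h.2.le⟩, mul_zero]
    have h3 := h2.integral_Ioi_deriv_eq h1 0
    have h4 : ∀ s, deriv (fun s : ℝ => s ^ (k + 1) * ρ s) s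
        = (k + 1) * (s ^ k * ρ s) + s ^ k * (s * deriv ρ s) := fun s => by
      have := ((hasDerivAt_pow (k + 1) s).mul
        ((hρ.differentiable (by norm_num) s).hasDerivAt)).deriv
      refine Eq.trans this ?_
      rw [Nat.add_sub_cancel]
      push_cast
      ring
    simp only [h4] at h3
    rw [integral_add, integral_const_mul, ← hC] at h3
    · simp at h3
      linarith
    · exact ((hcont.integrable_of_hasCompactSupport hsupp).integrableOn).const_mul _
    · refine (Continuous.integrable_of_hasCompactSupport ?_ ?_).integrableOn
      · exact (continuous_pow k).mul (continuous_id.mul (hρ.continuous_deriv (by norm_num)))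
      · refine HasCompactSupport.intro (isCompact_Icc (a := (1 : ℝ)) (b := 3)) fun s hs => ?_
        rw [hρd s hs, mul_zero, mul_zero]
  rw [hC'] at key
  have hcomp : CompactSpace (sphere (0 : E) 1) := isCompact_iff_compactSpace.1 (isCompact_sphere 0 1)
  have hne : ∀ θ : sphere (0 : E) 1, (θ : E) ≠ 0 := fun θ => ne_zero_of_mem_unit_sphere θ
  have hcs : ∀ {Q : E → ℝ}, ContinuousOn Q {0}ᶜ → Integrable (fun θ : sphere (0 : E) 1 => Q θ)
      (volume : Measure E).toSphere := fun hQ =>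
    (hQ.comp_continuous continuous_subtype_val fun θ => hne θ).integrable_of_hasCompactSupport
      (HasCompactSupport.of_compactSpace _)
  have hθ : ∀ θ : sphere (0 : E) 1, coord b (θ : E) ⬝ᵥ coord b (θ : E) = 1 := fun θ => by
    rw [coord_dotProduct, real_inner_self_eq_norm_sq]; simp
  have e1 : ∀ θ : sphere (0 : E) 1,
      detDeriv (hessMatrix b F θ) (hessMatrix b G θ) / f θ ^ (k + 1)
      = (k + 2) * (g θ * (fullHess b f θ).det)
        + f θ * detDeriv (fullHess b f θ) (hessMatrix b g θ) := fun θ => by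
    have h := detDeriv_smul_add_vecMulVec (transpose_hessMatrix b hf.contDiffOn (hne θ))
      (transpose_hessMatrix b hg.contDiffOn (hne θ)) (hfpos θ) (hθ θ)
      (hf.hessMatrix_mulVec_self b (hne θ)) (hg.hessMatrix_mulVec_self b (hne θ))
      (hf.gradCoord_dotProduct_self b (hne θ)) (hg.gradCoord_dotProduct_self b (hne θ))
    rw [hF, hG, hessMatrix_half_sq b hf.contDiffOn (hne θ),
      hessMatrix_mul b hf.contDiffOn hg.contDiffOn (hne θ), h]
    have := (hfpos θ).ne'
    simp only [fullHess]
    field_simp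
    push_cast
    ring
  have e2 : ∀ θ : sphere (0 : E) 1, (hessMatrix b F θ).det * (2 * g θ) / f θ / f θ ^ (k + 1)
      = 2 * (g θ * (fullHess b f θ).det) := fun θ => by
    have h := det_smul_add_vecMulVec (transpose_hessMatrix b hf.contDiffOn (hne θ))
      (hfpos θ).ne' (hθ θ) (hf.hessMatrix_mulVec_self b (hne θ))
      (hf.gradCoord_dotProduct_self b (hne θ))
    rw [hF, hessMatrix_half_sq b hf.contDiffOn (hne θ), h]
    have := (hfpos θ).ne'
    simp only [fullHess, Nat.succ_eq_add_one, pow_succ]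
    field_simp
  simp only [e1, e2] at key
  have hcfull : ContinuousOn (fun x => (fullHess b f x).det) {0}ᶜ :=
    Continuous.comp_continuousOn (continuous_id.matrix_det) (continuousOn_fullHess b hf.contDiffOn)
  rw [integral_add, integral_const_mul, integral_const_mul] at key
  · push_cast
    -- The two integrals contribute (k + 2) and -2(k + 1) times ∫ g det D²f; the sum -k gives the
    -- factor n - 1, and C > 0 can be divided out.
    have h5 : C * ((∫ θ : sphere (0 : E) 1, f θ * detDeriv (fullHess b f θ) (hessMatrix b g θ)
        ∂(volume : Measure E).toSphere) - k * ∫ θ : sphere (0 : E) 1, g θ * (fullHess b f θ).det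
        ∂(volume : Measure E).toSphere) = 0 := by
      linear_combination key
    have h6 := (mul_eq_zero.1 h5).resolve_left hCpos.ne'
    linear_combination h6
  · exact (hcs (hg.contDiffOn.continuousOn.mul hcfull)).const_mul _
  · exact hcs (hf.contDiffOn.continuousOn.mul (continuousOn_detDeriv
      (continuousOn_fullHess b hf.contDiffOn) (continuousOn_hessMatrix b hg.contDiffOn)))

end Variation

/-! ### Bochner-type integral identities -/

section Bochner

open Matrix

variable {E : Type*} [NormedAddCommGroup E] [InnerProductSpace ℝ E] [FiniteDimensional ℝ E]
  [Nontrivial E] [MeasurableSpace E] [BorelSpace E] {n : ℕ} (b : OrthonormalBasis (Fin n) ℝ E)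

lemma HomC2.add_const_mul {f g : E → ℝ} (hf : HomC2 f) (hg : HomC2 g) (s : ℝ) :
    HomC2 fun x => f x + s * g x where
  contDiffOn := hf.contDiffOn.add (contDiffOn_const.mul hg.contDiffOn)
  hom r hr x := by simp only [hf.hom r hr, hg.hom r hr]; ring

lemma hessMatrix_add_const_mul {f g : E → ℝ} (hf : ContDiffOn ℝ 2 f {0}ᶜ)
    (hg : ContDiffOn ℝ 2 g {0}ᶜ) (s : ℝ) {x : E} (hx : x ≠ 0) :
    hessMatrix b (fun y => f y + s * g y) x = hessMatrix b f x + s • hessMatrix b g x := by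
  have h1 : (fderiv ℝ fun y => f y + s * g y) =ᶠ[nhds x]
      fun y => fderiv ℝ f y + s • fderiv ℝ g y := by
    filter_upwards [isOpen_compl_singleton.mem_nhds hx] with y hy
    have hg0 := differentiableAt_of_contDiffOn hg hy
    rw [fderiv_fun_add (differentiableAt_of_contDiffOn hf hy) (hg0.const_mul s),
      fderiv_const_mul hg0]
  have hf1 := (contDiffAt_fderiv hf hx).differentiableAt one_ne_zero
  have hg1 := (contDiffAt_fderiv hg hx).differentiableAt one_ne_zero
  ext i j
  simp only [hessMatrix, Matrix.of_apply, Matrix.add_apply, Matrix.smul_apply]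
  rw [h1.fderiv_eq, fderiv_fun_add (g := fun y => s • fderiv ℝ g y) hf1 (hg1.const_smul s),
    fderiv_fun_const_smul hg1]
  rfl

lemma integrable_sphere {Q : sphere (0 : E) 1 → ℝ} (hQ : Continuous Q) :
    Integrable Q (volume : Measure E).toSphere := by
  have hcomp : CompactSpace (sphere (0 : E) 1) := isCompact_iff_compactSpace.1 (isCompact_sphere 0 1)
  exact hQ.integrable_of_hasCompactSupport (HasCompactSupport.of_compactSpace _)

lemma exists_pos_add_mul {f g : E → ℝ} (hf : HomC2 f) (hpos : ∀ x ≠ 0, 0 < f x) (hg : HomC2 g) :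
    ∃ δ > 0, ∀ s : ℝ, |s| < δ → ∀ x ≠ 0, 0 < f x + s * g x := by
  obtain ⟨m, _, hm, _, hmM⟩ := hf.exists_bounds hpos
  have hcomp : CompactSpace (sphere (0 : E) 1) := isCompact_iff_compactSpace.1 (isCompact_sphere 0 1)
  obtain ⟨C, hC⟩ := isCompact_univ.exists_bound_of_continuousOn
    hg.continuousOn_sphere.continuousOn
  refine ⟨m / (|C| + 1), by positivity, fun s hs x hx => ?_⟩
  have hx' : 0 < ‖x‖ := norm_pos_iff.2 hx
  rw [hf.eq_norm_mul hx, hg.eq_norm_mul hx]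
  set θ : sphere (0 : E) 1 := ⟨‖x‖⁻¹ • x, by simp [norm_smul, hx'.ne']⟩ with hθ
  have h1 : m ≤ f θ := by simpa using (hmM θ).1
  have h2 : |g θ| ≤ |C| := (hC θ (Set.mem_univ _)).trans (le_abs_self C)
  rw [lt_div_iff₀ (by positivity)] at hs
  have h3 : |s * g θ| < m := by
    rw [abs_mul]
    nlinarith [abs_nonneg s, abs_nonneg (g θ)]
  change 0 < ‖x‖ * f θ + s * (‖x‖ * g θ)
  have h4 := (abs_lt.1 h3).1
  have h5 : 0 < f θ + s * g θ := by linarith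
  nlinarith

open Polynomial in
lemma eval_derivative_detPoly (A B : Matrix (Fin n) (Fin n) ℝ) (s : ℝ) :
    (derivative (detPoly A B)).eval s = detDeriv (A + s • B) B := by
  refine ((detPoly A B).hasDerivAt s).unique ?_
  simp only [eval_detPoly]
  refine hasDerivAt_det (P := fun s => A + s • B) fun i j => ?_
  simpa using ((hasDerivAt_id s).mul_const (B i j)).const_add (A i j)

variable {h u : E → ℝ}

/-- The trace of `(D²h)⁻¹ D²u`. -/
def relTrace (h u : E → ℝ) (x : E) : ℝ := ((fullHess b h x)⁻¹ * hessMatrix b u x).trace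

/-- The trace of the square of `(D²h)⁻¹ D²u`. -/
def relTraceSq (h u : E → ℝ) (x : E) : ℝ :=
  ((fullHess b h x)⁻¹ * hessMatrix b u x * ((fullHess b h x)⁻¹ * hessMatrix b u x)).trace

lemma continuous_hessMatrix_sphere (hu : HomC2 u) :
    Continuous fun θ : sphere (0 : E) 1 => hessMatrix b u θ :=
  (continuousOn_hessMatrix b hu.contDiffOn).comp_continuous continuous_subtype_val
    fun θ => ne_zero_of_mem_unit_sphere θ

lemma continuous_fullHess_sphere (hu : HomC2 u) :
    Continuous fun θ : sphere (0 : E) 1 => fullHess b u θ :=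
  (continuousOn_fullHess b hu.contDiffOn).comp_continuous continuous_subtype_val
    fun θ => ne_zero_of_mem_unit_sphere θ

lemma continuous_inv_fullHess (hh : HomC2 h)
    (hM : ∀ θ : sphere (0 : E) 1, (fullHess b h θ).PosDef) :
    Continuous fun θ : sphere (0 : E) 1 => (fullHess b h θ)⁻¹ := by
  simp only [Matrix.inv_def, Ring.inverse_eq_inv']
  have := continuous_fullHess_sphere b hh
  exact (this.matrix_det.inv₀ fun θ => (hM θ).det_pos.ne').smul this.matrix_adjugate

lemma continuous_relTrace (hh : HomC2 h)
    (hM : ∀ θ : sphere (0 : E) 1, (fullHess b h θ).PosDef) (hu : HomC2 u) :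
    Continuous fun θ : sphere (0 : E) 1 => relTrace b h u θ :=
  ((continuous_inv_fullHess b hh hM).matrix_mul (continuous_hessMatrix_sphere b hu)).matrix_trace

lemma continuous_relTraceSq (hh : HomC2 h)
    (hM : ∀ θ : sphere (0 : E) 1, (fullHess b h θ).PosDef) (hu : HomC2 u) :
    Continuous fun θ : sphere (0 : E) 1 => relTraceSq b h u θ :=
  have := (continuous_inv_fullHess b hh hM).matrix_mul (continuous_hessMatrix_sphere b hu)
  (this.matrix_mul this).matrix_trace

/-- The first variation identity after Jacobi's formula; for u = zh it says that Δ_K z has mean zero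
for ν_K. -/
theorem integral_relTrace (hh : HomC2 h) (hpos : ∀ x ≠ 0, 0 < h x)
    (hM : ∀ θ : sphere (0 : E) 1, (fullHess b h θ).PosDef) (hu : HomC2 u) :
    ∫ θ : sphere (0 : E) 1, relTrace b h u θ * (h θ * (fullHess b h θ).det)
        ∂(volume : Measure E).toSphere
      = ((n : ℝ) - 1) * ∫ θ : sphere (0 : E) 1, u θ * (fullHess b h θ).det
        ∂(volume : Measure E).toSphere := by
  rw [← integral_detDeriv_fullHess b hh hpos hu]
  congr 1
  ext θ
  rw [detDeriv_eq (hM θ).det_pos.ne', relTrace]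
  ring

open Polynomial in
/-- The Bochner identity of the Hilbert--Brunn--Minkowski operator. -/
theorem integral_bochner (hh : HomC2 h) (hpos : ∀ x ≠ 0, 0 < h x)
    (hM : ∀ θ : sphere (0 : E) 1, (fullHess b h θ).PosDef) (hu : HomC2 u) :
    ∫ θ : sphere (0 : E) 1, ((relTrace b h u θ ^ 2 - relTraceSq b h u θ)
        * (h θ * (fullHess b h θ).det) - ((n : ℝ) - 2) * (u θ * relTrace b h u θ *
          (fullHess b h θ).det)) ∂(volume : Measure E).toSphere = 0 := by
  obtain ⟨δ, hδ, hδs⟩ := exists_pos_add_mul hh hpos hu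
  have hne : ∀ θ : sphere (0 : E) 1, (θ : E) ≠ 0 := fun θ => ne_zero_of_mem_unit_sphere θ
  have hcM := (continuousOn_fullHess b hh.contDiffOn).comp_continuous continuous_subtype_val hne
  have hcB := (continuousOn_hessMatrix b hu.contDiffOn).comp_continuous continuous_subtype_val hne
  set P : sphere (0 : E) 1 → ℝ[X] := fun θ => detPoly (fullHess b h θ) (hessMatrix b u θ) with hP
  have hPc : ContinuousCoeff P := continuousCoeff_detPoly hcM hcB
  -- p θ is the polynomial (h + su)(d/ds) det D²(h + su) - (n-1) u det D²(h + su) in s. By the first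
  -- variation identity for h + su, its integral vanishes as long as h + su > 0, so the coefficient
  -- of s integrates to zero. There u·(d/ds)det contributes once and the last term n - 1 times,
  -- which leaves n - 2.
  set p : sphere (0 : E) 1 → ℝ[X] := fun θ =>
    (Polynomial.C (h θ) + Polynomial.C (u θ) * X) * derivative (P θ)
      - Polynomial.C (((n : ℝ) - 1) * u θ) * P θ with hp
  have hcomp : CompactSpace (sphere (0 : E) 1) := isCompact_iff_compactSpace.1 (isCompact_sphere 0 1)
  have hcoeff : ∀ k, Continuous fun θ => (p θ).coeff k := fun k => by
    have h1 := hh.continuousOn_sphere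
    have h2 := hu.continuousOn_sphere
    rcases k with _ | k
    · simp only [hp, coeff_sub, add_mul, coeff_add, mul_assoc, coeff_C_mul, coeff_derivative,
        coeff_X_mul_zero]
      exact ((h1.mul ((hPc _).mul continuous_const)).add (h2.mul continuous_const)).sub
        (continuous_const.mul (h2.mul (hPc _)))
    · simp only [hp, coeff_sub, add_mul, coeff_add, mul_assoc, coeff_C_mul, coeff_derivative,
        coeff_X_mul]
      exact ((h1.mul ((hPc _).mul continuous_const)).add
        (h2.mul ((hPc _).mul continuous_const))).sub
        (continuous_const.mul (h2.mul (hPc _)))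
  have hdeg : ∀ θ, (p θ).natDegree ≤ n + 1 := fun θ => by
    have h0 : (P θ).natDegree ≤ n := natDegree_detPoly_le _ _
    refine natDegree_sub_le_of_le (natDegree_mul_le_of_le (m := 1) (n := n) ?_ ?_)
      ((natDegree_C_mul_le _ _).trans (h0.trans (Nat.le_succ n))) |>.trans (by simp [add_comm])
    · refine natDegree_add_le_of_degree_le (by simp) ((natDegree_C_mul_le _ _).trans (by simp))
    · exact (natDegree_derivative_le _).trans (by omega)
  have key := integral_coeff_eq_zero (μ := (volume : Measure E).toSphere) hdeg
    (fun k => (hcoeff k).integrable_of_hasCompactSupport (HasCompactSupport.of_compactSpace _))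
    hδ (c := 0) (fun s hs => ?_) one_ne_zero
  · rw [← key]
    congr 1
    ext θ
    have hd := (hM θ).det_pos.ne'
    have h2 := two_mul_coeff_two_detPoly hd (hessMatrix b u θ)
    have h1 : (P θ).coeff 1 = (fullHess b h θ).det * relTrace b h u θ := detDeriv_eq hd _
    have h2' : 2 * (P θ).coeff 2 = (fullHess b h θ).det *
      (relTrace b h u θ ^ 2 - relTraceSq b h u θ) := h2
    simp only [hp, coeff_sub, add_mul, coeff_add, mul_assoc, coeff_C_mul, coeff_derivative]
    have h3 : (X * derivative (P θ)).coeff 1 = (P θ).coeff 1 := by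
      have := coeff_X_mul (derivative (P θ)) 0
      rw [zero_add] at this
      rw [this, coeff_derivative]
      simp
    rw [h3, h1]
    push_cast
    linear_combination (- h θ) * h2'
  · have h1 := integral_detDeriv_fullHess b (hh.add_const_mul hu s) (hδs s hs) hu
    have h2 : ∀ θ : sphere (0 : E) 1, fullHess b (fun x => h x + s * u x) θ
        = fullHess b h θ + s • hessMatrix b u θ := fun θ => by
      rw [fullHess, hessMatrix_add_const_mul b hh.contDiffOn hu.contDiffOn s (hne θ), fullHess]
      abel
    simp only [h2] at h1
    have h3 : ∀ θ, (p θ).eval s = (h θ + s * u θ) *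
        detDeriv (fullHess b h θ + s • hessMatrix b u θ) (hessMatrix b u θ)
        - (n - 1) * (u θ * (fullHess b h θ + s • hessMatrix b u θ).det) := fun θ => by
      simp only [hp, eval_sub, eval_mul, eval_add, eval_C, eval_X, hP, eval_derivative_detPoly,
        eval_detPoly]
      ring
    simp only [h3]
    have hcMs := hcM.add (hcB.const_smul s)
    rw [integral_sub, integral_const_mul, h1, sub_self]
    · exact (Continuous.mul (hh.continuousOn_sphere.add
        (continuous_const.mul hu.continuousOn_sphere)) (continuousCoeff_detPoly hcMs hcB 1)
          ).integrable_of_hasCompactSupport (HasCompactSupport.of_compactSpace _)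
    · exact (continuous_const.mul (hu.continuousOn_sphere.mul hcMs.matrix_det)
        ).integrable_of_hasCompactSupport (HasCompactSupport.of_compactSpace _)

lemma HomC2.fullHess_mulVec_self (hh : HomC2 h) (θ : sphere (0 : E) 1) :
    fullHess b h θ *ᵥ coord b (θ : E) = coord b (θ : E) := by
  rw [fullHess, add_mulVec, hh.hessMatrix_mulVec_self b (ne_zero_of_mem_unit_sphere θ),
    vecMulVec_mulVec, coord_dotProduct, real_inner_self_eq_norm_sq]
  simp

lemma coord_dotProduct_self (θ : sphere (0 : E) 1) :
    coord b (θ : E) ⬝ᵥ coord b (θ : E) = 1 := by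
  rw [coord_dotProduct, real_inner_self_eq_norm_sq]; simp

/-- θ is a fixed vector of `fullHess`, so removing the radial part θ⊗θ lowers the trace n of the
identity by 1. -/
lemma relTrace_self (hh : HomC2 h) {θ : sphere (0 : E) 1} (hdet : (fullHess b h θ).det ≠ 0) :
    relTrace b h h θ = n - 1 := by
  have h1 : hessMatrix b h θ = fullHess b h θ - vecMulVec (coord b (θ : E)) (coord b (θ : E)) := by
    rw [fullHess]; abel
  have h2 : (fullHess b h θ)⁻¹ *ᵥ coord b (θ : E) = coord b (θ : E) := by
    conv_lhs => rw [← hh.fullHess_mulVec_self b θ]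
    rw [mulVec_mulVec, Matrix.nonsing_inv_mul _ (isUnit_iff_ne_zero.2 hdet), one_mulVec]
  rw [relTrace, h1, mul_sub, Matrix.nonsing_inv_mul _ (isUnit_iff_ne_zero.2 hdet), mul_vecMulVec,
    h2, Matrix.trace_sub, trace_vecMulVec, coord_dotProduct_self]
  simp

/-- The Hessian of `ζ² h`. -/
lemma hessMatrix_sq_mul {ζ : E → ℝ} (hζ : ContDiffOn ℝ 2 ζ {0}ᶜ) (hh : ContDiffOn ℝ 2 h {0}ᶜ)
    {x : E} (hx : x ≠ 0) :
    hessMatrix b (fun y => ζ y * (ζ y * h y)) x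
      = (2 * ζ x) • hessMatrix b (fun y => ζ y * h y) x - ζ x ^ 2 • hessMatrix b h x
        + (2 * h x) • vecMulVec (gradCoord b ζ x) (gradCoord b ζ x) := by
  have h1 : gradCoord b (fun y => ζ y * h y) x = ζ x • gradCoord b h x + h x • gradCoord b ζ x := by
    ext i
    simp only [gradCoord]
    rw [fderiv_fun_mul (differentiableAt_of_contDiffOn hζ hx) (differentiableAt_of_contDiffOn hh hx)]
    rfl
  rw [hessMatrix_mul b hζ (hζ.mul hh) hx, h1, hessMatrix_mul b hζ hh hx]
  ext i j
  simp only [Matrix.add_apply, Matrix.sub_apply, Matrix.smul_apply, vecMulVec_apply, Pi.add_apply,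
    Pi.smul_apply, smul_eq_mul]
  ring

/-- Nonnegativity of the Hilbert--Brunn--Minkowski operator. -/
theorem integral_mul_relTrace_le {ζ : E → ℝ} (hζ : ContDiffOn ℝ 2 ζ {0}ᶜ)
    (hζ0 : ∀ r : ℝ, 0 < r → ∀ x, ζ (r • x) = ζ x) (hh : HomC2 h) (hpos : ∀ x ≠ 0, 0 < h x)
    (hM : ∀ θ : sphere (0 : E) 1, (fullHess b h θ).PosDef) :
    ∫ θ : sphere (0 : E) 1, ζ θ * relTrace b h (fun y => ζ y * h y) θ
        * (h θ * (fullHess b h θ).det) ∂(volume : Measure E).toSphere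
      ≤ ((n : ℝ) - 1) * ∫ θ : sphere (0 : E) 1, ζ θ ^ 2 * (h θ * (fullHess b h θ).det)
        ∂(volume : Measure E).toSphere := by
  have hne : ∀ θ : sphere (0 : E) 1, (θ : E) ≠ 0 := fun θ => ne_zero_of_mem_unit_sphere θ
  have hu : HomC2 fun y => ζ y * h y :=
    ⟨hζ.mul hh.contDiffOn, fun r hr x => by simp only [hζ0 r hr, hh.hom r hr]; ring⟩
  have hu2 : HomC2 fun y => ζ y * (ζ y * h y) :=
    ⟨hζ.mul hu.contDiffOn, fun r hr x => by simp only [hζ0 r hr, hh.hom r hr]; ring⟩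
  have key := integral_relTrace b hh hpos hM hu2
  -- D²(ζ²h) equals 2ζD²(ζh) - ζ²D²h plus 2h ∇ζ⊗∇ζ, and the last term has nonnegative trace against
  -- (D²h)⁻¹. Integrating, the left side of the divergence identity for ζ²h is bounded below.
  have hpt : ∀ θ : sphere (0 : E) 1, 2 * ζ θ * relTrace b h (fun y => ζ y * h y) θ
      - (n - 1) * ζ θ ^ 2 ≤ relTrace b h (fun y => ζ y * (ζ y * h y)) θ := fun θ => by
    have h1 := relTrace_self b hh (hM θ).det_pos.ne'
    rw [← h1]
    simp only [relTrace]
    rw [hessMatrix_sq_mul b hζ hh.contDiffOn (hne θ), mul_add, mul_sub, Matrix.mul_smul,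
      Matrix.mul_smul, Matrix.mul_smul, Matrix.trace_add, Matrix.trace_sub, Matrix.trace_smul,
      Matrix.trace_smul, Matrix.trace_smul, mul_vecMulVec, trace_vecMulVec]
    have h2 : 0 ≤ (fullHess b h θ)⁻¹ *ᵥ gradCoord b ζ θ ⬝ᵥ gradCoord b ζ θ := by
      have := (hM θ).inv.posSemidef.dotProduct_mulVec_nonneg (gradCoord b ζ θ)
      rw [dotProduct_comm]
      simpa using this
    have h3 := (hpos θ (hne θ)).le
    simp only [smul_eq_mul]
    nlinarith [mul_nonneg h3 h2]
  have hcomp : CompactSpace (sphere (0 : E) 1) := isCompact_iff_compactSpace.1 (isCompact_sphere 0 1)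
  have hcd : Continuous fun θ : sphere (0 : E) 1 => h θ * (fullHess b h θ).det :=
    hh.continuousOn_sphere.mul (continuous_fullHess_sphere b hh).matrix_det
  have hcζ : Continuous fun θ : sphere (0 : E) 1 => ζ θ :=
    hζ.continuousOn.comp_continuous continuous_subtype_val hne
  have i1 : Integrable (fun θ : sphere (0 : E) 1 => ζ θ * relTrace b h (fun y => ζ y * h y) θ
      * (h θ * (fullHess b h θ).det)) (volume : Measure E).toSphere :=
    integrable_sphere ((hcζ.mul (continuous_relTrace b hh hM hu)).mul hcd)
  have i2 : Integrable (fun θ : sphere (0 : E) 1 => ζ θ ^ 2 * (h θ * (fullHess b h θ).det))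
      (volume : Measure E).toSphere := integrable_sphere ((hcζ.pow 2).mul hcd)
  have i3 : Integrable (fun θ : sphere (0 : E) 1 => relTrace b h (fun y => ζ y * (ζ y * h y)) θ
      * (h θ * (fullHess b h θ).det)) (volume : Measure E).toSphere :=
    integrable_sphere ((continuous_relTrace b hh hM hu2).mul hcd)
  have hle := integral_mono ((i1.const_mul 2).sub (i2.const_mul ((n : ℝ) - 1))) i3 fun θ => by
    have h1 := hpt θ
    have h2 : 0 < h θ * (fullHess b h θ).det := mul_pos (hpos θ (hne θ)) (hM θ).det_pos
    have h3 := mul_le_mul_of_nonneg_right h1 h2.le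
    simp only [Pi.sub_apply]
    linarith
  simp only [Pi.sub_apply] at hle
  rw [integral_sub (i1.const_mul 2) (i2.const_mul _), integral_const_mul, integral_const_mul,
    key] at hle
  have h4 : ∀ θ : sphere (0 : E) 1, ζ θ * (ζ θ * h θ) * (fullHess b h θ).det
      = ζ θ ^ 2 * (h θ * (fullHess b h θ).det) := fun θ => by ring
  simp only [h4] at hle
  linarith

end Bochner

/-! ### A Poincaré inequality for `0`-homogeneous functions -/

section Poincare

open Set ENNReal

variable {E : Type*} [NormedAddCommGroup E] [InnerProductSpace ℝ E] [FiniteDimensional ℝ E]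
  [MeasurableSpace E] [BorelSpace E]

/-- The map x ↦ tx + (1-t)y sends the ball into itself with Jacobian tⁿ ≥ 2⁻ⁿ. -/
lemma lintegral_segment_le {g : E → ℝ≥0∞} (hg : Measurable g) {t : ℝ} (ht : t ∈ Icc (1 / 2 : ℝ) 1)
    {y : E} (hy : y ∈ ball (0 : E) 1) :
    ∫⁻ x in ball (0 : E) 1, g (t • x + (1 - t) • y)
      ≤ 2 ^ Module.finrank ℝ E * ∫⁻ x in ball (0 : E) 1, g x := by
  have ht0 : 0 < t := by linarith [ht.1]
  set G : E → ℝ≥0∞ := (ball (0 : E) 1).indicator g with hG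
  have hGm : Measurable G := hg.indicator measurableSet_ball
  have h1 : ∫⁻ x in ball (0 : E) 1, g (t • x + (1 - t) • y)
      ≤ ∫⁻ x, G (t • x + (1 - t) • y) := by
    rw [← lintegral_indicator measurableSet_ball]
    refine lintegral_mono fun x => ?_
    by_cases hx : x ∈ ball (0 : E) 1
    · have := (convex_ball (0 : E) 1) hx hy ht0.le (by linarith [ht.2] : (0 : ℝ) ≤ 1 - t) (by ring)
      rw [indicator_of_mem hx, hG, indicator_of_mem this]
    · rw [indicator_of_notMem hx]; exact zero_le
  refine h1.trans ?_
  have h2 : ∫⁻ x, G (t • x + (1 - t) • y)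
      = ENNReal.ofReal |(t ^ Module.finrank ℝ E)⁻¹| * ∫⁻ x, G x := by
    have h3 := lintegral_map (μ := (volume : Measure E)) (f := fun x => G (x + (1 - t) • y))
      (g := fun x : E => t • x) (hGm.comp (measurable_id.add_const _)) (measurable_const_smul t)
    rw [← h3, Measure.map_addHaar_smul _ ht0.ne', lintegral_smul_measure,
      lintegral_add_right_eq_self G, smul_eq_mul]
  rw [h2, hG, lintegral_indicator measurableSet_ball]
  gcongr
  rw [abs_of_pos (by positivity), ← ENNReal.ofReal_ofNat, ← ENNReal.ofReal_pow (by norm_num),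
    ← inv_pow]
  refine ENNReal.ofReal_le_ofReal (pow_le_pow_left₀ (by positivity) ?_ _)
  rw [inv_le_comm₀ ht0 two_pos]
  linarith [ht.1]

variable {F : Type*} [NormedAddCommGroup F] [NormedSpace ℝ F]

lemma enorm_sub_le_lintegral_segment [CompleteSpace F] {w : E → F} (hw : ContDiffOn ℝ 1 w {0}ᶜ)
    {x y : E}
    (h : ∀ t ∈ Icc (0 : ℝ) 1, t • x + (1 - t) • y ≠ 0) :
    ‖w x - w y‖ₑ ≤ ‖x - y‖ₑ * ∫⁻ t in Icc (0 : ℝ) 1, ‖fderiv ℝ w (t • x + (1 - t) • y)‖ₑ := by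
  set γ : ℝ → E := fun t => t • x + (1 - t) • y with hγ
  have hγd : ∀ t, HasDerivAt γ (x - y) t := fun t => by
    have := ((hasDerivAt_id t).smul_const x).add (((hasDerivAt_id t).const_sub 1).smul_const y)
    rw [one_smul, neg_smul, one_smul, ← sub_eq_add_neg] at this
    exact this
  have hγc : ContDiff ℝ 1 γ := by
    simp only [hγ]; fun_prop
  have h1 : ContDiffOn ℝ 1 (w ∘ γ) (Icc 0 1) := hw.comp hγc.contDiffOn fun t ht => h t ht
  have h2 := enorm_sub_le_lintegral_deriv_of_contDiffOn_Icc h1 zero_le_one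
  have h3 : (w ∘ γ) 1 - (w ∘ γ) 0 = w x - w y := by simp [hγ]
  rw [h3] at h2
  refine h2.trans ?_
  rw [← lintegral_const_mul' _ _ (by simp)]
  refine setLIntegral_mono' measurableSet_Icc fun t ht => ?_
  have h4 : HasFDerivAt w (fderiv ℝ w (γ t)) (γ t) :=
    ((hw.contDiffAt (isOpen_compl_singleton.mem_nhds (h t ht))).differentiableAt
      one_ne_zero).hasFDerivAt
  rw [(h4.comp_hasDerivAt t (hγd t)).deriv, mul_comm]
  exact ContinuousLinearMap.le_opENorm _ _

/-- The Poincaré inequality on the ball for functions which may be singular at the origin. -/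
lemma exists_lintegral_enorm_sub_le [CompleteSpace F] (hn : 2 ≤ Module.finrank ℝ E) {w : E → F}
    (hw : ContDiffOn ℝ 1 w {0}ᶜ) :
    ∃ y : E, ∫⁻ x in ball (0 : E) 1, ‖w x - w y‖ₑ
      ≤ 4 * 2 ^ Module.finrank ℝ E * ∫⁻ x in ball (0 : E) 1, ‖fderiv ℝ w x‖ₑ := by
  have hnt : Nontrivial E := Module.nontrivial_of_finrank_pos (R := ℝ) (by omega)
  set B := ball (0 : E) 1 with hB
  set g : E → ℝ≥0∞ := fun x => ‖fderiv ℝ w x‖ₑ with hg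
  have hgm : Measurable g := (measurable_fderiv ℝ w).enorm
  set I := ∫⁻ x in B, g x with hI
  set c : ℝ≥0∞ := 2 ^ Module.finrank ℝ E with hc
  have hwm : AEStronglyMeasurable w (volume : Measure E) := by
    have := hw.continuousOn.aestronglyMeasurable (μ := (volume : Measure E))
      (measurableSet_singleton (0 : E)).compl
    rwa [restrict_compl_singleton] at this
  have hvol0 : volume B ≠ 0 := (measure_ball_pos _ _ one_pos).ne'
  have hvolt : volume B ≠ ⊤ := measure_ball_lt_top.ne
  -- The segment is split at its midpoint: for t ≥ 1/2 the change of variables will be made in x,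
  -- for t ≤ 1/2 in y. This keeps the Jacobian away from 0; the factor 2 bounds ‖x - y‖.
  have hpair : ∀ y ∈ B, y ≠ 0 → ∀ᵐ x ∂(volume.restrict B),
      ‖w x - w y‖ₑ ≤ 2 * ((∫⁻ t in Icc (0 : ℝ) (1 / 2), g (t • x + (1 - t) • y))
        + ∫⁻ t in Icc (1 / 2 : ℝ) 1, g (t • x + (1 - t) • y)) := by
    intro y hy hy0
    -- A segment from y can meet the origin only if its other end x lies on the line through y. In
    -- dimension at least 2 that line is a null set, so the singularity of w at 0 is harmless.
    have hspan : (Submodule.span ℝ {y} : Submodule ℝ E) ≠ ⊤ := fun htop => by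
      have h1 := finrank_span_singleton (K := ℝ) hy0
      rw [htop, finrank_top] at h1
      omega
    have hnull := Measure.addHaar_submodule (volume : Measure E) _ hspan
    filter_upwards [ae_restrict_of_ae (compl_mem_ae_iff.2 hnull), ae_restrict_mem measurableSet_ball]
      with x hx hxB
    have hseg : ∀ t ∈ Icc (0 : ℝ) 1, t • x + (1 - t) • y ≠ 0 := by
      intro t ht h0
      rcases eq_or_ne t 0 with rfl | ht0
      · exact hy0 (by simpa using h0)
      · refine hx (Submodule.mem_span_singleton.2 ⟨-(t⁻¹ * (1 - t)), ?_⟩)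
        have h1 : t • x = -((1 - t) • y) := eq_neg_of_add_eq_zero_left h0
        have h2 : x = t⁻¹ • (t • x) := by rw [smul_smul, inv_mul_cancel₀ ht0, one_smul]
        rw [h2, h1, neg_smul, smul_neg, smul_smul]
    refine (enorm_sub_le_lintegral_segment hw hseg).trans ?_
    gcongr
    · rw [← ofReal_norm, ← ENNReal.ofReal_ofNat]
      refine ENNReal.ofReal_le_ofReal ?_
      rw [hB, mem_ball_zero_iff] at hxB hy
      linarith [norm_sub_le x y]
    · rw [← Icc_union_Icc_eq_Icc (b := (1 / 2 : ℝ)) (by norm_num) (by norm_num)]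
      exact lintegral_union_le _ _ _
  have hmeas3 : Measurable fun p : (E × E) × ℝ => g (p.2 • p.1.1 + (1 - p.2) • p.1.2) :=
    hgm.comp (by fun_prop)
  have hlen : ∀ a b : ℝ, b - a ≤ 1 → ∫⁻ _ in Icc a b, c * I ≤ c * I := fun a b hab => by
    rw [setLIntegral_const, Real.volume_Icc]
    calc c * I * ENNReal.ofReal (b - a) ≤ c * I * 1 := by
          gcongr; exact ENNReal.ofReal_le_one.2 hab
      _ = c * I := mul_one _
  have hT2 : ∀ y ∈ B, ∫⁻ x in B, ∫⁻ t in Icc (1 / 2 : ℝ) 1, g (t • x + (1 - t) • y) ≤ c * I := by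
    intro y hy
    rw [lintegral_lintegral_swap]
    · refine le_trans ?_ (hlen (1 / 2) 1 (by norm_num))
      exact setLIntegral_mono' measurableSet_Icc fun t ht => lintegral_segment_le hgm ht hy
    · exact (hmeas3.comp (by fun_prop :
        Measurable fun q : E × ℝ => ((q.1, y), q.2))).aemeasurable
  have hT1 : ∀ x ∈ B, ∫⁻ y in B, ∫⁻ t in Icc (0 : ℝ) (1 / 2), g (t • x + (1 - t) • y) ≤ c * I := by
    intro x hx
    rw [lintegral_lintegral_swap]
    · refine le_trans ?_ (hlen 0 (1 / 2) (by norm_num))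
      refine setLIntegral_mono' measurableSet_Icc fun t ht => ?_
      have := lintegral_segment_le hgm (t := 1 - t) ⟨by linarith [ht.2], by linarith [ht.1]⟩ hx
      simpa [add_comm, sub_sub_cancel] using this
    · exact (hmeas3.comp (by fun_prop :
        Measurable fun q : E × ℝ => ((x, q.1), q.2))).aemeasurable
  have hm1 : Measurable fun p : E × E => ∫⁻ t in Icc (0 : ℝ) (1 / 2),
      g (t • p.1 + (1 - t) • p.2) := hmeas3.lintegral_prod_right'
  have hm1' : Measurable fun p : E × E => ∫⁻ t in Icc (0 : ℝ) (1 / 2),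
      g (t • p.2 + (1 - t) • p.1) := by
    have : Measurable fun p : (E × E) × ℝ => g (p.2 • p.1.2 + (1 - p.2) • p.1.1) :=
      hgm.comp (by fun_prop)
    exact this.lintegral_prod_right'
  have hm2 : Measurable fun p : E × E => ∫⁻ t in Icc (1 / 2 : ℝ) 1,
      g (t • p.1 + (1 - t) • p.2) := hmeas3.lintegral_prod_right'
  have hA : ∫⁻ y in B, ∫⁻ x in B, ‖w x - w y‖ₑ ≤ 4 * c * I * volume B := by
    calc ∫⁻ y in B, ∫⁻ x in B, ‖w x - w y‖ₑ
        ≤ ∫⁻ y in B, ∫⁻ x in B, 2 * ((∫⁻ t in Icc (0 : ℝ) (1 / 2), g (t • x + (1 - t) • y))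
          + ∫⁻ t in Icc (1 / 2 : ℝ) 1, g (t • x + (1 - t) • y)) := by
          refine lintegral_mono_ae ?_
          filter_upwards [ae_restrict_of_ae (compl_mem_ae_iff.2 (measure_singleton (0 : E))),
            ae_restrict_mem measurableSet_ball] with y hy hyB
          exact lintegral_mono_ae (hpair y hyB hy)
      _ = 2 * ((∫⁻ y in B, ∫⁻ x in B, ∫⁻ t in Icc (0 : ℝ) (1 / 2), g (t • x + (1 - t) • y))
          + ∫⁻ y in B, ∫⁻ x in B, ∫⁻ t in Icc (1 / 2 : ℝ) 1, g (t • x + (1 - t) • y)) := by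
          have e1 : Measurable fun y => ∫⁻ x in B, ∫⁻ t in Icc (0 : ℝ) (1 / 2),
              g (t • x + (1 - t) • y) := hm1'.lintegral_prod_right'
          rw [← lintegral_add_left e1, ← lintegral_const_mul' _ _ (by simp)]
          refine lintegral_congr fun y => ?_
          have e2 : Measurable fun x => ∫⁻ t in Icc (0 : ℝ) (1 / 2),
              g (t • x + (1 - t) • y) := by
            have : Measurable fun q : E × ℝ => g (q.2 • q.1 + (1 - q.2) • y) :=
              hgm.comp (by fun_prop)
            exact this.lintegral_prod_right'
          rw [lintegral_const_mul' _ _ (by simp), ← lintegral_add_left e2]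
      _ ≤ 2 * (c * I * volume B + c * I * volume B) := by
          gcongr
          · rw [lintegral_lintegral_swap (f := fun y x => ∫⁻ t in Icc (0 : ℝ) (1 / 2),
              g (t • x + (1 - t) • y)) hm1'.aemeasurable,
              ← setLIntegral_const]
            exact setLIntegral_mono' measurableSet_ball hT1
          · rw [← setLIntegral_const]
            exact setLIntegral_mono' measurableSet_ball hT2
      _ = 4 * c * I * volume B := by ring
  have hfm : AEMeasurable (fun y => ∫⁻ x in B, ‖w x - w y‖ₑ) (volume.restrict B) := by
    have h1 : AEStronglyMeasurable (fun p : E × E => w p.2 - w p.1)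
        ((volume.restrict B).prod (volume.restrict B)) :=
      (hwm.restrict.comp_snd).sub (hwm.restrict.comp_fst)
    exact h1.enorm.lintegral_prod_right'
  -- Some y does at least as well as the average over y; w(y) plays the part of the mean value of w.
  obtain ⟨y, -, hy⟩ := exists_le_setLAverage hvol0 hvolt hfm
  refine ⟨y, hy.trans ?_⟩
  rw [setLAverage_eq]
  exact (ENNReal.div_le_div_right hA _).trans
    (ENNReal.mul_div_cancel_right hvol0 hvolt).le

/-- Every `1`-homogeneous function is close to a linear function if its Hessian is small. -/
theorem exists_lintegral_sub_inner_le (hn : 2 ≤ Module.finrank ℝ E)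
    (b : OrthonormalBasis (Fin (Module.finrank ℝ E)) ℝ E) {u : E → ℝ} (hu : HomC2 u) :
    ∃ ξ : E, ∫⁻ θ : sphere (0 : E) 1, ‖u θ - inner ℝ (θ : E) ξ‖ₑ ∂(volume : Measure E).toSphere
      ≤ Module.finrank ℝ E * (4 * 2 ^ Module.finrank ℝ E *
        ∫⁻ θ : sphere (0 : E) 1, ‖fderiv ℝ (gradField b u) θ‖ₑ ∂(volume : Measure E).toSphere) := by
  have hnt : Nontrivial E := Module.nontrivial_of_finrank_pos (R := ℝ) (by omega)
  obtain ⟨k, hk⟩ : ∃ k, Module.finrank ℝ E = k + 2 := ⟨_, (Nat.sub_add_cancel hn).symm⟩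
  set w := gradField b u with hw
  have hwc : ContDiffOn ℝ 1 w {0}ᶜ := fun x hx =>
    (contDiffAt_gradField b hu.contDiffOn hx).contDiffWithinAt
  have hw0 : ∀ r : ℝ, 0 < r → ∀ x, w (r • x) = w x := fun r hr x => by
    have h1 := fderiv_smul_of_homogeneous (g := u) (r := r) (k := 1)
      (fun x => by simpa using hu.hom r hr x) x
    rw [pow_one] at h1
    have h2 : fderiv ℝ u (r • x) = fderiv ℝ u x := smul_right_injective _ hr.ne' h1
    change ∑ i, _ = ∑ i, _
    rw [h2]
  obtain ⟨y, hy⟩ := exists_lintegral_enorm_sub_le hn hwc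
  have hDw : ∀ r : ℝ, 0 < r → ∀ x, fderiv ℝ w (r • x) = r⁻¹ • fderiv ℝ w x := fun r hr x => by
    have h1 := fderiv_smul_of_homogeneous (g := w) (r := r) (k := 0)
      (fun x => by simpa using hw0 r hr x) x
    rw [pow_zero, one_smul] at h1
    rw [← h1, smul_smul, inv_mul_cancel₀ hr.ne', one_smul]
  have hmw : Measurable w := by
    have : ∀ i, Measurable fun x => fderiv ℝ u x (b i) := fun i => measurable_fderiv_apply_const ℝ u _
    rw [hw]
    exact Finset.measurable_fun_sum _ fun i _ => (this i).smul_const _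
  have hmD : Measurable fun x => ‖fderiv ℝ w x‖ₑ := (measurable_fderiv ℝ w).enorm
  -- By Euler's identity u(θ) = ⟨θ, w(θ)⟩ with w = ∇u, so |u(θ) - ⟨θ, w(y)⟩| ≤ ‖w(θ) - w(y)‖, and
  -- the Poincaré inequality applies to the 0-homogeneous field w.
  refine ⟨w y, ?_⟩
  have hpol : ∀ {g : E → ℝ≥0∞}, Measurable g → ∫⁻ x in ball (0 : E) 1, g x
      = ∫⁻ θ : sphere (0 : E) 1, ∫⁻ r in Ioo (0 : ℝ) 1, ENNReal.ofReal (r ^ (k + 1)) *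
        g (r • (θ : E)) ∂volume ∂(volume : Measure E).toSphere := fun {g} hg => by
    rw [← lintegral_indicator measurableSet_ball, lintegral_polar (hg.indicator measurableSet_ball),
      hk]
    refine lintegral_congr fun θ => ?_
    rw [← lintegral_indicator measurableSet_Ioi, ← lintegral_indicator measurableSet_Ioo]
    refine lintegral_congr fun r => ?_
    by_cases hr : 0 < r
    · have hrn : ‖r • (θ : E)‖ = r := by simp [norm_smul, abs_of_pos hr]
      by_cases hr1 : r < 1
      · rw [indicator_of_mem (show r ∈ Ioi (0 : ℝ) from hr),
          indicator_of_mem (show r ∈ Ioo (0 : ℝ) 1 from ⟨hr, hr1⟩), indicator_of_mem]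
        · rfl
        · rwa [mem_ball_zero_iff, hrn]
      · rw [indicator_of_mem (show r ∈ Ioi (0 : ℝ) from hr),
          indicator_of_notMem (show r ∉ Ioo (0 : ℝ) 1 from fun h => hr1 h.2),
          indicator_of_notMem, mul_zero]
        rwa [mem_ball_zero_iff, hrn]
    · rw [indicator_of_notMem (show r ∉ Ioi (0 : ℝ) from hr),
        indicator_of_notMem (show r ∉ Ioo (0 : ℝ) 1 from fun h => hr h.1)]
  have hleft : ∫⁻ x in ball (0 : E) 1, ‖w x - w y‖ₑ
      = (∫⁻ r in Ioo (0 : ℝ) 1, ENNReal.ofReal (r ^ (k + 1))) *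
        ∫⁻ θ : sphere (0 : E) 1, ‖w θ - w y‖ₑ ∂(volume : Measure E).toSphere := by
    rw [hpol (by fun_prop), ← lintegral_const_mul _ (by fun_prop)]
    refine lintegral_congr fun θ => ?_
    rw [← lintegral_mul_const _ (by fun_prop)]
    exact setLIntegral_congr_fun measurableSet_Ioo fun r hr => by
      rw [hw0 r hr.1]
  have hright : ∫⁻ x in ball (0 : E) 1, ‖fderiv ℝ w x‖ₑ
      ≤ ∫⁻ θ : sphere (0 : E) 1, ‖fderiv ℝ w θ‖ₑ ∂(volume : Measure E).toSphere := by
    rw [hpol hmD]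
    refine lintegral_mono fun θ => ?_
    calc ∫⁻ r in Ioo (0 : ℝ) 1, ENNReal.ofReal (r ^ (k + 1)) * ‖fderiv ℝ w (r • (θ : E))‖ₑ
        ≤ ∫⁻ r in Ioo (0 : ℝ) 1, ‖fderiv ℝ w θ‖ₑ := by
          refine setLIntegral_mono' measurableSet_Ioo fun r hr => ?_
          -- Dw is homogeneous of degree -1, so the radial weight rᵏ⁺¹ becomes rᵏ ≤ 1.
          rw [hDw r hr.1, enorm_smul, ← mul_assoc, ← ofReal_norm r⁻¹,
            ← ENNReal.ofReal_mul (pow_nonneg hr.1.le _), Real.norm_of_nonneg (inv_nonneg.2 hr.1.le),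
            pow_succ, mul_assoc, mul_inv_cancel₀ hr.1.ne', mul_one]
          calc ENNReal.ofReal (r ^ k) * ‖fderiv ℝ w θ‖ₑ ≤ 1 * ‖fderiv ℝ w θ‖ₑ := by
                gcongr
                exact ENNReal.ofReal_le_one.2 (pow_le_one₀ hr.1.le hr.2.le)
            _ = _ := one_mul _
      _ = ‖fderiv ℝ w θ‖ₑ := by rw [setLIntegral_const, Real.volume_Ioo]; simp
  have hrad : (Module.finrank ℝ E : ℝ≥0∞) * ∫⁻ r in Ioo (0 : ℝ) 1, ENNReal.ofReal (r ^ (k + 1))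
      = 1 := by
    have h1 : ∫⁻ r in Ioo (0 : ℝ) 1, ENNReal.ofReal (r ^ (k + 1))
        = ENNReal.ofReal (1 / ((k : ℝ) + 2)) := by
      rw [Measure.restrict_congr_set Ioo_ae_eq_Ioc, ← ofReal_integral_eq_lintegral_ofReal
        (intervalIntegral.intervalIntegrable_pow _).1, ← intervalIntegral.integral_of_le zero_le_one,
        integral_pow]
      · congr 1
        push_cast
        simp
        ring
      · filter_upwards [ae_restrict_mem measurableSet_Ioc] with r hr using pow_nonneg hr.1.le _
    rw [h1, hk, ← ENNReal.ofReal_natCast, ← ENNReal.ofReal_mul (by positivity)]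
    push_cast
    rw [mul_one_div_cancel (by positivity), ENNReal.ofReal_one]
  calc ∫⁻ θ : sphere (0 : E) 1, ‖u θ - inner ℝ (θ : E) (w y)‖ₑ ∂(volume : Measure E).toSphere
      ≤ ∫⁻ θ : sphere (0 : E) 1, ‖w θ - w y‖ₑ ∂(volume : Measure E).toSphere := by
        refine lintegral_mono fun θ => ?_
        have hθ : (θ : E) ≠ 0 := ne_zero_of_mem_unit_sphere θ
        have h1 : u θ = inner ℝ (θ : E) (w θ) := by
          have h2 := fderiv_self_of_homogeneous (k := 1)
            (differentiableAt_of_contDiffOn hu.contDiffOn hθ) fun r hr => by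
              simpa using hu.hom r hr θ
          rw [Nat.cast_one, one_mul] at h2
          rw [← h2, clm_eq_sum_coord b, real_inner_comm, ← coord_dotProduct b]
          congr 1
          ext i
          exact (inner_gradField b u θ i).symm
        rw [h1, ← inner_sub_right, ← ofReal_norm, ← ofReal_norm]
        refine ENNReal.ofReal_le_ofReal ((norm_inner_le_norm _ _).trans ?_)
        simp
    _ = Module.finrank ℝ E * ∫⁻ x in ball (0 : E) 1, ‖w x - w y‖ₑ := by
        rw [hleft, ← mul_assoc, hrad, one_mul]
    _ ≤ _ := by
        gcongr
        refine hy.trans ?_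
        gcongr

end Poincare

/-! ### Regularity of the support function -/

section Support

open Topology Filter

variable {E : Type*} [NormedAddCommGroup E] [InnerProductSpace ℝ E] (K : ConvexBody E)

lemma exists_maximizer (y : E) : ∃ x ∈ K, ∀ k ∈ K, inner ℝ y k ≤ inner ℝ y x := by
  obtain ⟨x, hx, h⟩ := K.isCompact.exists_isMaxOn K.nonempty
    (f := fun x : E => (inner ℝ y x : ℝ)) (by fun_prop)
  exact ⟨x, hx, fun k hk => h hk⟩

/-- A point of `K` at which the support function is attained. -/
def supportPt (y : E) : E := (exists_maximizer K y).choose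

lemma supportPt_mem (y : E) : supportPt K y ∈ K := (exists_maximizer K y).choose_spec.1

lemma inner_le_inner_supportPt (y : E) {k : E} (hk : k ∈ K) :
    (inner ℝ y k : ℝ) ≤ inner ℝ y (supportPt K y) := (exists_maximizer K y).choose_spec.2 k hk

lemma supportFun_eq (y : E) : supportFun K y = inner ℝ y (supportPt K y) := by
  refine IsGreatest.csSup_eq ⟨⟨_, supportPt_mem K y, rfl⟩, ?_⟩
  rintro _ ⟨k, hk, rfl⟩
  exact inner_le_inner_supportPt K y hk

lemma supportFun_smul {r : ℝ} (hr : 0 < r) (y : E) :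
    supportFun K (r • y) = r * supportFun K y := by
  refine IsGreatest.csSup_eq ⟨⟨_, supportPt_mem K y, ?_⟩, ?_⟩
  · simp only [real_inner_smul_left, supportFun_eq]
  · rintro _ ⟨k, hk, rfl⟩
    simp only [real_inner_smul_left, supportFun_eq]
    exact mul_le_mul_of_nonneg_left (inner_le_inner_supportPt K y hk) hr.le

variable {K}

lemma not_mem_interior_of_maximizer {x y : E} (hy : y ≠ 0)
    (hmax : ∀ k ∈ K, (inner ℝ y k : ℝ) ≤ inner ℝ y x) : x ∉ interior (K : Set E) := by
  intro hx
  have h1 : Tendsto (fun s : ℝ => x + s • y) (𝓝[>] 0) (𝓝 x) := by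
    have : Continuous fun s : ℝ => x + s • y := by fun_prop
    simpa using this.continuousAt.tendsto.mono_left (nhdsWithin_le_nhds (a := (0 : ℝ)))
  obtain ⟨s, hs, hs0⟩ := ((h1.eventually (isOpen_interior.mem_nhds hx)).and
    self_mem_nhdsWithin).exists
  have := hmax _ (interior_subset hs)
  rw [inner_add_right, real_inner_smul_right] at this
  have h2 : (0 : ℝ) < inner ℝ y y := real_inner_self_pos.2 hy
  nlinarith [mul_pos (Set.mem_Ioi.1 hs0) h2]

lemma supportFun_pos (h0 : (0 : E) ∈ interior (K : Set E)) {y : E} (hy : y ≠ 0) :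
    0 < supportFun K y := by
  have h1 : Tendsto (fun s : ℝ => s • y) (𝓝[>] 0) (𝓝 0) := by
    have : Continuous fun s : ℝ => s • y := by fun_prop
    simpa using this.continuousAt.tendsto.mono_left (nhdsWithin_le_nhds (a := (0 : ℝ)))
  obtain ⟨s, hs, hs0⟩ := ((h1.eventually (isOpen_interior.mem_nhds h0)).and
    self_mem_nhdsWithin).exists
  have := inner_le_inner_supportPt K y (interior_subset hs)
  rw [real_inner_smul_right] at this
  rw [supportFun_eq]
  exact lt_of_lt_of_le (mul_pos (Set.mem_Ioi.1 hs0) (real_inner_self_pos.2 hy)) this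

/-- Lagrange multiplier rule at a maximizer of a linear functional over a sublevel set. -/
lemma exists_lagrange {U : Set E} {ρ : E → ℝ} (hU : IsOpen U)
    (hKU : (K : Set E) ∩ U = {y ∈ U | ρ y ≤ 0}) {x y : E} (hxK : x ∈ K) (hxU : x ∈ U)
    (hρ : DifferentiableAt ℝ ρ x) (hρx : fderiv ℝ ρ x ≠ 0) (hy : y ≠ 0)
    (hmax : ∀ k ∈ K, (inner ℝ y k : ℝ) ≤ inner ℝ y x) :
    ρ x = 0 ∧ ∃ t : ℝ, 0 < t ∧ innerSL ℝ y = t • fderiv ℝ ρ x := by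
  have hle : ρ x ≤ 0 := by
    have : x ∈ {y ∈ U | ρ y ≤ 0} := hKU ▸ ⟨hxK, hxU⟩
    exact this.2
  have hzero : ρ x = 0 := by
    by_contra hne
    have hlt : ρ x < 0 := lt_of_le_of_ne hle hne
    refine not_mem_interior_of_maximizer hy hmax (mem_interior_iff_mem_nhds.2 ?_)
    filter_upwards [hρ.continuousAt.eventually_lt continuousAt_const hlt, hU.mem_nhds hxU]
      with z hz hzU
    have : z ∈ (K : Set E) ∩ U := hKU ▸ ⟨hzU, hz.le⟩
    exact this.1
  -- A direction along which ρ strictly decreases points into K, so the functional cannot increase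
  -- along it.
  have hneg : ∀ v : E, fderiv ℝ ρ x v < 0 → (inner ℝ y v : ℝ) ≤ 0 := by
    intro v hv
    have hline : HasDerivAt (fun s : ℝ => x + s • v) v 0 := by
      simpa using ((hasDerivAt_id (0 : ℝ)).smul_const v).const_add x
    have hd : HasDerivAt (fun s : ℝ => ρ (x + s • v)) (fderiv ℝ ρ x v) 0 := by
      have h3 : HasFDerivAt ρ (fderiv ℝ ρ x) ((fun s : ℝ => x + s • v) 0) := by
        simpa using hρ.hasFDerivAt
      exact h3.comp_hasDerivAt 0 hline
    have hc : Tendsto (fun s : ℝ => x + s • v) (𝓝[>] 0) (𝓝 x) := by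
      simpa using hline.continuousAt.tendsto.mono_left (nhdsWithin_le_nhds (a := (0 : ℝ)))
    have hs := hd.tendsto_slope_zero_right
    obtain ⟨s, ⟨hs1, hs2⟩, hs0⟩ := (((hs.eventually (eventually_lt_nhds hv)).and
      (hc.eventually (hU.mem_nhds hxU))).and self_mem_nhdsWithin).exists
    replace hs0 : 0 < s := hs0
    have hlt : ρ (x + s • v) < 0 := by
      simp only [zero_add, zero_smul, add_zero, hzero, sub_zero, smul_eq_mul] at hs1
      by_contra hcon
      exact absurd (mul_nonneg (inv_nonneg.2 hs0.le) (not_lt.1 hcon)) (not_le.2 hs1)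
    have hmem : x + s • v ∈ (K : Set E) ∩ U := hKU ▸ ⟨hs2, hlt.le⟩
    have := hmax _ hmem.1
    rw [inner_add_right, real_inner_smul_right] at this
    by_contra hcon
    nlinarith [mul_pos hs0 (not_le.1 hcon)]
  obtain ⟨v0, hv0⟩ : ∃ v0, fderiv ℝ ρ x v0 < 0 := by
    by_contra! hcon
    refine hρx (ContinuousLinearMap.ext fun v => le_antisymm ?_ (hcon v))
    simpa using hcon (-v)
  have hker : ∀ w, fderiv ℝ ρ x w = 0 → (inner ℝ y w : ℝ) = 0 := by
    intro w hw
    by_contra hne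
    -- The multiple of w is chosen so that the functional takes the value 1 on the sum, while Dρ is
    -- still negative there.
    have := hneg (v0 + ((1 - inner ℝ y v0) / inner ℝ y w) • w) (by simp [hw, hv0])
    rw [inner_add_right, real_inner_smul_right, div_mul_cancel₀ _ hne] at this
    linarith
  have hEq : innerSL ℝ y = ((inner ℝ y v0 : ℝ) / fderiv ℝ ρ x v0) • fderiv ℝ ρ x := by
    ext v
    have := hker (v - (fderiv ℝ ρ x v / fderiv ℝ ρ x v0) • v0) (by
      simp [hv0.ne])
    rw [inner_sub_right, real_inner_smul_right] at this
    simp only [innerSL_apply_apply, _root_.smul_apply, smul_eq_mul]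
    rw [sub_eq_zero.1 this]
    ring
  refine ⟨hzero, _, lt_of_le_of_ne (div_nonneg_of_nonpos (hneg v0 hv0) hv0.le) ?_, hEq⟩
  intro h0
  rw [← h0, zero_smul] at hEq
  have := congrArg (fun T : E →L[ℝ] ℝ => T y) hEq
  simp only [innerSL_apply_apply, _root_.zero_apply] at this
  exact hy (inner_self_eq_zero.1 this)

/-- Strict convexity of K. If two maximizers existed, the segment between them would lie in K and
consist of maximizers. At its midpoint ρ vanishes, with zero first and positive second derivative
along the segment, so 0 is a local minimum of ρ there. As ρ ≤ 0 on K, ρ is zero along the segment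
nearby, contradicting the positive second derivative. -/
lemma eq_of_maximizer (hK : IsSmoothPos K) {x₁ x₂ y : E} (hy : y ≠ 0) (h₁ : x₁ ∈ K) (h₂ : x₂ ∈ K)
    (hm₁ : ∀ k ∈ K, (inner ℝ y k : ℝ) ≤ inner ℝ y x₁)
    (hm₂ : ∀ k ∈ K, (inner ℝ y k : ℝ) ≤ inner ℝ y x₂) : x₁ = x₂ := by
  by_contra hne
  set v := x₂ - x₁ with hv
  have hv0 : v ≠ 0 := sub_ne_zero.2 (Ne.symm hne)
  have hyv : (inner ℝ y v : ℝ) = 0 := by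
    rw [hv, inner_sub_right, sub_eq_zero]
    exact le_antisymm (hm₁ _ h₂) (hm₂ _ h₁)
  set m := x₁ + (1 / 2 : ℝ) • v with hm
  have hseg : ∀ s : ℝ, |s| ≤ 1 / 2 → m + s • v ∈ K := by
    intro s hs
    rw [abs_le] at hs
    have := K.convex h₁ h₂ (a := 1 / 2 - s) (b := 1 / 2 + s) (by linarith) (by linarith) (by ring)
    have heq : m + s • v = (1 / 2 - s) • x₁ + (1 / 2 + s) • x₂ := by
      rw [hm, hv]
      module
    rw [heq]
    exact this
  have hmK : m ∈ K := by simpa using hseg 0 (by norm_num)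
  have hmax : ∀ k ∈ K, (inner ℝ y k : ℝ) ≤ inner ℝ y m := by
    intro k hk
    rw [hm, inner_add_right, real_inner_smul_right, hyv]
    simpa using hm₁ k hk
  have hfr : m ∈ frontier (K : Set E) :=
    ⟨subset_closure hmK, not_mem_interior_of_maximizer hy hmax⟩
  obtain ⟨U, ρ, hU, hmU, hρ, hKU, hρm, hpos⟩ := hK.smooth_boundary m hfr
  have hρd : ∀ z ∈ U, ContDiffAt ℝ ∞ ρ z := fun z hz => hρ.contDiffAt (hU.mem_nhds hz)
  obtain ⟨hρ0, t, ht, hyt⟩ := exists_lagrange hU hKU hmK hmU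
    ((hρd m hmU).differentiableAt (by simp)) hρm hy hmax
  have hDv : fderiv ℝ ρ m v = 0 := by
    have := congrArg (fun T : E →L[ℝ] ℝ => T v) hyt
    simp only [innerSL_apply_apply, _root_.smul_apply, smul_eq_mul, hyv] at this
    exact (mul_eq_zero.1 this.symm).resolve_left ht.ne'
  set φ : ℝ → ℝ := fun s => ρ (m + s • v) with hφ
  have hline : ∀ s : ℝ, HasDerivAt (fun s : ℝ => m + s • v) v s := fun s => by
    simpa using ((hasDerivAt_id s).smul_const v).const_add m
  have hmem : ∀ᶠ s : ℝ in 𝓝 0, m + s • v ∈ U := by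
    have := (hline 0).continuousAt.preimage_mem_nhds (t := U) (by simpa using hU.mem_nhds hmU)
    exact this
  have hφ' : ∀ᶠ s : ℝ in 𝓝 0, HasDerivAt φ (fderiv ℝ ρ (m + s • v) v) s := by
    filter_upwards [hmem] with s hs
    exact ((hρd _ hs).differentiableAt (by simp)).hasFDerivAt.comp_hasDerivAt s (hline s)
  have hφ1 : deriv φ =ᶠ[𝓝 0] fun s => fderiv ℝ ρ (m + s • v) v := hφ'.mono fun s hs => hs.deriv
  have hφ'' : deriv (deriv φ) 0 = fderiv ℝ (fderiv ℝ ρ) m v v := by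
    rw [hφ1.deriv_eq]
    have h2 : HasFDerivAt (fderiv ℝ ρ) (fderiv ℝ (fderiv ℝ ρ) m) (m + (0 : ℝ) • v) := by
      simpa using (((contDiffAt_infty.1 (hρd m hmU) 2).fderiv_right (m := 1) (by norm_num)).differentiableAt
        (by simp)).hasFDerivAt
    exact ((ContinuousLinearMap.apply ℝ ℝ v).hasFDerivAt.comp_hasDerivAt 0
      (h2.comp_hasDerivAt 0 (hline 0))).deriv
  have hpos' : 0 < deriv (deriv φ) 0 := hφ'' ▸ hpos v hv0 hDv
  have hmin : IsLocalMin φ 0 := isLocalMin_of_deriv_deriv_pos hpos'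
    (by rw [hφ1.eq_of_nhds]; simpa using hDv) hφ'.self_of_nhds.continuousAt
  have hzero : φ =ᶠ[𝓝 0] fun _ => 0 := by
    have hball : ∀ᶠ s : ℝ in 𝓝 0, |s| ≤ 1 / 2 := by
      have := (continuous_abs (G := ℝ)).continuousAt (x := 0)
      exact (this.eventually (eventually_le_nhds (by simp : |(0 : ℝ)| < 1 / 2)))
    filter_upwards [hmin, hmem, hball] with s hs hsU hsb
    have h3 : m + s • v ∈ {y ∈ U | ρ y ≤ 0} := hKU ▸ ⟨hseg s hsb, hsU⟩
    refine le_antisymm h3.2 ?_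
    simpa [hφ, hρ0] using hs
  have : deriv (deriv φ) 0 = 0 := by
    rw [hzero.deriv.deriv_eq]
    simp
  exact absurd this hpos'.ne'

/-- By compactness the maximizers have cluster points as z → y; each of them maximizes ⟨y, ·⟩, and
the maximizer is unique. -/
lemma continuousAt_supportPt (hK : IsSmoothPos K) {y : E} (hy : y ≠ 0) :
    ContinuousAt (supportPt K) y := by
  refine K.isCompact.tendsto_nhds_of_unique_mapClusterPt
    (Eventually.of_forall fun z => supportPt_mem K z) fun x hx hcl => ?_
  obtain ⟨𝒰, h𝒰, hlim⟩ := mapClusterPt_iff_ultrafilter.1 hcl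
  refine eq_of_maximizer hK hy hx (supportPt_mem K y) (fun k hk => ?_)
    fun k hk => inner_le_inner_supportPt K y hk
  have hid : Tendsto (fun z : E => z) 𝒰 (𝓝 y) := h𝒰
  exact le_of_tendsto_of_tendsto (hid.inner tendsto_const_nhds) (hid.inner hlim)
    (Eventually.of_forall fun z => inner_le_inner_supportPt K z hk)

/-- Envelope argument: with x(·) the maximizer, h(z) - h(y) - ⟨x(y), z - y⟩ lies between 0 and ⟨z -
y, x(z) - x(y)⟩, and x is continuous at y. -/
lemma hasFDerivAt_supportFun (hK : IsSmoothPos K) {y : E} (hy : y ≠ 0) :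
    HasFDerivAt (supportFun K) (innerSL ℝ (supportPt K y)) y := by
  rw [hasFDerivAt_iff_isLittleO, Asymptotics.isLittleO_iff]
  intro c hc
  have hcont := continuousAt_supportPt hK hy
  filter_upwards [hcont (Metric.closedBall_mem_nhds _ hc)] with z hz
  have hz' : ‖supportPt K z - supportPt K y‖ ≤ c := by
    simpa [dist_eq_norm] using hz
  have h1 := inner_le_inner_supportPt K z (supportPt_mem K y)
  have h2 := inner_le_inner_supportPt K y (supportPt_mem K z)
  have h3 : (inner ℝ (z - y) (supportPt K z - supportPt K y) : ℝ)
      ≤ ‖z - y‖ * ‖supportPt K z - supportPt K y‖ := real_inner_le_norm _ _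
  have h4 : ‖z - y‖ * ‖supportPt K z - supportPt K y‖ ≤ c * ‖z - y‖ := by
    rw [mul_comm]; gcongr
  rw [innerSL_apply_apply, supportFun_eq, supportFun_eq, Real.norm_eq_abs,
    real_inner_comm (z - y) (supportPt K y)]
  simp only [inner_sub_left, inner_sub_right] at h3 ⊢
  rw [abs_le]
  constructor <;> nlinarith [norm_nonneg (z - y), mul_nonneg hc.le (norm_nonneg (z - y))]

/-- Inverse function theorem for G(x, t) = (t Dρ(x), ρ(x)): by the Lagrange rule the maximizer for y
solves G(x, t) = (y, 0). The differential is injective, since t D²ρ v + s Dρ = 0 and Dρ v = 0 give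
D²ρ(v, v) = 0 on pairing with v. For v the derivative of the maximizer in the direction w, the same
pairing yields ⟨w, v⟩ = t D²ρ(v, v). -/
lemma hasFDerivAt_supportPt [FiniteDimensional ℝ E] (hK : IsSmoothPos K) {y : E} (hy : y ≠ 0) :
    ContDiffAt ℝ 1 (supportPt K) y ∧ ∀ w, (inner ℝ y w : ℝ) = 0 → w ≠ 0 →
      0 < (inner ℝ (fderiv ℝ (supportPt K) y w) w : ℝ) := by
  set x := supportPt K y with hx
  have hmax := fun k hk => inner_le_inner_supportPt K y (k := k) hk
  have hfr : x ∈ frontier (K : Set E) :=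
    ⟨subset_closure (supportPt_mem K y), not_mem_interior_of_maximizer hy hmax⟩
  obtain ⟨U, ρ, hU, hxU, hρ, hKU, hρx, hpos⟩ := hK.smooth_boundary x hfr
  have hρd : ∀ z ∈ U, ContDiffAt ℝ ∞ ρ z := fun z hz => hρ.contDiffAt (hU.mem_nhds hz)
  have hρ1 : ContDiffAt ℝ 1 (fderiv ℝ ρ) x :=
    (contDiffAt_infty.1 (hρd x hxU) 2).fderiv_right (m := 1) (by norm_num)
  obtain ⟨hρ0, t, ht, hyt⟩ := exists_lagrange hU hKU (supportPt_mem K y) hxU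
    ((hρd x hxU).differentiableAt (by simp)) hρx hy hmax
  set G : E × ℝ → (E →L[ℝ] ℝ) × ℝ := fun p => (p.2 • fderiv ℝ ρ p.1, ρ p.1) with hG
  have hGd : ContDiffAt ℝ 1 G (x, t) := by
    have h1 : ContDiffAt ℝ 1 (fun p : E × ℝ => fderiv ℝ ρ p.1) (x, t) :=
      hρ1.comp (x, t) contDiffAt_fst
    have h2 : ContDiffAt ℝ 1 (fun p : E × ℝ => ρ p.1) (x, t) :=
      ((hρd x hxU).of_le (by simp)).comp (x, t) contDiffAt_fst
    exact (contDiffAt_snd.smul h1).prodMk h2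
  set D := fderiv ℝ (fderiv ℝ ρ) x with hD
  set L : E × ℝ →L[ℝ] (E →L[ℝ] ℝ) × ℝ :=
    (t • (D ∘L ContinuousLinearMap.fst ℝ E ℝ) +
      (ContinuousLinearMap.snd ℝ E ℝ).smulRight (fderiv ℝ ρ x)).prod
      (fderiv ℝ ρ x ∘L ContinuousLinearMap.fst ℝ E ℝ) with hL
  have hLapp : ∀ v s, L (v, s) = (t • D v + s • fderiv ℝ ρ x, fderiv ℝ ρ x v) := fun v s => rfl
  have hGL : HasFDerivAt G L (x, t) := by
    have h1 : HasFDerivAt (fun p : E × ℝ => fderiv ℝ ρ p.1)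
        (D ∘L ContinuousLinearMap.fst ℝ E ℝ) (x, t) :=
      HasFDerivAt.comp (x, t) (hρ1.differentiableAt (by simp)).hasFDerivAt hasFDerivAt_fst
    have h2 : HasFDerivAt (fun p : E × ℝ => ρ p.1)
        (fderiv ℝ ρ x ∘L ContinuousLinearMap.fst ℝ E ℝ) (x, t) :=
      HasFDerivAt.comp (x, t) ((hρd x hxU).differentiableAt (by simp)).hasFDerivAt hasFDerivAt_fst
    exact ((hasFDerivAt_snd (𝕜 := ℝ) (p := (x, t))).smul h1).prodMk h2
  have hinj : Function.Injective L := by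
    rw [injective_iff_map_eq_zero]
    rintro ⟨v, s⟩ hvs
    rw [hLapp, Prod.mk_eq_zero] at hvs
    have hv : v = 0 := by
      by_contra hv
      have h1 := congrArg (fun T : E →L[ℝ] ℝ => T v) hvs.1
      simp only [_root_.add_apply, _root_.smul_apply, smul_eq_mul,
        hvs.2, mul_zero, add_zero, _root_.zero_apply] at h1
      exact (mul_pos ht (hpos v hv hvs.2)).ne' h1
    have h2 := hvs.1
    rw [hv, map_zero, smul_zero, zero_add, smul_eq_zero] at h2
    rw [hv, h2.resolve_right hρx, Prod.mk_zero_zero]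
  have hdim : Module.finrank ℝ (E × ℝ) = Module.finrank ℝ ((E →L[ℝ] ℝ) × ℝ) := by
    have : Module.finrank ℝ E = Module.finrank ℝ (E →L[ℝ] ℝ) :=
      (InnerProductSpace.toDual ℝ E).toLinearEquiv.finrank_eq
    simp [this]
  set e : (E × ℝ) ≃L[ℝ] (E →L[ℝ] ℝ) × ℝ :=
    (LinearEquiv.ofInjectiveOfFinrankEq (L : E × ℝ →ₗ[ℝ] _) hinj hdim).toContinuousLinearEquiv
    with he
  have heL : ∀ p, e p = L p := fun p => rfl
  have hGe : HasFDerivAt G (e : E × ℝ →L[ℝ] (E →L[ℝ] ℝ) × ℝ) (x, t) := by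
    have : (e : E × ℝ →L[ℝ] (E →L[ℝ] ℝ) × ℝ) = L := ContinuousLinearMap.ext heL
    rw [this]; exact hGL
  have hst := hGd.hasStrictFDerivAt' hGe one_ne_zero
  set Ψ := hGd.localInverse hGe one_ne_zero with hΨ
  have hGxt : G (x, t) = (innerSL ℝ y, 0) := by rw [hyt, hG, ← hρ0]
  have hΨ1 : ContDiffAt ℝ 1 Ψ (innerSL ℝ y, 0) := hGxt ▸ hGd.to_localInverse hGe one_ne_zero
  have hΨ2 : HasFDerivAt Ψ (e.symm : (E →L[ℝ] ℝ) × ℝ →L[ℝ] E × ℝ) (innerSL ℝ y, 0) :=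
    hGxt ▸ hst.to_localInverse.hasFDerivAt
  set ι : E →L[ℝ] (E →L[ℝ] ℝ) × ℝ := (innerSL ℝ).prod 0 with hι
  have hιapp : ∀ z, ι z = (innerSL ℝ z, 0) := fun z => rfl
  obtain ⟨v0, hv0⟩ : ∃ v0, fderiv ℝ ρ x v0 ≠ 0 := by
    by_contra! hcon
    exact hρx (ContinuousLinearMap.ext hcon)
  have hcont := continuousAt_supportPt hK hy
  have hDcont : ContinuousAt (fun z => fderiv ℝ ρ (supportPt K z)) y :=
    ContinuousAt.comp (f := supportPt K) hρ1.continuousAt hcont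
  -- Testing the Lagrange condition on a fixed v0 recovers the multiplier as a continuous function
  -- of z. This continuity keeps the solution in the domain of the local inverse.
  set τ : E → ℝ := fun z => inner ℝ z v0 / fderiv ℝ ρ (supportPt K z) v0 with hτ
  have hDv0 : ContinuousAt (fun z => fderiv ℝ ρ (supportPt K z) v0) y :=
    hDcont.clm_apply continuousAt_const
  have hτc : ContinuousAt τ y :=
    (continuousAt_id.inner continuousAt_const).div hDv0 hv0
  have hτy : τ y = t := by
    have := congrArg (fun T : E →L[ℝ] ℝ => T v0) hyt
    simp only [innerSL_apply_apply, _root_.smul_apply, smul_eq_mul] at this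
    simp only [hτ, this]
    exact mul_div_cancel_right₀ _ hv0
  have hGeq : ∀ᶠ z in 𝓝 y, G (supportPt K z, τ z) = ι z := by
    filter_upwards [hDv0.eventually_ne hv0, hcont (hU.mem_nhds hxU),
      isOpen_compl_singleton.mem_nhds hy] with z hz hzU hz0
    obtain ⟨hz1, s, hs, hzs⟩ := exists_lagrange hU hKU (supportPt_mem K z) hzU
      ((hρd _ hzU).differentiableAt (by simp)) (fun h => hz (by rw [h]; rfl)) hz0
      fun k hk => inner_le_inner_supportPt K z hk
    have hτz : τ z = s := by
      have := congrArg (fun T : E →L[ℝ] ℝ => T v0) hzs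
      simp only [innerSL_apply_apply, _root_.smul_apply, smul_eq_mul] at this
      simp only [hτ, this]
      exact mul_div_cancel_right₀ _ hz
    rw [hιapp, hzs, hG]
    simp only [hz1, hτz]
  have hpair : ContinuousAt (fun z => (supportPt K z, τ z)) y := hcont.prodMk hτc
  have hinv : ∀ᶠ z in 𝓝 y, Ψ (ι z) = (supportPt K z, τ z) := by
    have h1 := hst.eventually_left_inverse
    have h2 : Tendsto (fun z => (supportPt K z, τ z)) (𝓝 y) (𝓝 (x, t)) := by
      have := hpair.tendsto
      rwa [hτy] at this
    filter_upwards [h2.eventually h1, hGeq] with z hz hz2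
    rw [← hz2]
    exact hz
  have hsupp : supportPt K =ᶠ[𝓝 y] fun z => (Ψ (ι z)).1 := hinv.mono fun z hz => by simp only [hz]
  have hcd : ContDiffAt ℝ 1 (fun z => (Ψ (ι z)).1) y :=
    contDiffAt_fst.comp y (ContDiffAt.comp (g := Ψ) y hΨ1 ι.contDiff.contDiffAt)
  refine ⟨hcd.congr_of_eventuallyEq hsupp, fun w hyw hw => ?_⟩
  have hder : HasFDerivAt (fun z => (Ψ (ι z)).1)
      (ContinuousLinearMap.fst ℝ E ℝ ∘L (e.symm : (E →L[ℝ] ℝ) × ℝ →L[ℝ] E × ℝ) ∘L ι) y :=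
    hasFDerivAt_fst.comp y (HasFDerivAt.comp (g := Ψ) y hΨ2 ι.hasFDerivAt)
  rw [hsupp.fderiv_eq, hder.fderiv]
  obtain ⟨⟨v, s⟩, hvs⟩ : ∃ p, e.symm (ι w) = p := ⟨_, rfl⟩
  have h5 : L (v, s) = ι w := by rw [← heL, ← hvs, e.apply_symm_apply]
  rw [hLapp, hιapp, Prod.mk.injEq] at h5
  have h6 : (ContinuousLinearMap.fst ℝ E ℝ ∘L (e.symm : (E →L[ℝ] ℝ) × ℝ →L[ℝ] E × ℝ) ∘L ι) w = v := by
    simp [hvs]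
  rw [h6, real_inner_comm]
  have h7 := congrArg (fun T : E →L[ℝ] ℝ => T v) h5.1
  simp only [innerSL_apply_apply, _root_.smul_apply, _root_.add_apply,
    smul_eq_mul, h5.2, mul_zero, add_zero] at h7
  rw [← h7]
  refine mul_pos ht (hpos v (fun hv => ?_) h5.2)
  -- If v = 0 then w is a multiple of the normal, hence of y; being orthogonal to y it would vanish.
  have h8 := congrArg (fun T : E →L[ℝ] ℝ => T w) h5.1
  have h9 := congrArg (fun T : E →L[ℝ] ℝ => T w) hyt
  simp only [innerSL_apply_apply, _root_.smul_apply, _root_.add_apply,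
    smul_eq_mul, hv, map_zero, _root_.zero_apply, hyw, mul_zero, zero_add] at h8 h9
  rw [(mul_eq_zero.1 h9.symm).resolve_left ht.ne', mul_zero] at h8
  exact hw (inner_self_eq_zero.1 h8.symm)

lemma fderiv_supportFun (hK : IsSmoothPos K) {y : E} (hy : y ≠ 0) :
    fderiv ℝ (supportFun K) =ᶠ[𝓝 y] fun z => innerSL ℝ (supportPt K z) := by
  filter_upwards [isOpen_compl_singleton.mem_nhds hy] with z hz
  exact (hasFDerivAt_supportFun hK hz).fderiv

variable [FiniteDimensional ℝ E]

lemma homC2_supportFun (hK : IsSmoothPos K) : HomC2 (supportFun K) where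
  contDiffOn := by
    have : ContDiffOn ℝ (1 + 1) (supportFun K) {0}ᶜ := by
      rw [contDiffOn_succ_iff_fderiv_of_isOpen isOpen_compl_singleton]
      refine ⟨fun y hy => (hasFDerivAt_supportFun hK hy).differentiableAt.differentiableWithinAt,
        by simp, fun y hy => ?_⟩
      exact (((innerSL ℝ).contDiff.contDiffAt.comp y (hasFDerivAt_supportPt hK hy).1
        ).congr_of_eventuallyEq (fderiv_supportFun hK hy)).contDiffWithinAt
    exact this
  hom r hr x := supportFun_smul K hr x

lemma fderiv_fderiv_supportFun_pos (hK : IsSmoothPos K) {y : E} (hy : y ≠ 0) {w : E}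
    (hyw : (inner ℝ y w : ℝ) = 0) (hw : w ≠ 0) :
    0 < fderiv ℝ (fderiv ℝ (supportFun K)) y w w := by
  obtain ⟨h1, h2⟩ := hasFDerivAt_supportPt hK hy
  rw [(fderiv_supportFun hK hy).fderiv_eq]
  have : HasFDerivAt (fun z => innerSL ℝ (supportPt K z))
      ((innerSL ℝ).comp (fderiv ℝ (supportPt K) y)) y :=
    (innerSL ℝ).hasFDerivAt.comp y (h1.differentiableAt (by simp)).hasFDerivAt
  rw [this.fderiv]
  exact h2 w hyw hw

open Matrix in
-- Decompose v = w + aθ with w tangent: the quadratic form is D²h(w, w) + a².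
lemma posDef_fullHess_supportFun (hK : IsSmoothPos K) {n : ℕ}
    (b : OrthonormalBasis (Fin n) ℝ E) (θ : sphere (0 : E) 1) :
    (fullHess b (supportFun K) θ).PosDef := by
  have hh := homC2_supportFun hK
  have hθ : (θ : E) ≠ 0 := ne_zero_of_mem_unit_sphere θ
  have hθ1 : ‖(θ : E)‖ = 1 := norm_eq_of_mem_sphere θ
  have hquad : ∀ v : E, coord b v ⬝ᵥ fullHess b (supportFun K) θ *ᵥ coord b v
      = fderiv ℝ (fderiv ℝ (supportFun K)) θ v v + (inner ℝ (θ : E) v) ^ 2 := by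
    intro v
    rw [fullHess, Matrix.add_mulVec, dotProduct_add, coord_dotProduct_hessMatrix,
      vecMulVec_mulVec, dotProduct_smul]
    simp only [coord_dotProduct, real_inner_comm (θ : E) v]
    simp [sq]
  refine Matrix.PosDef.of_dotProduct_mulVec_pos ?_ fun c hc => ?_
  · rw [Matrix.IsHermitian, conjTranspose_eq_transpose_of_trivial, fullHess, transpose_add,
      transpose_hessMatrix b hh.contDiffOn hθ, transpose_vecMulVec]
  · obtain ⟨v, rfl⟩ : ∃ v : E, coord b v = c :=
      ⟨∑ i, c i • b i, by ext i; simp [coord, inner_sum, real_inner_smul_right,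
        b.inner_eq_ite]⟩
    have hv : v ≠ 0 := by
      rintro rfl
      exact hc (by ext i; simp [coord])
    rw [star_trivial, hquad]
    set a : ℝ := inner ℝ (θ : E) v with ha
    set w := v - a • (θ : E) with hw
    have hθw : (inner ℝ (θ : E) w : ℝ) = 0 := by
      rw [hw, inner_sub_right, real_inner_smul_right, real_inner_self_eq_norm_sq, hθ1, ← ha]
      ring
    have hself : ∀ u, fderiv ℝ (fderiv ℝ (supportFun K)) θ u θ = 0 := fun u => by
      rw [fderiv_fderiv_self_of_homogeneous (k := 1) hh.contDiffOn
        (fun r hr y => by simpa using hh.hom r hr y) hθ]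
      simp
    have hself' : ∀ u, fderiv ℝ (fderiv ℝ (supportFun K)) θ θ u = 0 := fun u => by
      rw [fderiv_fderiv_symm hh.contDiffOn hθ, hself]
    have hvv : fderiv ℝ (fderiv ℝ (supportFun K)) θ v v
        = fderiv ℝ (fderiv ℝ (supportFun K)) θ w w := by
      have : v = w + a • (θ : E) := by rw [hw]; abel
      rw [this]
      simp [hself, hself']
    rw [hvv]
    by_cases hw0 : w = 0
    · have : a ≠ 0 := by
        rintro h0
        apply hv
        have : v = w + a • (θ : E) := by rw [hw]; abel
        rw [this, hw0, h0]; simp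
      rw [hw0]
      simp only [map_zero, zero_add]
      positivity
    · have := fderiv_fderiv_supportFun_pos hK hθ hθw hw0
      positivity

end Support

/-! ### The tensor `D²u` in coordinates -/

section HomExt

variable {E : Type*} [NormedAddCommGroup E] [InnerProductSpace ℝ E]

lemma homExt_zero (u : sphere (0 : E) 1 → ℝ) : homExt u 0 = 0 := by simp [homExt]

lemma homExt_sphere (u : sphere (0 : E) 1 → ℝ) (θ : sphere (0 : E) 1) : homExt u θ = u θ := by
  have h1 : ‖(θ : E)‖ = 1 := norm_eq_of_mem_sphere θ
  rw [homExt, dif_neg (ne_zero_of_mem_unit_sphere θ)]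
  have h2 : ∀ p : ‖(θ : E)‖⁻¹ • (θ : E) ∈ sphere (0 : E) 1,
      (⟨‖(θ : E)‖⁻¹ • (θ : E), p⟩ : sphere (0 : E) 1) = θ := fun p => Subtype.ext (by simp)
  rw [h2, h1, one_mul]

lemma homExt_eq (u : sphere (0 : E) 1 → ℝ) {f : E → ℝ}
    (hf : ∀ r : ℝ, 0 < r → ∀ x, f (r • x) = r * f x) (hfu : ∀ θ : sphere (0 : E) 1, f θ = u θ) :
    homExt u = f := by
  ext x
  by_cases hx : x = 0
  · have := hf 2 two_pos 0
    rw [smul_zero] at this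
    rw [hx, homExt_zero]
    linarith
  · have hx' : 0 < ‖x‖ := norm_pos_iff.2 hx
    rw [homExt, dif_neg hx, ← hfu, hf _ (inv_pos.2 hx'), ← mul_assoc, mul_inv_cancel₀ hx'.ne',
      one_mul]

lemma homExt_smul (u : sphere (0 : E) 1 → ℝ) {r : ℝ} (hr : 0 < r) (x : E) :
    homExt u (r • x) = r * homExt u x := by
  by_cases hx : x = 0
  · rw [hx, smul_zero, homExt_zero, mul_zero]
  · rw [homExt, homExt, dif_neg hx, dif_neg (smul_ne_zero hr.ne' hx), ← mul_assoc]
    have hn : ‖r • x‖ = r * ‖x‖ := by rw [norm_smul, Real.norm_of_nonneg hr.le]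
    congr 1
    congr 1
    refine Subtype.ext ?_
    simp only [hn, smul_smul, mul_inv]
    congr 1
    field_simp

lemma homExt_supp (K : ConvexBody E) : homExt (supp K) = supportFun K :=
  homExt_eq _ (fun _ hr x => supportFun_smul K hr x) fun _ => rfl

lemma IsC2.homC2 {z : sphere (0 : E) 1 → ℝ} (hz : IsC2 z) : HomC2 (homExt z) :=
  ⟨hz, fun _ hr x => homExt_smul z hr x⟩

lemma HomC2.isC2 {f : E → ℝ} (hf : HomC2 f) : IsC2 fun θ : sphere (0 : E) 1 => f θ := by
  rw [IsC2, homExt_eq _ hf.hom fun θ => rfl]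
  exact hf.contDiffOn

/-- The `0`-homogeneous extension of a function on the sphere. -/
def homExtZero (z : sphere (0 : E) 1 → ℝ) (x : E) : ℝ := ‖x‖⁻¹ * homExt z x

lemma homExtZero_sphere (z : sphere (0 : E) 1 → ℝ) (θ : sphere (0 : E) 1) :
    homExtZero z θ = z θ := by
  rw [homExtZero, homExt_sphere, norm_eq_of_mem_sphere θ, inv_one, one_mul]

lemma homExtZero_smul (z : sphere (0 : E) 1 → ℝ) {r : ℝ} (hr : 0 < r) (x : E) :
    homExtZero z (r • x) = homExtZero z x := by
  rw [homExtZero, homExtZero, homExt_smul z hr, norm_smul, Real.norm_of_nonneg hr.le]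
  field_simp

lemma IsC2.contDiffOn_homExtZero {z : sphere (0 : E) 1 → ℝ} (hz : IsC2 z) :
    ContDiffOn ℝ 2 (homExtZero z) {0}ᶜ := by
  refine ContDiffOn.mul (fun x hx => ?_) hz
  exact ((contDiffAt_norm ℝ hx).inv (norm_ne_zero_iff.2 hx)).contDiffWithinAt

lemma homExt_mul {z : sphere (0 : E) 1 → ℝ} {h : E → ℝ}
    (hh : ∀ r : ℝ, 0 < r → ∀ x, h (r • x) = r * h x) :
    homExt (fun θ => z θ * h θ) = fun x => homExtZero z x * h x :=
  homExt_eq _ (fun r hr x => by rw [homExtZero_smul z hr, hh r hr]; ring)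
    fun θ => by rw [homExtZero_sphere]

lemma IsC2.continuous {z : sphere (0 : E) 1 → ℝ} (hz : IsC2 z) : Continuous z := by
  have := hz.homC2.continuousOn_sphere
  simpa only [homExt_sphere] using this

end HomExt

/-! ### Block decomposition along ℝθ ⊕ θ^⊥ and the matrices of D²u -/

section Coordinates

open Matrix

variable {E : Type*} [NormedAddCommGroup E] [InnerProductSpace ℝ E] [FiniteDimensional ℝ E]
  {n : ℕ} (b : OrthonormalBasis (Fin n) ℝ E)

lemma inner_fderiv_gradient {f : E → ℝ} (hf : ContDiffOn ℝ 2 f {0}ᶜ) {x : E} (hx : x ≠ 0)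
    (v w : E) : inner ℝ (fderiv ℝ (gradient f) x v) w = fderiv ℝ (fderiv ℝ f) x v w := by
  set T : (E →L[ℝ] ℝ) →L[ℝ] E :=
    { toFun := (InnerProductSpace.toDual ℝ E).symm
      map_add' := by simp
      map_smul' := by simp
      cont := (InnerProductSpace.toDual ℝ E).symm.continuous } with hT
  have h0 : HasFDerivAt (InnerProductSpace.toDual ℝ E).symm T (fderiv ℝ f x) := T.hasFDerivAt
  have h1 := h0.comp x ((contDiffAt_fderiv hf hx).differentiableAt (by simp)).hasFDerivAt
  change inner ℝ (fderiv ℝ ((InnerProductSpace.toDual ℝ E).symm ∘ fderiv ℝ f) x v) w = _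
  rw [h1.fderiv]
  exact InnerProductSpace.toDual_symm_apply

/-- By Euler's identity the second derivative at θ already takes values in θ^⊥, so the projection in
`hess` changes nothing. -/
lemma coe_hess (u : sphere (0 : E) 1 → ℝ) (hu : IsC2 u) (θ : sphere (0 : E) 1)
    (v : tangent θ) : ((hess u θ v : tangent θ) : E) = fderiv ℝ (gradient (homExt u)) θ v := by
  have hθ : (θ : E) ≠ 0 := ne_zero_of_mem_unit_sphere θ
  have hmem : fderiv ℝ (gradient (homExt u)) θ v ∈ tangent θ := by
    rw [Submodule.mem_orthogonal_singleton_iff_inner_left, inner_fderiv_gradient hu hθ,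
    fderiv_fderiv_self_of_homogeneous (k := 1) hu
      (fun r hr y => by simpa using homExt_smul u hr y) hθ]
    simp
  exact congrArg Subtype.val
    ((tangent θ).orthogonalProjectionOnto_mem_subspace_eq_self ⟨_, hmem⟩)

lemma fderiv_gradient_self {f : E → ℝ} (hf : HomC2 f) {x : E} (hx : x ≠ 0) :
    fderiv ℝ (gradient f) x x = 0 := by
  refine ext_inner_right ℝ fun w => ?_
  rw [inner_fderiv_gradient hf.contDiffOn hx, fderiv_fderiv_symm hf.contDiffOn hx,
    fderiv_fderiv_self_of_homogeneous (k := 1) hf.contDiffOn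
      (fun r hr y => by simpa using hf.hom r hr y) hx]
  simp

/-- The splitting of `E` into the radial and tangential directions. -/
def splitting (θ : sphere (0 : E) 1) :
    ((Submodule.span ℝ {(θ : E)} : Submodule ℝ E) × tangent θ) ≃ₗ[ℝ] E :=
  Submodule.prodEquivOfIsCompl _ _ (Submodule.isCompl_orthogonal _)

lemma splitting_apply (θ : sphere (0 : E) 1)
    (p : (Submodule.span ℝ {(θ : E)} : Submodule ℝ E) × tangent θ) :
    splitting θ p = (p.1 : E) + p.2 := rfl

lemma toMatrix_fderiv_gradient {f : E → ℝ} (hf : ContDiffOn ℝ 2 f {0}ᶜ) {x : E} (hx : x ≠ 0) :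
    LinearMap.toMatrix b.toBasis b.toBasis (fderiv ℝ (gradient f) x : E →ₗ[ℝ] E)
      = hessMatrix b f x := by
  ext i j
  rw [LinearMap.toMatrix_apply, hessMatrix, Matrix.of_apply, fderiv_fderiv_symm hf hx]
  simp only [OrthonormalBasis.coe_toBasis, OrthonormalBasis.coe_toBasis_repr_apply,
    OrthonormalBasis.repr_apply_apply, ContinuousLinearMap.coe_coe]
  rw [real_inner_comm, inner_fderiv_gradient hf hx]

lemma conj_splitting_hess {u : sphere (0 : E) 1 → ℝ} (hu : IsC2 u) (θ : sphere (0 : E) 1) :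
    (splitting θ).conj (LinearMap.prodMap 0 (hess u θ))
      = (fderiv ℝ (gradient (homExt u)) θ : E →ₗ[ℝ] E) := by
  refine LinearMap.ext fun x => ?_
  obtain ⟨p, rfl⟩ := (splitting θ).surjective x
  rw [LinearEquiv.conj_apply_apply, LinearEquiv.symm_apply_apply, LinearMap.prodMap_apply,
    splitting_apply, splitting_apply, coe_hess u hu]
  obtain ⟨c, hc⟩ := Submodule.mem_span_singleton.1 p.1.2
  have h0 : fderiv ℝ (gradient (homExt u)) θ (p.1 : E) = 0 := by
    rw [← hc, map_smul, fderiv_gradient_self hu.homC2 (ne_zero_of_mem_unit_sphere θ), smul_zero]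
  simp [h0]

/-- The matrix of the orthogonal projection to the radial direction. -/
lemma toMatrix_conj_splitting_id (θ : sphere (0 : E) 1) :
    LinearMap.toMatrix b.toBasis b.toBasis ((splitting θ).conj (LinearMap.prodMap LinearMap.id 0))
      = vecMulVec (coord b (θ : E)) (coord b (θ : E)) := by
  have hθ : ‖(θ : E)‖ = 1 := norm_eq_of_mem_sphere θ
  have h1 : ∀ x : E, (splitting θ).conj (LinearMap.prodMap LinearMap.id 0) x
      = (inner ℝ (θ : E) x : ℝ) • (θ : E) := by
    intro x
    obtain ⟨p, rfl⟩ := (splitting θ).surjective x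
    rw [LinearEquiv.conj_apply_apply, LinearEquiv.symm_apply_apply, LinearMap.prodMap_apply,
      splitting_apply, splitting_apply]
    obtain ⟨c, hc⟩ := Submodule.mem_span_singleton.1 p.1.2
    have h2 : (inner ℝ (θ : E) (p.2 : E) : ℝ) = 0 :=
      Submodule.mem_orthogonal_singleton_iff_inner_right.1 p.2.2
    rw [inner_add_right, h2, ← hc, real_inner_smul_right, real_inner_self_eq_norm_sq, hθ]
    simp [hc]
  ext i j
  rw [LinearMap.toMatrix_apply, h1, vecMulVec_apply]
  simp only [OrthonormalBasis.coe_toBasis, OrthonormalBasis.coe_toBasis_repr_apply,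
    OrthonormalBasis.repr_apply_apply, coord, real_inner_smul_right]
  rw [mul_comm, real_inner_comm (b j)]

/-- `fullHess` represents the block endomorphism id ⊕ D²u of ℝθ ⊕ θ^⊥. Determinants and inverses on
the varying tangent spaces can thus be computed with n × n matrices in one fixed basis. -/
lemma toMatrix_conj_splitting {u : sphere (0 : E) 1 → ℝ} (hu : IsC2 u) (θ : sphere (0 : E) 1) :
    LinearMap.toMatrix b.toBasis b.toBasis
      ((splitting θ).conj (LinearMap.prodMap LinearMap.id (hess u θ)))
      = fullHess b (homExt u) θ := by
  have h1 : LinearMap.prodMap LinearMap.id (hess u θ) = LinearMap.prodMap 0 (hess u θ) +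
      LinearMap.prodMap (LinearMap.id : _ →ₗ[ℝ] (Submodule.span ℝ {(θ : E)} : Submodule ℝ E)) 0 := by
    refine LinearMap.ext fun p => ?_
    simp
  rw [h1, map_add, map_add, toMatrix_conj_splitting_id, conj_splitting_hess hu,
    toMatrix_fderiv_gradient b hu (ne_zero_of_mem_unit_sphere θ), fullHess]

lemma det_hess {u : sphere (0 : E) 1 → ℝ} (hu : IsC2 u) (θ : sphere (0 : E) 1) :
    LinearMap.det (hess u θ) = (fullHess b (homExt u) θ).det := by
  rw [← toMatrix_conj_splitting b hu, LinearMap.det_toMatrix, LinearEquiv.conj_apply,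
    LinearMap.comp_assoc, LinearMap.det_conj, LinearMap.det_prodMap, LinearMap.det_id, one_mul]

/-- The inverse of id ⊕ D²h is id ⊕ (D²h)⁻¹, and its product with 0 ⊕ D²u has no radial trace. The
determinant hypothesis makes `Ring.inverse` a genuine inverse. -/
lemma trace_inverse_hess_mul {h u : sphere (0 : E) 1 → ℝ} (hh : IsC2 h) (hu : IsC2 u)
    (θ : sphere (0 : E) 1) (hdet : (fullHess b (homExt h) θ).det ≠ 0) :
    LinearMap.trace ℝ (tangent θ) (Ring.inverse (hess h θ) * hess u θ)
      = relTrace b (homExt h) (homExt u) θ := by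
  have hunit : IsUnit (hess h θ) := by
    rw [LinearMap.isUnit_iff_isUnit_det, det_hess b hh]
    exact isUnit_iff_ne_zero.2 hdet
  set R := Ring.inverse (hess h θ) with hR
  have hRh : R * hess h θ = 1 := Ring.inverse_mul_cancel _ hunit
  have hinv : (fullHess b (homExt h) θ)⁻¹ = LinearMap.toMatrix b.toBasis b.toBasis
      ((splitting θ).conj (LinearMap.prodMap LinearMap.id R)) := by
    refine Matrix.inv_eq_left_inv ?_
    rw [← toMatrix_conj_splitting b hh, ← LinearMap.toMatrix_mul, Module.End.mul_eq_comp,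
      ← LinearEquiv.conj_comp, LinearMap.prodMap_comp, ← Module.End.mul_eq_comp R, hRh]
    have : LinearMap.prodMap ((LinearMap.id : _ →ₗ[ℝ] (Submodule.span ℝ {(θ : E)} : Submodule ℝ E)) ∘ₗ
      LinearMap.id) (1 : Module.End ℝ (tangent θ)) = LinearMap.id := LinearMap.ext fun p => rfl
    rw [this, LinearEquiv.conj_id, LinearMap.toMatrix_id]
  rw [relTrace, hinv, ← toMatrix_fderiv_gradient b hu (ne_zero_of_mem_unit_sphere θ),
    ← conj_splitting_hess hu, ← LinearMap.toMatrix_mul,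
    Module.End.mul_eq_comp ((splitting θ).conj _), ← LinearEquiv.conj_comp, LinearMap.prodMap_comp, LinearMap.comp_zero,
    ← LinearMap.trace_eq_matrix_trace ℝ b.toBasis, LinearMap.trace_conj',
    LinearMap.trace_prodMap', map_zero, zero_add, Module.End.mul_eq_comp]

end Coordinates

/-! ### The Hilbert--Brunn--Minkowski operator in coordinates -/

section Operator

open Matrix

variable {E : Type*} [NormedAddCommGroup E] [InnerProductSpace ℝ E] [FiniteDimensional ℝ E]
  {n : ℕ} (b : OrthonormalBasis (Fin n) ℝ E) {K : ConvexBody E}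

lemma isC2_supp (hK : IsSmoothPos K) : IsC2 (supp K) := (homC2_supportFun hK).isC2

lemma supp_pos (hK : IsSmoothPos K) (θ : sphere (0 : E) 1) : 0 < supp K θ :=
  supportFun_pos hK.zero_mem_interior (ne_zero_of_mem_unit_sphere θ)

/-- The `1`-homogeneous extension of `z h_K`. -/
def mulSupp (K : ConvexBody E) (z : sphere (0 : E) 1 → ℝ) : E → ℝ :=
  fun x => homExtZero z x * supportFun K x

lemma homExt_mul_supp (z : sphere (0 : E) 1 → ℝ) :
    homExt (fun θ => z θ * supp K θ) = mulSupp K z :=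
  homExt_mul fun _ hr x => supportFun_smul K hr x

lemma mulSupp_sphere (z : sphere (0 : E) 1 → ℝ) (θ : sphere (0 : E) 1) :
    mulSupp K z θ = z θ * supp K θ := by rw [mulSupp, homExtZero_sphere]; rfl

lemma homC2_mulSupp (hK : IsSmoothPos K) {z : sphere (0 : E) 1 → ℝ} (hz : IsC2 z) :
    HomC2 (mulSupp K z) where
  contDiffOn := hz.contDiffOn_homExtZero.mul (homC2_supportFun hK).contDiffOn
  hom r hr x := by rw [mulSupp, homExtZero_smul z hr, supportFun_smul K hr]; simp only [mulSupp]; ring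

lemma laplacian_eq (hK : IsSmoothPos K) {z : sphere (0 : E) 1 → ℝ} (hz : IsC2 z)
    (θ : sphere (0 : E) 1) :
    laplacian K z θ = relTrace b (supportFun K) (mulSupp K z) θ - ((n : ℝ) - 1) * z θ := by
  have hu : IsC2 fun θ => z θ * supp K θ := by
    rw [IsC2, homExt_mul_supp]
    exact (homC2_mulSupp hK hz).contDiffOn
  have hdim : Module.finrank ℝ E = n := by
    rw [Module.finrank_eq_card_basis b.toBasis, Fintype.card_fin]
  rw [laplacian, trace_inverse_hess_mul b (isC2_supp hK) hu θ, homExt_supp, homExt_mul_supp, hdim]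
  rw [homExt_supp]
  exact (posDef_fullHess_supportFun hK b θ).det_pos.ne'

/-- The density of `ν_K` with respect to the Lebesgue measure on the sphere. -/
def density (K : ConvexBody E) (θ : sphere (0 : E) 1) : ℝ :=
  supportFun K θ * (fullHess b (supportFun K) θ).det

lemma density_pos (hK : IsSmoothPos K) (θ : sphere (0 : E) 1) : 0 < density b K θ :=
  mul_pos (supp_pos hK θ) (posDef_fullHess_supportFun hK b θ).det_pos

variable [Nontrivial E] [MeasurableSpace E] [BorelSpace E]

lemma continuous_density (hK : IsSmoothPos K) : Continuous (density b K) :=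
  (homC2_supportFun hK).continuousOn_sphere.mul
    (continuous_fullHess_sphere b (homC2_supportFun hK)).matrix_det

lemma nu_eq (hK : IsSmoothPos K) :
    nu K = (volume : Measure E).toSphere.withDensity fun θ => ENNReal.ofReal (density b K θ) := by
  rw [nu]
  congr 1
  ext θ
  rw [density, det_hess b (isC2_supp hK), homExt_supp]
  rfl

lemma integral_nu (hK : IsSmoothPos K) (g : sphere (0 : E) 1 → ℝ) :
    ∫ θ, g θ ∂nu K = ∫ θ, g θ * density b K θ ∂(volume : Measure E).toSphere := by
  rw [nu_eq b hK, integral_withDensity_eq_integral_toReal_smul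
    (continuous_density b hK).measurable.ennreal_ofReal (by simp)]
  congr 1
  ext θ
  rw [ENNReal.toReal_ofReal (density_pos b hK θ).le, smul_eq_mul, mul_comm]

lemma isFiniteMeasure_nu (hK : IsSmoothPos K) : IsFiniteMeasure (nu K) := by
  rw [nu_eq (stdOrthonormalBasis ℝ E) hK]
  exact isFiniteMeasure_withDensity_ofReal
    (integrable_sphere (continuous_density (stdOrthonormalBasis ℝ E) hK)).2


lemma continuous_laplacian (hK : IsSmoothPos K) {z : sphere (0 : E) 1 → ℝ} (hz : IsC2 z) :
    Continuous (laplacian K z) := by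
  rw [funext (laplacian_eq (stdOrthonormalBasis ℝ E) hK hz)]
  exact (continuous_relTrace _ (homC2_supportFun hK) (posDef_fullHess_supportFun hK _)
    (homC2_mulSupp hK hz)).sub (continuous_const.mul hz.continuous)

lemma memLp_nu (hK : IsSmoothPos K) {p : ENNReal} {g : sphere (0 : E) 1 → ℝ} (hg : Continuous g) :
    MemLp g p (nu K) := by
  have hcomp : CompactSpace (sphere (0 : E) 1) := isCompact_iff_compactSpace.1 (isCompact_sphere 0 1)
  have := isFiniteMeasure_nu hK
  exact hg.memLp_of_hasCompactSupport (HasCompactSupport.of_compactSpace _)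

end Operator

/-! ### Wirtinger's inequality and the planar Minkowski inequality -/

section Wirtinger

open Real Set

/-- Wirtinger's inequality. -/
lemma integral_sq_le_integral_deriv_sq {f f' : ℝ → ℝ} (hf : ∀ x, HasDerivAt f (f' x) x)
    (hf' : Continuous f') (hper : f π = f (-π)) (h0 : ∫ x in (-π)..π, f x = 0) :
    ∫ x in (-π)..π, f x ^ 2 ≤ ∫ x in (-π)..π, f' x ^ 2 := by
  have hab : -π < π := by linarith [pi_pos]
  have hfc : Continuous f := continuous_iff_continuousAt.2 fun x => (hf x).continuousAt
  have hL2 : ∀ g : ℝ → ℝ, Continuous g →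
      MemLp (fun x => (g x : ℂ)) 2 (volume.restrict (Ioc (-π) π)) := by
    intro g hg
    have hgc : Continuous fun x => (g x : ℂ) := Complex.continuous_ofReal.comp hg
    obtain ⟨C, hC⟩ := isCompact_Icc.exists_bound_of_continuousOn (s := Icc (-π) π) hgc.continuousOn
    refine MemLp.of_bound hgc.aestronglyMeasurable C ?_
    exact (ae_restrict_iff' measurableSet_Ioc).2
      (.of_forall fun x hx => hC x (Ioc_subset_Icc_self hx))
  have h1 := hasSum_sq_fourierCoeffOn hab (hL2 f hfc)
  have h2 := hasSum_sq_fourierCoeffOn hab (hL2 f' hf')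
  -- Parseval, compared term by term: the mean of f vanishes, and for n ≠ 0 periodicity gives |n|
  -- |f̂(n)| = |f̂'(n)|, the interval having length 2π.
  have hle := hasSum_le (fun n => ?_) h1 h2
  · simp only [Complex.norm_real, norm_eq_abs, sq_abs, smul_eq_mul] at hle
    exact le_of_mul_le_mul_left hle (inv_pos.2 (by linarith))
  · by_cases hn : n = 0
    · have : fourierCoeffOn hab (fun x => (f x : ℂ)) n = 0 := by
        rw [fourierCoeffOn_eq_integral, hn]
        simp only [neg_zero, fourier_zero, one_smul]
        rw [intervalIntegral.integral_ofReal, h0]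
        simp
      rw [this]
      simp
    · have := fourierCoeffOn_of_hasDerivAt hab (f := fun x => (f x : ℂ))
        (f' := fun x => (f' x : ℂ)) hn (fun x _ => (hf x).ofReal_comp)
        ((Complex.continuous_ofReal.comp hf').intervalIntegrable _ _)
      rw [this, hper, sub_self, mul_zero, zero_sub, norm_mul, mul_pow]
      have h3 : ‖-((π : ℂ) - ((-π : ℝ) : ℂ)) * fourierCoeffOn hab (fun x => (f' x : ℂ)) n‖
          = 2 * π * ‖fourierCoeffOn hab (fun x => (f' x : ℂ)) n‖ := by
        rw [norm_mul, norm_neg]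
        congr 1
        rw [← Complex.ofReal_sub, Complex.norm_real, norm_eq_abs, abs_of_pos (by linarith)]
        ring
      rw [← neg_mul, h3]
      have h4 : ‖(1 : ℂ) / (-2 * π * Complex.I * n)‖ = 1 / (2 * π * |(n : ℝ)|) := by
        simp [abs_of_pos pi_pos]
      rw [h4]
      have hn1 : (1 : ℝ) ≤ |(n : ℝ)| := by exact_mod_cast Int.one_le_abs hn
      have h5 : 1 / (2 * π * |(n : ℝ)|) * (2 * π) ≤ 1 := by
        have hp := pi_pos
        rw [div_mul_eq_mul_div, one_mul, div_le_one (by positivity)]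
        nlinarith
      rw [← mul_pow, ← mul_assoc]
      have h6 : 0 ≤ 1 / (2 * π * |(n : ℝ)|) * (2 * π) := by have := pi_pos; positivity
      have h7 := mul_le_of_le_one_left (norm_nonneg (fourierCoeffOn hab (fun x => (f' x : ℂ)) n)) h5
      exact pow_le_pow_left₀ (mul_nonneg h6 (norm_nonneg _)) h7 2

/-- Here q = f + f'', and integration by parts turns ∫ fq into ∫ f² - ∫ f'². -/
lemma integral_mul_nonpos {f f' q : ℝ → ℝ} (hd1 : ∀ x, HasDerivAt f (f' x) x)
    (hd2 : ∀ x, HasDerivAt f' (q x - f x) x) (hq : Continuous q) (hper : f π = f (-π))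
    (hper' : f' π = f' (-π)) (h0 : ∫ x in (-π)..π, f x = 0) : ∫ x in (-π)..π, f x * q x ≤ 0 := by
  have hfc : Continuous f := continuous_iff_continuousAt.2 fun φ => (hd1 φ).continuousAt
  have hf'c : Continuous f' := continuous_iff_continuousAt.2 fun φ => (hd2 φ).continuousAt
  have hW := integral_sq_le_integral_deriv_sq hd1 hf'c hper h0
  have hparts := intervalIntegral.integral_mul_deriv_eq_deriv_mul (a := -π) (b := π)
    (fun φ _ => hd1 φ) (fun φ _ => hd2 φ) (hf'c.intervalIntegrable _ _)
    ((hq.sub hfc).intervalIntegrable _ _)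
  rw [hper, hper', sub_self, zero_sub] at hparts
  have hsplit : ∫ φ in (-π)..π, f φ * q φ
      = (∫ φ in (-π)..π, f φ * (q φ - f φ)) + ∫ φ in (-π)..π, f φ ^ 2 := by
    have h1 : Continuous fun φ => f φ * (q φ - f φ) := hfc.mul (hq.sub hfc)
    have h2 : Continuous fun φ => f φ ^ 2 := hfc.pow 2
    rw [← intervalIntegral.integral_add (h1.intervalIntegrable _ _) (h2.intervalIntegrable _ _)]
    congr 1
    ext φ
    ring
  have hsq : ∫ φ in (-π)..π, f' φ * f' φ = ∫ φ in (-π)..π, f' φ ^ 2 := by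
    congr 1; ext φ; ring
  rw [hsplit, hparts, hsq]
  linarith

end Wirtinger

/-! ### Functions on the unit circle of a Euclidean plane -/

section Circle

open Real Set Matrix

variable {E : Type*} [NormedAddCommGroup E] [InnerProductSpace ℝ E]
  (b : OrthonormalBasis (Fin 2) ℝ E)

/-- The unit speed parametrization of the unit circle. -/
def circlePt (φ : ℝ) : E := cos φ • b 0 + sin φ • b 1

/-- The unit tangent to the unit circle. -/
def circleTan (φ : ℝ) : E := -sin φ • b 0 + cos φ • b 1

lemma hasDerivAt_circlePt (φ : ℝ) : HasDerivAt (circlePt b) (circleTan b φ) φ :=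
  ((hasDerivAt_cos φ).smul_const (b 0)).add ((hasDerivAt_sin φ).smul_const (b 1))

lemma hasDerivAt_circleTan (φ : ℝ) : HasDerivAt (circleTan b) (-circlePt b φ) φ := by
  convert! ((hasDerivAt_sin φ).neg.smul_const (b 0)).add ((hasDerivAt_cos φ).smul_const (b 1))
    using 1
  rw [circlePt]
  module

lemma norm_circlePt (φ : ℝ) : ‖circlePt b φ‖ = 1 := by
  have h : ‖circlePt b φ‖ ^ 2 = 1 := by
    rw [← real_inner_self_eq_norm_sq, circlePt]
    simp only [inner_add_left, inner_add_right, real_inner_smul_left, real_inner_smul_right,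
      b.inner_eq_ite]
    simp only [if_true, Fin.isValue, zero_ne_one, one_ne_zero, if_false]
    nlinarith [sin_sq_add_cos_sq φ]
  nlinarith [norm_nonneg (circlePt b φ)]

lemma circlePt_ne_zero (φ : ℝ) : circlePt b φ ≠ 0 := by
  rw [← norm_ne_zero_iff, norm_circlePt]; exact one_ne_zero

lemma continuous_circlePt : Continuous (circlePt b) :=
  continuous_iff_continuousAt.2 fun φ => (hasDerivAt_circlePt b φ).continuousAt

/-- The radial direction is in the kernel of D²f, so only the tangential second derivative
contributes to the trace. -/
lemma trace_hessMatrix_circlePt {f : E → ℝ} (hf : HomC2 f) (φ : ℝ) :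
    (hessMatrix b f (circlePt b φ)).trace
      = fderiv ℝ (fderiv ℝ f) (circlePt b φ) (circleTan b φ) (circleTan b φ) := by
  have hx := circlePt_ne_zero b φ
  set D := fderiv ℝ (fderiv ℝ f) (circlePt b φ) with hD
  have hself : ∀ v, D v (circlePt b φ) = 0 := fun v => by
    rw [hD, fderiv_fderiv_self_of_homogeneous (k := 1) hf.contDiffOn
      (fun r hr y => by simpa using hf.hom r hr y) hx]
    simp
  have hsymm : D (b 1) (b 0) = D (b 0) (b 1) := fderiv_fderiv_symm hf.contDiffOn hx _ _
  have h0 := hself (b 0)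
  have h1 := hself (b 1)
  simp only [circlePt, map_add, map_smul, smul_eq_mul, hsymm] at h0 h1
  have hsc := sin_sq_add_cos_sq φ
  have hT : D (circleTan b φ) (circleTan b φ) = sin φ ^ 2 * D (b 0) (b 0)
      - 2 * (sin φ * cos φ) * D (b 0) (b 1) + cos φ ^ 2 * D (b 1) (b 1) := by
    simp only [circleTan, map_add, map_smul, _root_.add_apply, _root_.smul_apply, smul_eq_mul, hsymm]
    ring
  have htr : (hessMatrix b f (circlePt b φ)).trace = D (b 0) (b 0) + D (b 1) (b 1) := by
    rw [Matrix.trace_fin_two]; rfl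
  rw [hT, htr]
  linear_combination (cos φ) * h0 + sin φ * h1 - (D (b 0) (b 0) + D (b 1) (b 1)) * hsc

variable [FiniteDimensional ℝ E] [MeasurableSpace E] [BorelSpace E]

/-- The surface measure is defined through the volume. The 0-homogeneous extension of g is therefore
integrated over the unit disc in two ways, by `integral_radial` and in planar polar coordinates; the
radial factor is 1/2 in both. -/
lemma integral_toSphere_eq_circle {g : sphere (0 : E) 1 → ℝ} (hg : Continuous g) :
    ∫ θ, g θ ∂(volume : Measure E).toSphere
      = ∫ φ in (-π)..π, g ⟨circlePt b φ, by simp [norm_circlePt]⟩ := by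
  have hdim : Module.finrank ℝ E = 2 := by
    rw [Module.finrank_eq_card_basis b.toBasis, Fintype.card_fin]
  have hnt : Nontrivial E := Module.nontrivial_of_finrank_pos (R := ℝ) (by omega)
  have hcomp : CompactSpace (sphere (0 : E) 1) := isCompact_iff_compactSpace.1 (isCompact_sphere 0 1)
  obtain ⟨C, hC⟩ : ∃ C, ∀ θ, ‖g θ‖ ≤ C := by
    obtain ⟨C, hC⟩ := isCompact_univ.exists_bound_of_continuousOn hg.continuousOn
    exact ⟨C, fun θ => hC θ (mem_univ θ)⟩
  have hC0 : 0 ≤ C := (norm_nonneg _).trans (hC ⟨circlePt b 0, by simp [norm_circlePt]⟩)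
  set W : E → ℝ := homExtZero g with hW
  have hWs : ∀ θ : sphere (0 : E) 1, ∀ r : ℝ, 0 < r → W (r • (θ : E)) = g θ := fun θ r hr => by
    rw [hW, homExtZero_smul g hr, homExtZero_sphere]
  have hWx : ∀ x (hx : x ≠ 0), W x = g ⟨‖x‖⁻¹ • x, by simp [norm_smul, norm_ne_zero_iff.2 hx]⟩ := by
    intro x hx
    have hx' : 0 < ‖x‖ := norm_pos_iff.2 hx
    rw [← hWs _ _ hx']
    congr 1
    rw [smul_smul, mul_inv_cancel₀ hx'.ne', one_smul]
  have hWc : ContinuousOn W {0}ᶜ := by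
    rw [continuousOn_iff_continuous_domRestrict]
    have : Continuous fun x : ({0}ᶜ : Set E) => g ⟨‖(x : E)‖⁻¹ • (x : E), by
        have : (x : E) ≠ 0 := x.2
        simp [norm_smul, norm_ne_zero_iff.2 this]⟩ := by
      refine hg.comp (Continuous.subtype_mk ?_ _)
      exact (continuous_subtype_val.norm.inv₀ fun x => norm_ne_zero_iff.2 x.2).smul
        continuous_subtype_val
    convert! this using 1
    ext x
    exact hWx x x.2
  have hWb : ∀ x, ‖W x‖ ≤ C := by
    intro x
    by_cases hx : x = 0
    · rw [hx, hW, homExtZero, homExt_zero]; simpa using hC0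
    · rw [hWx x hx]; exact hC _
  have hWm : AEStronglyMeasurable W volume := by
    have := hWc.aestronglyMeasurable (μ := (volume : Measure E)) (measurableSet_singleton 0).compl
    rwa [restrict_compl_singleton] at this
  set F : E → ℝ := fun x => (ball (0 : E) 1).indicator W x with hF
  have hFi : Integrable F := by
    refine (integrable_indicator_iff measurableSet_ball).2 ?_
    exact Measure.integrableOn_of_bounded (M := C) measure_ball_lt_top.ne hWm (.of_forall hWb)
  set κ : ℝ → ℝ := (Iio 1).indicator 1 with hκ
  have hFκ : ∀ x : E, F x = κ ‖x‖ * W x := by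
    intro x
    by_cases hx : ‖x‖ < 1 <;> simp [hF, hκ, Set.indicator, hx]
  have e1 := integral_radial hFi (f := fun _ => 1) (w := g) (κ := κ) (fun _ => one_pos) (by
    intro θ r hr
    rw [hFκ, hWs θ r hr, norm_smul, norm_eq_of_mem_sphere θ, Real.norm_of_nonneg hr.le])
  set ι : ℂ ≃ₗᵢ[ℝ] E := Complex.orthonormalBasisOneI.repr.trans b.repr.symm with hι
  have hιp : ∀ r φ : ℝ, ι (Complex.polarCoord.symm (r, φ)) = r • circlePt b φ := by
    intro r φ
    have h1 : ∀ z : ℂ, ι z = z.re • b 0 + z.im • b 1 := by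
      intro z
      rw [hι, LinearIsometryEquiv.trans_apply, ← b.sum_repr_symm, Fin.sum_univ_two]
      simp
    rw [h1, Complex.polarCoord_symm_apply, circlePt]
    simp [smul_smul, Complex.cos_ofReal_re, Complex.sin_ofReal_re]
  have e2 : ∫ x, F x = ∫ z : ℂ, F (ι z) :=
    (ι.measurePreserving.integral_comp ι.toMeasurableEquiv.measurableEmbedding F).symm
  have hpt : ∀ p ∈ polarCoord.target, p.1 • F (ι (Complex.polarCoord.symm p))
      = (p.1 * κ p.1) * W (circlePt b p.2) := by
    rintro ⟨r, φ⟩ hp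
    rw [polarCoord_target, mem_prod, mem_Ioi] at hp
    have hr : 0 < r := hp.1
    rw [hιp, hFκ, norm_smul, norm_circlePt, Real.norm_of_nonneg hr.le, hW, homExtZero_smul g hr]
    simp only [smul_eq_mul, mul_one]
    ring
  rw [← Complex.integral_comp_polarCoord_symm,
    setIntegral_congr_fun polarCoord.open_target.measurableSet hpt, polarCoord_target,
    Measure.volume_eq_prod, setIntegral_prod_mul (fun r => r * κ r) fun φ => W (circlePt b φ)] at e2
  have hκ1 : ∫ s in Ioi (0 : ℝ), s * κ s = 1 / 2 := by
    have h1 : ∀ s, s * κ s = (Iio (1 : ℝ)).indicator (fun s => s) s := fun s => by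
      by_cases hs : s < 1 <;> simp [hκ, Set.indicator, hs]
    simp_rw [h1]
    rw [setIntegral_indicator measurableSet_Iio, Ioi_inter_Iio, ← integral_Ioc_eq_integral_Ioo,
      ← intervalIntegral.integral_of_le zero_le_one, integral_id]
    norm_num
  rw [e1, hdim] at e2
  simp only [one_pow, div_one, Nat.add_one_sub_one, pow_one, hκ1] at e2
  have e3 := mul_left_cancel₀ (by norm_num) e2
  rw [e3, intervalIntegral.integral_of_le (by linarith [pi_pos]), integral_Ioc_eq_integral_Ioo]
  refine setIntegral_congr_fun measurableSet_Ioo fun φ _ => ?_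
  have := hWs ⟨circlePt b φ, by simp [norm_circlePt]⟩ 1 one_pos
  simpa using this

lemma hasDerivAt_comp_circlePt {u : E → ℝ} (hu : HomC2 u) (φ : ℝ) :
    HasDerivAt (fun φ => u (circlePt b φ)) (fderiv ℝ u (circlePt b φ) (circleTan b φ)) φ :=
  (differentiableAt_of_contDiffOn hu.contDiffOn (circlePt_ne_zero b φ)).hasFDerivAt.comp_hasDerivAt φ
    (hasDerivAt_circlePt b φ)

/-- With f(φ) = u(γ(φ)) this says f'' + f = tr D²u: the acceleration of the circle is -γ, and Du(γ)γ
= u by Euler. -/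
lemma hasDerivAt_fderiv_circlePt {u : E → ℝ} (hu : HomC2 u) (φ : ℝ) :
    HasDerivAt (fun φ => fderiv ℝ u (circlePt b φ) (circleTan b φ))
      ((hessMatrix b u (circlePt b φ)).trace - u (circlePt b φ)) φ := by
  have hne := circlePt_ne_zero b φ
  have h0 : HasFDerivAt (fderiv ℝ u) (fderiv ℝ (fderiv ℝ u) (circlePt b φ)) (circlePt b φ) :=
    ((contDiffAt_fderiv hu.contDiffOn hne).differentiableAt (by simp)).hasFDerivAt
  have h1 : HasDerivAt (fun φ => fderiv ℝ u (circlePt b φ))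
      (fderiv ℝ (fderiv ℝ u) (circlePt b φ) (circleTan b φ)) φ :=
    h0.comp_hasDerivAt φ (hasDerivAt_circlePt b φ)
  have h2 := fderiv_self_of_homogeneous (k := 1)
    (differentiableAt_of_contDiffOn hu.contDiffOn hne)
    fun r hr => by simpa using hu.hom r hr (circlePt b φ)
  refine (h1.clm_apply (hasDerivAt_circleTan b φ)).congr_deriv ?_
  rw [map_neg, h2, Nat.cast_one, one_mul, ← sub_eq_add_neg, ← trace_hessMatrix_circlePt b hu]

/-- The mixed volume form is nonpositive on functions of mean zero on the circle. -/
lemma integral_mul_trace_hessMatrix_nonpos {u : E → ℝ} (hu : HomC2 u)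
    (h0 : ∫ θ : sphere (0 : E) 1, u θ ∂(volume : Measure E).toSphere = 0) :
    ∫ θ : sphere (0 : E) 1, u θ * (hessMatrix b u θ).trace ∂(volume : Measure E).toSphere ≤ 0 := by
  have hdim : Module.finrank ℝ E = 2 := by
    rw [Module.finrank_eq_card_basis b.toBasis, Fintype.card_fin]
  have hnt : Nontrivial E := Module.nontrivial_of_finrank_pos (R := ℝ) (by omega)
  have hper : circlePt b π = circlePt b (-π) := by simp [circlePt]
  have hper' : circleTan b π = circleTan b (-π) := by simp [circleTan]
  have hqS : Continuous fun θ : sphere (0 : E) 1 => (hessMatrix b u θ).trace :=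
    (continuous_hessMatrix_sphere b hu).matrix_trace
  have hqc : Continuous fun φ => (hessMatrix b u (circlePt b φ)).trace :=
    ((continuousOn_hessMatrix b hu.contDiffOn).comp_continuous (continuous_circlePt b)
      fun φ => circlePt_ne_zero b φ).matrix_trace
  rw [integral_toSphere_eq_circle b hu.continuousOn_sphere] at h0
  have hmul : Continuous fun θ : sphere (0 : E) 1 => u θ * (hessMatrix b u θ).trace :=
    hu.continuousOn_sphere.mul hqS
  rw [integral_toSphere_eq_circle b hmul]
  exact integral_mul_nonpos (hasDerivAt_comp_circlePt b hu) (hasDerivAt_fderiv_circlePt b hu) hqc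
    (congrArg u hper) (by rw [hper, hper']) h0

end Circle

/-! ### Integral inequalities for the Hilbert--Brunn--Minkowski operator -/

section Inequalities

open Matrix

variable {E : Type*} [NormedAddCommGroup E] [InnerProductSpace ℝ E] [FiniteDimensional ℝ E]
  {K : ConvexBody E} {z : sphere (0 : E) 1 → ℝ}

/-- The function `((D²h_K)⁻¹)^{ij} D²_{ij}(z h_K) = Δ_K z + (n - 1) z`. -/
def hessTrace (K : ConvexBody E) (z : sphere (0 : E) 1 → ℝ) (θ : sphere (0 : E) 1) : ℝ :=
  laplacian K z θ + ((Module.finrank ℝ E : ℝ) - 1) * z θ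

lemma hessTrace_eq {n : ℕ} (b : OrthonormalBasis (Fin n) ℝ E) (hK : IsSmoothPos K) (hz : IsC2 z)
    (θ : sphere (0 : E) 1) : hessTrace K z θ = relTrace b (supportFun K) (mulSupp K z) θ := by
  have hdim : Module.finrank ℝ E = n := by
    rw [Module.finrank_eq_card_basis b.toBasis, Fintype.card_fin]
  rw [hessTrace, laplacian_eq b hK hz, hdim, sub_add_cancel]

/-- The squared norm of `D²(z h_K)` with respect to `D²h_K`. -/
def hessSq (K : ConvexBody E) (z : sphere (0 : E) 1 → ℝ) (θ : sphere (0 : E) 1) : ℝ :=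
  relTraceSq (stdOrthonormalBasis ℝ E) (supportFun K) (mulSupp K z) θ

variable [Nontrivial E] [MeasurableSpace E] [BorelSpace E]

lemma integrable_nu (hK : IsSmoothPos K) {g : sphere (0 : E) 1 → ℝ} (hg : Continuous g) :
    Integrable g (nu K) := by
  have hcomp : CompactSpace (sphere (0 : E) 1) := isCompact_iff_compactSpace.1 (isCompact_sphere 0 1)
  have := isFiniteMeasure_nu hK
  exact hg.integrable_of_hasCompactSupport (HasCompactSupport.of_compactSpace _)

lemma continuous_hessTrace (hK : IsSmoothPos K) (hz : IsC2 z) : Continuous (hessTrace K z) :=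
  (continuous_laplacian hK hz).add (continuous_const.mul hz.continuous)

lemma continuous_hessSq (hK : IsSmoothPos K) (hz : IsC2 z) : Continuous (hessSq K z) :=
  continuous_relTraceSq _ (homC2_supportFun hK) (posDef_fullHess_supportFun hK _)
    (homC2_mulSupp hK hz)

/-- `-Δ_K` is nonnegative. -/
lemma integral_mul_hessTrace_le (hK : IsSmoothPos K) (hz : IsC2 z) :
    ∫ θ, z θ * hessTrace K z θ ∂nu K
      ≤ ((Module.finrank ℝ E : ℝ) - 1) * ∫ θ, z θ ^ 2 ∂nu K := by
  set b := stdOrthonormalBasis ℝ E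
  have h := integral_mul_relTrace_le b hz.contDiffOn_homExtZero
    (fun r hr x => homExtZero_smul z hr x) (homC2_supportFun hK)
    (fun x hx => supportFun_pos hK.zero_mem_interior hx) (posDef_fullHess_supportFun hK b)
  simp only [homExtZero_sphere] at h
  rw [integral_nu b hK, integral_nu b hK]
  simp only [hessTrace_eq b hK hz]
  exact h

/-- The divergence theorem. -/
lemma integral_hessTrace (hK : IsSmoothPos K) (hz : IsC2 z) :
    ∫ θ, hessTrace K z θ ∂nu K = ((Module.finrank ℝ E : ℝ) - 1) * ∫ θ, z θ ∂nu K := by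
  set b := stdOrthonormalBasis ℝ E
  have h := integral_relTrace b (homC2_supportFun hK)
    (fun x hx => supportFun_pos hK.zero_mem_interior hx) (posDef_fullHess_supportFun hK b)
    (homC2_mulSupp hK hz)
  rw [integral_nu b hK, integral_nu b hK]
  simp only [hessTrace_eq b hK hz]
  simp only [mulSupp_sphere, mul_assoc] at h
  exact h

/-- The Bochner formula in integrated form. -/
lemma integral_hessSq (hK : IsSmoothPos K) (hz : IsC2 z) :
    ∫ θ, hessSq K z θ ∂nu K = (∫ θ, hessTrace K z θ ^ 2 ∂nu K)
      - ((Module.finrank ℝ E : ℝ) - 2) * ∫ θ, z θ * hessTrace K z θ ∂nu K := by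
  set b := stdOrthonormalBasis ℝ E with hb
  have h := integral_bochner b (homC2_supportFun hK)
    (fun x hx => supportFun_pos hK.zero_mem_interior hx) (posDef_fullHess_supportFun hK b)
    (homC2_mulSupp hK hz)
  have hT := continuous_hessTrace hK hz
  have hS := continuous_hessSq hK hz
  have h1 : ∫ θ, ((hessTrace K z θ ^ 2 - hessSq K z θ)
      - ((Module.finrank ℝ E : ℝ) - 2) * (z θ * hessTrace K z θ)) ∂nu K = 0 := by
    rw [integral_nu b hK, ← h]
    congr 1
    ext θ
    rw [hessTrace_eq b hK hz, hessSq, mulSupp_sphere, density, ← hb]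
    change _ = _ - _ * (z θ * supportFun K θ * _ * _)
    ring
  have i1 : Integrable (fun θ => hessTrace K z θ ^ 2) (nu K) := integrable_nu hK (hT.pow 2)
  have i2 : Integrable (fun θ => z θ * hessTrace K z θ) (nu K) :=
    integrable_nu hK (hz.continuous.mul hT)
  have i3 : Integrable (fun θ => hessTrace K z θ ^ 2 - hessSq K z θ) (nu K) :=
    i1.sub (integrable_nu hK hS)
  rw [integral_sub i3 (i2.const_mul _), integral_sub i1 (integrable_nu hK hS), integral_const_mul] at h1
  linarith

lemma hessSq_nonneg (hK : IsSmoothPos K) (hz : IsC2 z) (θ : sphere (0 : E) 1) :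
    0 ≤ hessSq K z θ :=
  trace_inv_mul_sq_nonneg (posDef_fullHess_supportFun hK _ θ)
    (transpose_hessMatrix _ (homC2_mulSupp hK hz).contDiffOn (ne_zero_of_mem_unit_sphere θ))

lemma sq_hessTrace_le (hE : 2 ≤ Module.finrank ℝ E) (hK : IsSmoothPos K) (hz : IsC2 z)
    (θ : sphere (0 : E) 1) :
    hessTrace K z θ ^ 2 ≤ ((Module.finrank ℝ E : ℝ) - 1) * hessSq K z θ := by
  set b := stdOrthonormalBasis ℝ E with hb
  have hθ : (θ : E) ≠ 0 := ne_zero_of_mem_unit_sphere θ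
  have hu := homC2_mulSupp hK hz
  rw [hessTrace_eq b hK hz]
  exact sq_trace_le_of_mulVec_eq_zero (posDef_fullHess_supportFun hK b θ)
    (transpose_hessMatrix b hu.contDiffOn hθ) hE (coord_dotProduct_self b θ)
    ((homC2_supportFun hK).fullHess_mulVec_self b θ) (hu.hessMatrix_mulVec_self b hθ)

/-- Integrating the pointwise bound and inserting Bochner's formula gives ∫ T² ≤ (n-1)(∫ T² - (n-2)
∫ zT). The common factor n - 2 is then cancelled, which is where n ≥ 3 is needed. -/
lemma mul_integral_mul_hessTrace_le (hE : 3 ≤ Module.finrank ℝ E) (hK : IsSmoothPos K)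
    (hz : IsC2 z) :
    ((Module.finrank ℝ E : ℝ) - 1) * ∫ θ, z θ * hessTrace K z θ ∂nu K
      ≤ ∫ θ, hessTrace K z θ ^ 2 ∂nu K := by
  have hn : (3 : ℝ) ≤ Module.finrank ℝ E := by exact_mod_cast hE
  have hT : Continuous fun θ => hessTrace K z θ ^ 2 := (continuous_hessTrace hK hz).pow 2
  have h1 : ∫ θ, hessTrace K z θ ^ 2 ∂nu K
      ≤ ((Module.finrank ℝ E : ℝ) - 1) * ∫ θ, hessSq K z θ ∂nu K := by
    rw [← integral_const_mul]
    exact integral_mono (integrable_nu hK hT)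
      ((integrable_nu hK (continuous_hessSq hK hz)).const_mul _)
      fun θ => sq_hessTrace_le (by omega) hK hz θ
  rw [integral_hessSq hK hz] at h1
  refine le_of_mul_le_mul_left ?_ (by linarith : (0 : ℝ) < Module.finrank ℝ E - 2)
  nlinarith

/-! #### The planar case -/

/-- Let e be a unit vector orthogonal to t. In the plane A = α e⊗e and B = β e⊗e, and the adjugate
of A + t⊗t exchanges its eigenvalues: it is 1 on e and α on t. Multiplying by it leaves B unchanged.
-/
lemma trace_adjugate_mul_of_mulVec_eq_zero {A B : Matrix (Fin 2) (Fin 2) ℝ} (hA : Aᵀ = A)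
    (hB : Bᵀ = B) {t : Fin 2 → ℝ} (ht : t ⬝ᵥ t = 1) (hAt : A *ᵥ t = 0) (hBt : B *ᵥ t = 0) :
    ((A + vecMulVec t t).adjugate * B).trace = B.trace := by
  have hA' : A 1 0 = A 0 1 := congrFun (congrFun hA 0) 1
  have hB' : B 1 0 = B 0 1 := congrFun (congrFun hB 0) 1
  have f1 := congrFun hAt 0
  have f2 := congrFun hAt 1
  have e1 := congrFun hBt 0
  have e2 := congrFun hBt 1
  simp only [mulVec, dotProduct, Fin.sum_univ_two, Pi.zero_apply, hA', hB'] at f1 f2 e1 e2 ht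
  rw [adjugate_fin_two, trace_fin_two, trace_fin_two]
  simp only [mul_apply, Fin.sum_univ_two, Matrix.add_apply, vecMulVec_apply, of_apply, cons_val', cons_val_zero,
    cons_val_one, hA', hB', cons_val_fin_one]
  -- The mixed discriminant of A and B vanishes, as they share the kernel vector t. It is checked
  -- after multiplication by t₀² and t₁², whose sum is 1.
  have hX : B 0 0 * A 1 1 + A 0 0 * B 1 1 - 2 * B 0 1 * A 0 1 = 0 := by
    have h1 : (B 0 0 * A 1 1 + A 0 0 * B 1 1 - 2 * B 0 1 * A 0 1) * (t 0 * t 0) = 0 := by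
      linear_combination A 1 1 * (t 0 * e1 - t 1 * e2) + B 1 1 * (t 0 * f1 - t 1 * f2)
        - 2 * (A 0 1 * t 0 * e2 - B 1 1 * t 1 * f2)
    have h2 : (B 0 0 * A 1 1 + A 0 0 * B 1 1 - 2 * B 0 1 * A 0 1) * (t 1 * t 1) = 0 := by
      linear_combination B 0 0 * (t 1 * f2 - t 0 * f1) + A 0 0 * (t 1 * e2 - t 0 * e1)
        - 2 * (A 0 1 * t 1 * e1 - B 0 0 * t 0 * f1)
    linear_combination h1 + h2 - (B 0 0 * A 1 1 + A 0 0 * B 1 1 - 2 * B 0 1 * A 0 1) * ht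
  linear_combination hX + (B 0 0 + B 1 1) * ht - t 0 * e1 - t 1 * e2

/-- In the plane the mixed area density of h and u does not involve h, so the Euclidean inequality
on the circle serves for every K. -/
lemma relTrace_mul_det_fin_two (b : OrthonormalBasis (Fin 2) ℝ E) {h u : E → ℝ} (hh : HomC2 h)
    (hu : HomC2 u) {θ : sphere (0 : E) 1} (hdet : (fullHess b h θ).det ≠ 0) :
    relTrace b h u θ * (fullHess b h θ).det = (hessMatrix b u θ).trace := by
  have hθ : (θ : E) ≠ 0 := ne_zero_of_mem_unit_sphere θ
  have := trace_adjugate_mul_of_mulVec_eq_zero (transpose_hessMatrix b hh.contDiffOn hθ)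
    (transpose_hessMatrix b hu.contDiffOn hθ) (coord_dotProduct_self b θ)
    (hh.hessMatrix_mulVec_self b hθ) (hu.hessMatrix_mulVec_self b hθ)
  rw [← this, relTrace, Matrix.inv_def, Ring.inverse_eq_inv', smul_mul, trace_smul, smul_eq_mul,
    mul_comm, ← mul_assoc, mul_inv_cancel₀ hdet, one_mul]
  rfl

/-- Minkowski's inequality in the plane. -/
lemma integral_mul_hessTrace_le_sq (hE : Module.finrank ℝ E = 2) (hK : IsSmoothPos K)
    (hz : IsC2 z) :
    (∫ _, 1 ∂nu K) * ∫ θ, z θ * hessTrace K z θ ∂nu K ≤ (∫ θ, z θ ∂nu K) ^ 2 := by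
  set b : OrthonormalBasis (Fin 2) ℝ E := (stdOrthonormalBasis ℝ E).reindex (finCongr hE)
  have hh := homC2_supportFun hK
  have hu := homC2_mulSupp hK hz
  have hpos : ∀ x ≠ 0, 0 < supportFun K x := fun x hx => supportFun_pos hK.zero_mem_interior hx
  have hM := posDef_fullHess_supportFun hK b
  have hdet : ∀ θ : sphere (0 : E) 1, (fullHess b (supportFun K) θ).det
      = (hessMatrix b (supportFun K) θ).trace := fun θ => by
    have hd := (hM θ).det_pos.ne'
    rw [← relTrace_mul_det_fin_two b hh hh hd, relTrace_self b hh hd]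
    norm_num
  have hden : ∀ θ : sphere (0 : E) 1, density b K θ
      = supportFun K θ * (hessMatrix b (supportFun K) θ).trace := fun θ => by rw [density, hdet]
  set h := supportFun K with hhdef
  set u := mulSupp K z with hudef
  have hmu : ∀ θ : sphere (0 : E) 1, u θ = z θ * h θ := fun θ => mulSupp_sphere z θ
  have hch := hh.continuousOn_sphere
  have hcu := hu.continuousOn_sphere
  have hcTh := (continuous_hessMatrix_sphere b hh).matrix_trace
  have hcTu := (continuous_hessMatrix_sphere b hu).matrix_trace
  have e1 : ∫ _, 1 ∂nu K = ∫ θ : sphere (0 : E) 1, h θ * (hessMatrix b h θ).trace ∂(volume : Measure E).toSphere := by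
    rw [integral_nu b hK]
    simp only [one_mul, hden]
  have e2 : ∫ θ, z θ ∂nu K = ∫ θ : sphere (0 : E) 1, u θ * (hessMatrix b h θ).trace ∂(volume : Measure E).toSphere := by
    rw [integral_nu b hK]
    simp only [hden, hmu, mul_assoc]
  have e3 : ∫ θ, z θ * hessTrace K z θ ∂nu K
      = ∫ θ : sphere (0 : E) 1, u θ * (hessMatrix b u θ).trace ∂(volume : Measure E).toSphere := by
    rw [integral_nu b hK]
    congr 1
    ext θ
    rw [hessTrace_eq b hK hz, ← relTrace_mul_det_fin_two b hh hu (hM θ).det_pos.ne', hmu, density]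
    ring
  have e4 : ∫ θ : sphere (0 : E) 1, h θ * (hessMatrix b u θ).trace ∂(volume : Measure E).toSphere
      = ∫ θ : sphere (0 : E) 1, u θ * (hessMatrix b h θ).trace ∂(volume : Measure E).toSphere := by
    have := integral_relTrace b hh hpos hM hu
    simp only [← hdet]
    rw [show ((2 : ℕ) : ℝ) - 1 = 1 by norm_num, one_mul] at this
    rw [← this]
    congr 1
    ext θ
    rw [← relTrace_mul_det_fin_two b hh hu (hM θ).det_pos.ne']
    ring
  have hIh : 0 < ∫ θ : sphere (0 : E) 1, h θ ∂(volume : Measure E).toSphere := by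
    have hcomp : CompactSpace (sphere (0 : E) 1) :=
      isCompact_iff_compactSpace.1 (isCompact_sphere 0 1)
    obtain ⟨θ⟩ : Nonempty (sphere (0 : E) 1) :=
      (NormedSpace.sphere_nonempty.2 zero_le_one).to_subtype
    exact hch.integral_pos_of_hasCompactSupport_nonneg_nonzero (HasCompactSupport.of_compactSpace _)
      (fun θ => (supp_pos hK θ).le) (supp_pos hK θ).ne'
  -- s makes u - sh of mean zero on the circle, so the area form is nonpositive on it. With V = ∫ 1,
  -- B = ∫ z, A = ∫ zTz this reads A ≤ 2sB - s²V, and multiplication by V gives VA ≤ B² - (B - sV)².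
  set s := (∫ θ : sphere (0 : E) 1, u θ ∂(volume : Measure E).toSphere) /
    ∫ θ : sphere (0 : E) 1, h θ ∂(volume : Measure E).toSphere with hs
  have hw : HomC2 fun x => u x + (-s) * h x := hu.add_const_mul hh (-s)
  have hw0 : ∫ θ : sphere (0 : E) 1, (u θ + (-s) * h θ) ∂(volume : Measure E).toSphere = 0 := by
    rw [integral_add (integrable_sphere hcu) ((integrable_sphere hch).const_mul _),
      integral_const_mul, hs]
    field_simp
    ring
  have hneg := integral_mul_trace_hessMatrix_nonpos b hw hw0
  have hexp : ∀ θ : sphere (0 : E) 1, (u θ + (-s) * h θ) *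
      (hessMatrix b (fun x => u x + (-s) * h x) θ).trace
      = (u θ * (hessMatrix b u θ).trace - s * (u θ * (hessMatrix b h θ).trace))
        - (s * (h θ * (hessMatrix b u θ).trace) - s ^ 2 * (h θ * (hessMatrix b h θ).trace)) := by
    intro θ
    rw [hessMatrix_add_const_mul b hu.contDiffOn hh.contDiffOn _ (ne_zero_of_mem_unit_sphere θ),
      trace_add, trace_smul, smul_eq_mul]
    ring
  simp only [hexp] at hneg
  have i1 : Integrable (fun θ : sphere (0 : E) 1 => u θ * (hessMatrix b u θ).trace)
      (volume : Measure E).toSphere :=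
    integrable_sphere (hcu.mul hcTu)
  have i2 : Integrable (fun θ : sphere (0 : E) 1 => u θ * (hessMatrix b h θ).trace)
      (volume : Measure E).toSphere :=
    integrable_sphere (hcu.mul hcTh)
  have i3 : Integrable (fun θ : sphere (0 : E) 1 => h θ * (hessMatrix b u θ).trace)
      (volume : Measure E).toSphere :=
    integrable_sphere (hch.mul hcTu)
  have i4 : Integrable (fun θ : sphere (0 : E) 1 => h θ * (hessMatrix b h θ).trace)
      (volume : Measure E).toSphere :=
    integrable_sphere (hch.mul hcTh)
  have i5 : Integrable (fun θ : sphere (0 : E) 1 => u θ * (hessMatrix b u θ).trace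
      - s * (u θ * (hessMatrix b h θ).trace)) (volume : Measure E).toSphere :=
    i1.sub (i2.const_mul s)
  have i6 : Integrable (fun θ : sphere (0 : E) 1 => s * (h θ * (hessMatrix b u θ).trace)
      - s ^ 2 * (h θ * (hessMatrix b h θ).trace)) (volume : Measure E).toSphere :=
    (i3.const_mul s).sub (i4.const_mul (s ^ 2))
  rw [integral_sub i5 i6,
    integral_sub i1 (i2.const_mul _), integral_sub (i3.const_mul _) (i4.const_mul _),
    integral_const_mul, integral_const_mul, integral_const_mul, e4, ← e1, ← e2, ← e3] at hneg
  have hV : 0 ≤ ∫ _, (1 : ℝ) ∂nu K := integral_nonneg fun _ => zero_le_one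
  generalize (∫ _, (1 : ℝ) ∂nu K) = V at *
  generalize (∫ θ, z θ ∂nu K) = B at *
  generalize (∫ θ, z θ * hessTrace K z θ ∂nu K) = A at *
  have h1 : A ≤ 2 * s * B - s ^ 2 * V := by linarith
  nlinarith [mul_le_mul_of_nonneg_left h1 hV, sq_nonneg (B - s * V)]

end Inequalities

/-! ### Functions with small Hessian are almost linear -/

section AlmostLinear

open Matrix

variable {E : Type*} [NormedAddCommGroup E] [InnerProductSpace ℝ E] [FiniteDimensional ℝ E]
  {K : ConvexBody E}

lemma dotProduct_mulVec_coord_le {n : ℕ} (b : OrthonormalBasis (Fin n) ℝ E)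
    (M : Matrix (Fin n) (Fin n) ℝ) (v : E) :
    coord b v ⬝ᵥ M *ᵥ coord b v ≤ (∑ i, ∑ j, |M i j|) * ‖v‖ ^ 2 := by
  have hc : ∀ i, |coord b v i| ≤ ‖v‖ := fun i => by
    simpa [coord, b.orthonormal.1 i] using abs_real_inner_le_norm (b i) v
  simp only [dotProduct, mulVec, Finset.mul_sum, Finset.sum_mul]
  refine Finset.sum_le_sum fun i _ => Finset.sum_le_sum fun j _ => ?_
  calc coord b v i * (M i j * coord b v j) ≤ |coord b v i * (M i j * coord b v j)| := le_abs_self _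
    _ = |M i j| * (|coord b v i| * |coord b v j|) := by rw [abs_mul, abs_mul]; ring
    _ ≤ |M i j| * (‖v‖ * ‖v‖) := by
      gcongr
      · exact hc i
      · exact hc j
    _ = |M i j| * ‖v‖ ^ 2 := by ring

/-- Let a be the image of w. Testing the Cauchy–Schwarz bound on a itself gives ‖a‖⁴ ≤ Λ‖a‖² · Λ‖w‖²
· T, T being the trace under the root. -/
lemma norm_fderiv_gradField_le {n : ℕ} (b : OrthonormalBasis (Fin n) ℝ E)
    {M : Matrix (Fin n) (Fin n) ℝ} (hM : M.PosDef) {Λ : ℝ} (hΛ0 : 0 ≤ Λ)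
    (hΛ : ∀ v : E, coord b v ⬝ᵥ M *ᵥ coord b v ≤ Λ * ‖v‖ ^ 2) {u : E → ℝ} (hu : HomC2 u) {x : E}
    (hx : x ≠ 0) :
    ‖fderiv ℝ (gradField b u) x‖
      ≤ Λ * √((M⁻¹ * hessMatrix b u x * (M⁻¹ * hessMatrix b u x)).trace) := by
  set T := (M⁻¹ * hessMatrix b u x * (M⁻¹ * hessMatrix b u x)).trace with hT
  have hB := transpose_hessMatrix b hu.contDiffOn hx
  have hT0 : 0 ≤ T := trace_inv_mul_sq_nonneg hM hB
  refine ContinuousLinearMap.opNorm_le_bound _ (by positivity) fun w => ?_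
  set a := fderiv ℝ (gradField b u) x w with ha
  have h1 : ∀ v, coord b v ⬝ᵥ hessMatrix b u x *ᵥ coord b w = inner ℝ v a := by
    intro v
    rw [coord_dotProduct_hessMatrix, fderiv_fderiv_symm hu.contDiffOn hx, ← coord_dotProduct b,
      clm_eq_sum_coord b, dotProduct_comm]
    congr 1
    ext i
    rw [coord, ha, inner_fderiv_gradField b hu.contDiffOn hx]
  have hq : ∀ v : E, 0 ≤ coord b v ⬝ᵥ M *ᵥ coord b v := fun v => by
    simpa using hM.posSemidef.dotProduct_mulVec_nonneg (coord b v)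
  have h2 := sq_dotProduct_mulVec_le hM hB (coord b a) (coord b w)
  rw [h1, real_inner_self_eq_norm_sq, ← hT] at h2
  have h3 : (coord b a ⬝ᵥ M *ᵥ coord b a) * (coord b w ⬝ᵥ M *ᵥ coord b w) * T
      ≤ (Λ * ‖a‖ ^ 2) * (Λ * ‖w‖ ^ 2) * T :=
    mul_le_mul_of_nonneg_right (mul_le_mul (hΛ a) (hΛ w) (hq w) (by positivity)) hT0
  by_cases ha0 : ‖a‖ = 0
  · rw [ha0]; positivity
  · have ha1 : 0 < ‖a‖ := lt_of_le_of_ne (norm_nonneg _) (Ne.symm ha0)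
    refine abs_le_of_sq_le_sq' ?_ (by positivity) |>.2
    have h4 : (Λ * √T * ‖w‖) ^ 2 = Λ ^ 2 * T * ‖w‖ ^ 2 := by
      rw [mul_pow, mul_pow, Real.sq_sqrt hT0]
    rw [h4]
    have h5 := h2.trans h3
    have h6 : ‖a‖ ^ 2 * ‖a‖ ^ 2 ≤ ‖a‖ ^ 2 * (Λ ^ 2 * T * ‖w‖ ^ 2) := by nlinarith
    exact le_of_mul_le_mul_left h6 (by positivity)

lemma lin_mul_supp (hK : IsSmoothPos K) (ξ : E) (θ : sphere (0 : E) 1) :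
    lin K ξ θ * supp K θ = inner ℝ (θ : E) ξ := by
  rw [lin, real_inner_smul_left]
  have := (supp_pos hK θ).ne'
  field_simp

variable [Nontrivial E] [MeasurableSpace E] [BorelSpace E]

lemma exists_bounds_sphere {g : sphere (0 : E) 1 → ℝ} (hg : Continuous g) (hpos : ∀ θ, 0 < g θ) :
    ∃ m M : ℝ, 0 < m ∧ 0 < M ∧ ∀ θ, m ≤ g θ ∧ g θ ≤ M := by
  have hcomp : CompactSpace (sphere (0 : E) 1) := isCompact_iff_compactSpace.1 (isCompact_sphere 0 1)
  have hne : Nonempty (sphere (0 : E) 1) := (NormedSpace.sphere_nonempty.2 zero_le_one).to_subtype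
  obtain ⟨x, hx⟩ := (isCompact_univ (X := sphere (0 : E) 1)).exists_isMinOn Set.univ_nonempty
    hg.continuousOn |>.imp fun _ h => h.2
  obtain ⟨y, hy⟩ := (isCompact_univ (X := sphere (0 : E) 1)).exists_isMaxOn Set.univ_nonempty
    hg.continuousOn |>.imp fun _ h => h.2
  exact ⟨g x, g y, hpos x, hpos y, fun θ => ⟨hx (Set.mem_univ θ), hy (Set.mem_univ θ)⟩⟩

lemma integral_sqrt_le {T : sphere (0 : E) 1 → ℝ} (hT : Continuous T) (hT0 : ∀ θ, 0 ≤ T θ) :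
    ∫ θ, √(T θ) ∂(volume : Measure E).toSphere
      ≤ √((volume : Measure E).toSphere.real Set.univ) *
        √(∫ θ, T θ ∂(volume : Measure E).toSphere) := by
  set m := (volume : Measure E).toSphere with hm
  have hs : Continuous fun θ => √(T θ) := hT.sqrt
  set a := ∫ θ, √(T θ) ∂m with ha
  set μ := m.real Set.univ with hμ
  have hμ0 : 0 ≤ μ := measureReal_nonneg
  rw [← Real.sqrt_mul hμ0]
  refine Real.le_sqrt_of_sq_le ?_
  have key : ∀ c : ℝ, 0 ≤ (∫ θ, T θ ∂m) - 2 * c * a + c ^ 2 * μ := by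
    intro c
    have h0 : 0 ≤ ∫ θ, ((T θ - 2 * c * √(T θ)) + c ^ 2) ∂m := by
      refine integral_nonneg fun θ => ?_
      have := Real.sq_sqrt (hT0 θ)
      change 0 ≤ T θ - 2 * c * √(T θ) + c ^ 2
      nlinarith [sq_nonneg (√(T θ) - c)]
    have i1 : Integrable (fun θ => T θ - 2 * c * √(T θ)) m :=
      (integrable_sphere hT).sub ((integrable_sphere hs).const_mul _)
    rw [integral_add i1 (integrable_const _), integral_sub (integrable_sphere hT)
      ((integrable_sphere hs).const_mul _), integral_const_mul, integral_const, smul_eq_mul] at h0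
    linarith
  by_cases h : μ = 0
  · have ha0 : a = 0 := by
      have : m = 0 := by
        rw [hμ, measureReal_eq_zero_iff] at h
        exact Measure.measure_univ_eq_zero.1 h
      rw [ha, this, integral_zero_measure]
    rw [ha0, h]
    simp
  · have hμ1 : 0 < μ := lt_of_le_of_ne hμ0 (Ne.symm h)
    -- The value c = a/μ minimizes the quadratic polynomial in `key`.
    have := key (a / μ)
    have h2 : μ * ((∫ θ, T θ ∂m) - 2 * (a / μ) * a + (a / μ) ^ 2 * μ)
        = μ * (∫ θ, T θ ∂m) - a ^ 2 := by field_simp; ring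
    have h3 := mul_nonneg hμ0 this
    linarith

/-- A function `z` with small `D²(z h_K)` is close in `L¹` to a linear function. -/
lemma exists_lintegral_sub_lin_le (hE : 2 ≤ Module.finrank ℝ E) (hK : IsSmoothPos K) :
    ∃ C : ℝ, 0 ≤ C ∧ ∀ z : sphere (0 : E) 1 → ℝ, IsC2 z → ∃ ξ : E,
      ∫⁻ θ, ‖z θ - lin K ξ θ‖ₑ ∂nu K ≤ ENNReal.ofReal (C * √(∫ θ, hessSq K z θ ∂nu K)) := by
  set b := stdOrthonormalBasis ℝ E with hb
  set m := (volume : Measure E).toSphere with hm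
  have hh := homC2_supportFun hK
  have hM := posDef_fullHess_supportFun hK b
  have hcM := continuous_fullHess_sphere b hh
  have hcomp : CompactSpace (sphere (0 : E) 1) := isCompact_iff_compactSpace.1 (isCompact_sphere 0 1)
  obtain ⟨Λ, hΛ⟩ : ∃ Λ, ∀ θ : sphere (0 : E) 1,
      ∑ i, ∑ j, |fullHess b (supportFun K) θ i j| ≤ Λ := by
    have : Continuous fun θ : sphere (0 : E) 1 => ∑ i, ∑ j, |fullHess b (supportFun K) θ i j| :=
      continuous_finsetSum _ fun i _ => continuous_finsetSum _ fun j _ => (hcM.matrix_elem i j).abs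
    obtain ⟨C, hC⟩ := isCompact_univ.exists_bound_of_continuousOn this.continuousOn
    exact ⟨C, fun θ => (le_abs_self _).trans (hC θ (Set.mem_univ θ))⟩
  have hΛ0 : 0 ≤ Λ := by
    obtain ⟨θ⟩ : Nonempty (sphere (0 : E) 1) := (NormedSpace.sphere_nonempty.2 zero_le_one).to_subtype
    exact (Finset.sum_nonneg fun i _ => Finset.sum_nonneg fun j _ => abs_nonneg _).trans (hΛ θ)
  obtain ⟨δ, _, hδ, _, hδd⟩ := exists_bounds_sphere (continuous_density b hK) (density_pos b hK)
  obtain ⟨_, D, _, hD, hDd⟩ := exists_bounds_sphere hcM.matrix_det fun θ => (hM θ).det_pos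
  -- D bounds det D²h_K, n · 4 · 2ⁿ is the Poincaré constant, Λ bounds D²h_K, and the square roots
  -- come from Cauchy–Schwarz on the sphere and from the lower bound δ for the density of ν_K.
  refine ⟨D * (Module.finrank ℝ E * (4 * 2 ^ Module.finrank ℝ E *
    (Λ * (√(m.real Set.univ) * √δ⁻¹)))), by positivity, fun z hz => ?_⟩
  have hu := homC2_mulSupp hK hz
  obtain ⟨ξ, hξ⟩ := exists_lintegral_sub_inner_le hE b hu
  refine ⟨ξ, ?_⟩
  have hcS := continuous_hessSq hK hz
  have hS0 := hessSq_nonneg hK hz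
  have h1 : ∫⁻ θ : sphere (0 : E) 1, ‖fderiv ℝ (gradField b (mulSupp K z)) θ‖ₑ ∂m
      ≤ ENNReal.ofReal (Λ * (√(m.real Set.univ) * √δ⁻¹) * √(∫ θ, hessSq K z θ ∂nu K)) := by
    calc ∫⁻ θ : sphere (0 : E) 1, ‖fderiv ℝ (gradField b (mulSupp K z)) θ‖ₑ ∂m
        ≤ ∫⁻ θ, ENNReal.ofReal (Λ * √(hessSq K z θ)) ∂m := by
          refine lintegral_mono fun θ => ?_
          rw [← ofReal_norm]
          refine ENNReal.ofReal_le_ofReal (norm_fderiv_gradField_le b (hM θ) hΛ0 (fun v => ?_) hu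
            (ne_zero_of_mem_unit_sphere θ))
          exact (dotProduct_mulVec_coord_le b _ v).trans
            (mul_le_mul_of_nonneg_right (hΛ θ) (sq_nonneg _))
      _ = ENNReal.ofReal (∫ θ, Λ * √(hessSq K z θ) ∂m) :=
          (ofReal_integral_eq_lintegral_ofReal ((integrable_sphere hcS.sqrt).const_mul _)
            (.of_forall fun θ => mul_nonneg hΛ0 (Real.sqrt_nonneg _))).symm
      _ ≤ _ := by
          refine ENNReal.ofReal_le_ofReal ?_
          rw [integral_const_mul, mul_assoc Λ, mul_assoc (√(m.real Set.univ))]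
          refine mul_le_mul_of_nonneg_left ((integral_sqrt_le hcS hS0).trans
            (mul_le_mul_of_nonneg_left ?_ (Real.sqrt_nonneg _))) hΛ0
          rw [← Real.sqrt_mul (inv_nonneg.2 hδ.le)]
          refine Real.sqrt_le_sqrt ?_
          rw [integral_nu b hK, ← integral_const_mul]
          refine integral_mono (integrable_sphere hcS)
            ((integrable_sphere (hcS.mul (continuous_density b hK))).const_mul _) fun θ => ?_
          calc hessSq K z θ = δ⁻¹ * (hessSq K z θ * δ) := by field_simp
            _ ≤ δ⁻¹ * (hessSq K z θ * density b K θ) := by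
              have := hS0 θ
              have := (hδd θ).1
              gcongr
  have h2 : ∫⁻ θ, ‖z θ - lin K ξ θ‖ₑ ∂nu K
      ≤ ENNReal.ofReal D * ∫⁻ θ : sphere (0 : E) 1, ‖mulSupp K z θ - inner ℝ (θ : E) ξ‖ₑ ∂m := by
    have hcd := (continuous_density b hK).measurable.ennreal_ofReal
    rw [nu_eq b hK, ← lintegral_const_mul' _ _ ENNReal.ofReal_ne_top]
    refine (lintegral_withDensity_le_lintegral_mul _ hcd _).trans (lintegral_mono fun θ => ?_)
    have hh0 := supp_pos hK θ
    simp only [Pi.mul_apply]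
    rw [← ofReal_norm, ← ofReal_norm, ← ENNReal.ofReal_mul (density_pos b hK θ).le,
      ← ENNReal.ofReal_mul hD.le]
    refine ENNReal.ofReal_le_ofReal ?_
    rw [mulSupp_sphere, ← lin_mul_supp hK ξ θ, ← sub_mul, norm_mul, Real.norm_of_nonneg hh0.le]
    calc density b K θ * ‖z θ - lin K ξ θ‖
        = (fullHess b (supportFun K) θ).det * (‖z θ - lin K ξ θ‖ * supp K θ) := by
          rw [density, supp]; ring
      _ ≤ D * (‖z θ - lin K ξ θ‖ * supp K θ) :=
          mul_le_mul_of_nonneg_right (hDd θ).2 (by positivity)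
  refine h2.trans ((mul_le_mul_right (hξ.trans (mul_le_mul_right (mul_le_mul_right h1 _) _)) _).trans
    (le_of_eq ?_))
  rw [← ENNReal.ofReal_natCast, show (4 * 2 ^ Module.finrank ℝ E : ENNReal) =
    ENNReal.ofReal (4 * 2 ^ Module.finrank ℝ E) by
    rw [ENNReal.ofReal_mul (by norm_num), ENNReal.ofReal_pow (by norm_num)]; simp,
    ← ENNReal.ofReal_mul (by positivity), ← ENNReal.ofReal_mul (by positivity),
    ← ENNReal.ofReal_mul (by positivity)]
  congr 1
  ring

end AlmostLinear

/-! ### The closure of the operator and its spectrum -/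

section Closure

open Filter Topology

variable {E : Type*} [NormedAddCommGroup E] [InnerProductSpace ℝ E] {K : ConvexBody E}

lemma homExt_add_const_mul (z w : sphere (0 : E) 1 → ℝ) (s : ℝ) :
    homExt (fun θ => z θ + s * w θ) = fun x => homExt z x + s * homExt w x :=
  homExt_eq _ (fun r hr x => by rw [homExt_smul z hr, homExt_smul w hr]; ring)
    fun θ => by rw [homExt_sphere, homExt_sphere]

lemma IsC2.add_const_mul {z w : sphere (0 : E) 1 → ℝ} (hz : IsC2 z) (hw : IsC2 w) (s : ℝ) :
    IsC2 fun θ => z θ + s * w θ := by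
  rw [IsC2, homExt_add_const_mul]
  exact ContDiffOn.add hz (contDiffOn_const.mul hw)

lemma isC2_zero : IsC2 (0 : sphere (0 : E) 1 → ℝ) := by
  rw [IsC2, homExt_eq 0 (f := 0) (by simp) (by simp)]
  exact contDiffOn_const

variable [FiniteDimensional ℝ E]

lemma mulSupp_lin (hK : IsSmoothPos K) (ξ : E) : mulSupp K (lin K ξ) = fun x => inner ℝ x ξ := by
  rw [← homExt_mul_supp]
  exact homExt_eq _ (fun r _ x => real_inner_smul_left _ _ _) fun θ => (lin_mul_supp hK ξ θ).symm

lemma isC2_lin (hK : IsSmoothPos K) (ξ : E) : IsC2 (lin K ξ) := by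
  have hh := homC2_supportFun hK
  have h : HomC2 fun x : E => ‖x‖ * ((supportFun K x)⁻¹ * inner ℝ x ξ) := by
    refine ⟨fun x hx => ContDiffAt.contDiffWithinAt ?_, fun r hr x => ?_⟩
    · exact (contDiffAt_norm ℝ hx).mul
        (((hh.contDiffOn.contDiffAt (isOpen_compl_singleton.mem_nhds hx)).inv
          (supportFun_pos hK.zero_mem_interior hx).ne').mul (contDiffAt_id.inner ℝ contDiffAt_const))
    · rw [norm_smul, Real.norm_of_nonneg hr.le, hh.hom r hr, real_inner_smul_left]
      by_cases hx : supportFun K x = 0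
      · simp [hx]
      · field_simp
  have h2 : lin K ξ = fun θ : sphere (0 : E) 1 =>
      ‖(θ : E)‖ * ((supportFun K θ)⁻¹ * inner ℝ (θ : E) ξ) := by
    ext θ
    rw [lin, real_inner_smul_left, norm_eq_of_mem_sphere θ, one_mul, supp]
  rw [h2]
  exact h.isC2

/-- The product of this function with h_K is linear, so its Hessian vanishes and only the zeroth
order term of Δ_K remains. -/
lemma laplacian_lin (hK : IsSmoothPos K) (ξ : E) (θ : sphere (0 : E) 1) :
    laplacian K (lin K ξ) θ = -(((Module.finrank ℝ E : ℝ) - 1) * lin K ξ θ) := by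
  set b := stdOrthonormalBasis ℝ E
  have h1 : (fderiv ℝ fun x : E => (inner ℝ x ξ : ℝ)) = fun _ => innerSL ℝ ξ := by
    ext x v
    have : HasFDerivAt (fun x : E => (inner ℝ x ξ : ℝ)) (innerSL ℝ ξ) x := by
      simp_rw [real_inner_comm ξ]
      exact (innerSL ℝ ξ).hasFDerivAt
    rw [this.fderiv]
  have h2 : hessMatrix b (fun x : E => inner ℝ x ξ) θ = 0 := by
    ext i j
    simp [hessMatrix, h1]
  rw [laplacian_eq b hK (isC2_lin hK ξ), mulSupp_lin hK, relTrace, h2]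
  simp

variable [Nontrivial E] [MeasurableSpace E] [BorelSpace E]

lemma laplacian_add_const_mul (hK : IsSmoothPos K) {z w : sphere (0 : E) 1 → ℝ} (hz : IsC2 z)
    (hw : IsC2 w) (s : ℝ) (θ : sphere (0 : E) 1) :
    laplacian K (fun θ => z θ + s * w θ) θ = laplacian K z θ + s * laplacian K w θ := by
  set b := stdOrthonormalBasis ℝ E
  have hm : mulSupp K (fun θ => z θ + s * w θ) = fun x => mulSupp K z x + s * mulSupp K w x := by
    ext x
    simp only [mulSupp, homExtZero, homExt_add_const_mul]
    ring
  rw [laplacian_eq b hK hz, laplacian_eq b hK hw, laplacian_eq b hK (hz.add_const_mul hw s), hm]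
  simp only [relTrace]
  rw [hessMatrix_add_const_mul b (homC2_mulSupp hK hz).contDiffOn (homC2_mulSupp hK hw).contDiffOn _
    (ne_zero_of_mem_unit_sphere θ), mul_add, Matrix.mul_smul, Matrix.trace_add, Matrix.trace_smul,
    smul_eq_mul]
  ring

lemma laplacian_zero (hK : IsSmoothPos K) (θ : sphere (0 : E) 1) : laplacian K 0 θ = 0 := by
  have := laplacian_add_const_mul hK isC2_zero isC2_zero 1 θ
  simp only [Pi.zero_apply, mul_zero, add_zero, one_mul] at this
  change laplacian K 0 θ = _ at this
  linarith

/-- The graph of `-Δ_K` on `C²(𝕊)`. -/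
def smoothGraph (hK : IsSmoothPos K) : Submodule ℝ (Lp ℝ 2 (nu K) × Lp ℝ 2 (nu K)) where
  carrier := {p | ∃ z : sphere (0 : E) 1 → ℝ, IsC2 z ∧
    p.1 =ᵐ[nu K] z ∧ p.2 =ᵐ[nu K] fun θ => -laplacian K z θ}
  add_mem' := by
    rintro p q ⟨z, hz, hp1, hp2⟩ ⟨w, hw, hq1, hq2⟩
    refine ⟨fun θ => z θ + 1 * w θ, hz.add_const_mul hw 1, ?_, ?_⟩
    · filter_upwards [Lp.coeFn_add p.1 q.1, hp1, hq1] with θ h h1 h2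
      rw [Prod.fst_add, h, Pi.add_apply, h1, h2, one_mul]
    · filter_upwards [Lp.coeFn_add p.2 q.2, hp2, hq2] with θ h h1 h2
      rw [Prod.snd_add, h, Pi.add_apply, h1, h2, laplacian_add_const_mul hK hz hw]
      ring
  zero_mem' := by
    refine ⟨0, isC2_zero, Lp.coeFn_zero _ _ _, ?_⟩
    filter_upwards [Lp.coeFn_zero ℝ 2 (nu K)] with θ h
    rw [laplacian_zero hK, neg_zero]
    exact h
  smul_mem' := by
    rintro c p ⟨z, hz, hp1, hp2⟩
    refine ⟨fun θ => (0 : sphere (0 : E) 1 → ℝ) θ + c * z θ, isC2_zero.add_const_mul hz c, ?_, ?_⟩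
    · filter_upwards [Lp.coeFn_smul c p.1, hp1] with θ h h1
      rw [Prod.smul_fst, h, Pi.smul_apply, h1, Pi.zero_apply, zero_add, smul_eq_mul]
    · filter_upwards [Lp.coeFn_smul c p.2, hp2] with θ h h1
      rw [Prod.smul_snd, h, Pi.smul_apply, h1, laplacian_add_const_mul hK isC2_zero hz,
        laplacian_zero hK, smul_eq_mul]
      ring

/-- Linearity of Δ_K on C² makes the generating set a subspace, so each element of the graph is a
limit of pairs (z, -Δ_K z) and not merely of combinations of such pairs. -/
lemma negLaplacianGraph_eq (hK : IsSmoothPos K) :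
    negLaplacianGraph K = (smoothGraph hK).topologicalClosure := by
  rw [negLaplacianGraph]
  congr 1
  exact Submodule.span_eq (smoothGraph hK)

/-- A closed condition valid for pairs (z, -Δ_K z) with z in C² passes to the closure. As (n-1)p₁ -
p₂ represents Tz, the integral inequalities become continuous conditions on L² × L². -/
lemma of_mem_negLaplacianGraph (hK : IsSmoothPos K) {P : Lp ℝ 2 (nu K) × Lp ℝ 2 (nu K) → Prop}
    (hP : IsClosed {p | P p}) (h : ∀ p, ∀ z, IsC2 z → p.1 =ᵐ[nu K] z →
      (((Module.finrank ℝ E : ℝ) - 1) • p.1 - p.2 : Lp ℝ 2 (nu K)) =ᵐ[nu K] hessTrace K z → P p)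
    {p : Lp ℝ 2 (nu K) × Lp ℝ 2 (nu K)} (hp : p ∈ negLaplacianGraph K) : P p := by
  rw [negLaplacianGraph_eq hK, ← SetLike.mem_coe, Submodule.topologicalClosure_coe] at hp
  refine closure_minimal (t := {p | P p}) ?_ hP hp
  rintro p ⟨z, hz, h1, h2⟩
  refine h p z hz h1 ?_
  filter_upwards [Lp.coeFn_sub (((Module.finrank ℝ E : ℝ) - 1) • p.1) p.2,
    Lp.coeFn_smul ((Module.finrank ℝ E : ℝ) - 1) p.1, h1, h2] with θ e1 e2 e3 e4
  rw [e1, Pi.sub_apply, e2, Pi.smul_apply, e3, e4, hessTrace, smul_eq_mul]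
  ring

lemma inner_eq_integral {f g : Lp ℝ 2 (nu K)} {z w : sphere (0 : E) 1 → ℝ} (hf : f =ᵐ[nu K] z)
    (hg : g =ᵐ[nu K] w) : (inner ℝ f g : ℝ) = ∫ θ, z θ * w θ ∂nu K := by
  rw [L2.inner_def]
  refine integral_congr_ae ?_
  filter_upwards [hf, hg] with θ h1 h2
  rw [h1, h2]
  simp [mul_comm]

/-- The constant function `1` as an element of `L²(ν_K)`. -/
def oneLp (hK : IsSmoothPos K) : Lp ℝ 2 (nu K) :=
  (memLp_nu hK (continuous_const (y := (1 : ℝ)))).toLp fun _ => 1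

lemma coeFn_oneLp (hK : IsSmoothPos K) : oneLp hK =ᵐ[nu K] fun _ => (1 : ℝ) := MemLp.coeFn_toLp _

lemma inner_oneLp_self_pos (hK : IsSmoothPos K) : 0 < (inner ℝ (oneLp hK) (oneLp hK) : ℝ) := by
  have hcomp : CompactSpace (sphere (0 : E) 1) := isCompact_iff_compactSpace.1 (isCompact_sphere 0 1)
  obtain ⟨θ⟩ : Nonempty (sphere (0 : E) 1) := (NormedSpace.sphere_nonempty.2 zero_le_one).to_subtype
  set b := stdOrthonormalBasis ℝ E
  rw [inner_eq_integral (coeFn_oneLp hK) (coeFn_oneLp hK), integral_nu b hK]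
  simp only [one_mul]
  exact (continuous_density b hK).integral_pos_of_hasCompactSupport_nonneg_nonzero
    (HasCompactSupport.of_compactSpace _) (fun θ => (density_pos b hK θ).le)
    (density_pos b hK θ).ne'

/-! ### Lower bounds for the eigenvalues -/

section Eigenvalue

variable {c : ℝ} {f : Lp ℝ 2 (nu K)}

lemma eigenvalue_nonneg (hK : IsSmoothPos K) (hf : f ∈ eigenspace K c) (hf0 : f ≠ 0) : 0 ≤ c := by
  have h := of_mem_negLaplacianGraph hK
    (P := fun p => (inner ℝ p.1 (((Module.finrank ℝ E : ℝ) - 1) • p.1 - p.2) : ℝ)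
      ≤ ((Module.finrank ℝ E : ℝ) - 1) * inner ℝ p.1 p.1)
    (isClosed_le (by fun_prop) (by fun_prop)) (fun p z hz h1 h2 => by
      rw [inner_eq_integral h1 h2, inner_eq_integral h1 h1]
      simpa only [sq] using integral_mul_hessTrace_le hK hz) hf
  have hpos : (0 : ℝ) < inner ℝ f f := real_inner_self_pos.2 hf0
  change (inner ℝ f (((Module.finrank ℝ E : ℝ) - 1) • f - c • f) : ℝ) ≤ _ * inner ℝ f f at h
  rw [← sub_smul, real_inner_smul_right] at h
  have := le_of_mul_le_mul_right h hpos
  linarith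

lemma inner_oneLp_eq_zero (hK : IsSmoothPos K) (hf : f ∈ eigenspace K c) (hc : c ≠ 0) :
    (inner ℝ (oneLp hK) f : ℝ) = 0 := by
  have h := of_mem_negLaplacianGraph hK
    (P := fun p => (inner ℝ (oneLp hK) (((Module.finrank ℝ E : ℝ) - 1) • p.1 - p.2) : ℝ)
      = ((Module.finrank ℝ E : ℝ) - 1) * inner ℝ (oneLp hK) p.1)
    (isClosed_eq (by fun_prop) (by fun_prop)) (fun p z hz h1 h2 => by
      rw [inner_eq_integral (coeFn_oneLp hK) h2, inner_eq_integral (coeFn_oneLp hK) h1]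
      simpa only [one_mul] using integral_hessTrace hK hz) hf
  change (inner ℝ (oneLp hK) (((Module.finrank ℝ E : ℝ) - 1) • f - c • f) : ℝ)
    = _ * inner ℝ (oneLp hK) f at h
  rw [← sub_smul, real_inner_smul_right] at h
  exact (mul_eq_zero.1 (by linarith : c * inner ℝ (oneLp hK) f = 0)).resolve_left hc

/-- On an eigenpair Tf is (n-1-c)f, so the closed inequality reads (n-1)(n-1-c) ≤ (n-1-c)². If 0 <
n-1-c this forces c ≤ 0, against c > 0. -/
lemma finrank_sub_one_le_of_three_le (hE : 3 ≤ Module.finrank ℝ E) (hK : IsSmoothPos K)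
    (hf : f ∈ eigenspace K c) (hf0 : f ≠ 0) (hc : c ≠ 0) : (Module.finrank ℝ E : ℝ) - 1 ≤ c := by
  have h := of_mem_negLaplacianGraph hK
    (P := fun p => ((Module.finrank ℝ E : ℝ) - 1) *
        (inner ℝ p.1 (((Module.finrank ℝ E : ℝ) - 1) • p.1 - p.2) : ℝ)
      ≤ inner ℝ (((Module.finrank ℝ E : ℝ) - 1) • p.1 - p.2)
        (((Module.finrank ℝ E : ℝ) - 1) • p.1 - p.2))
    (isClosed_le (by fun_prop) (by fun_prop)) (fun p z hz h1 h2 => by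
      rw [inner_eq_integral h1 h2, inner_eq_integral h2 h2]
      simpa only [sq] using mul_integral_mul_hessTrace_le hE hK hz) hf
  have hpos : (0 : ℝ) < inner ℝ f f := real_inner_self_pos.2 hf0
  have hc0 := lt_of_le_of_ne (eigenvalue_nonneg hK hf hf0) (Ne.symm hc)
  change _ * (inner ℝ f (((Module.finrank ℝ E : ℝ) - 1) • f - c • f) : ℝ)
    ≤ inner ℝ (((Module.finrank ℝ E : ℝ) - 1) • f - c • f)
      (((Module.finrank ℝ E : ℝ) - 1) • f - c • f) at h
  rw [← sub_smul, real_inner_smul_right, real_inner_smul_left, real_inner_smul_right, ← mul_assoc,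
    ← mul_assoc] at h
  have h1 := le_of_mul_le_mul_right h hpos
  by_contra hlt
  nlinarith

/-- As f is orthogonal to constants, Minkowski's inequality becomes (∫ 1)(n-1-c)‖f‖² ≤ 0. -/
lemma finrank_sub_one_le_of_eq_two (hE : Module.finrank ℝ E = 2) (hK : IsSmoothPos K)
    (hf : f ∈ eigenspace K c) (hf0 : f ≠ 0) (hc : c ≠ 0) : (Module.finrank ℝ E : ℝ) - 1 ≤ c := by
  have h := of_mem_negLaplacianGraph hK
    (P := fun p => (inner ℝ (oneLp hK) (oneLp hK) : ℝ) *
        (inner ℝ p.1 (((Module.finrank ℝ E : ℝ) - 1) • p.1 - p.2) : ℝ)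
      ≤ (inner ℝ (oneLp hK) p.1 : ℝ) ^ 2)
    (isClosed_le (by fun_prop) (by fun_prop)) (fun p z hz h1 h2 => by
      rw [inner_eq_integral h1 h2, inner_eq_integral (coeFn_oneLp hK) (coeFn_oneLp hK),
        inner_eq_integral (coeFn_oneLp hK) h1]
      simpa only [one_mul] using integral_mul_hessTrace_le_sq hE hK hz) hf
  have hpos : (0 : ℝ) < inner ℝ f f := real_inner_self_pos.2 hf0
  change _ * (inner ℝ f (((Module.finrank ℝ E : ℝ) - 1) • f - c • f) : ℝ)
    ≤ (inner ℝ (oneLp hK) f : ℝ) ^ 2 at h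
  rw [inner_oneLp_eq_zero hK hf hc, ← sub_smul, real_inner_smul_right] at h
  by_contra hlt
  have h1 : 0 < (Module.finrank ℝ E : ℝ) - 1 - c := by linarith
  have h2 := mul_pos (inner_oneLp_self_pos hK) (mul_pos h1 hpos)
  linarith

end Eigenvalue

/-! #### The first eigenspace -/

/-- The linear map `ξ ↦ ⟨x*_K, ξ⟩` into `L^p(ν_K)`. -/
def linLp (hK : IsSmoothPos K) (p : ENNReal) : E →ₗ[ℝ] Lp ℝ p (nu K) where
  toFun ξ := (memLp_nu hK (isC2_lin hK ξ).continuous).toLp (lin K ξ)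
  map_add' ξ η := by
    rw [← MemLp.toLp_add]
    congr 1
    ext θ
    simp [lin, inner_add_right]
  map_smul' c ξ := by
    rw [RingHom.id_apply, ← MemLp.toLp_const_smul]
    congr 1
    ext θ
    simp [lin, real_inner_smul_right]

lemma coeFn_linLp (hK : IsSmoothPos K) (p : ENNReal) (ξ : E) : linLp hK p ξ =ᵐ[nu K] lin K ξ :=
  (memLp_nu hK (isC2_lin hK ξ).continuous).coeFn_toLp

/-- The density of ν_K is positive, so a continuous function vanishing almost everywhere vanishes;
it is then evaluated at ξ/‖ξ‖. -/
lemma linLp_injective (hK : IsSmoothPos K) (p : ENNReal) : Function.Injective (linLp hK p) := by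
  rw [injective_iff_map_eq_zero]
  intro ξ hξ
  have h1 : lin K ξ =ᵐ[nu K] 0 :=
    (coeFn_linLp hK p ξ).symm.trans (hξ ▸ Lp.coeFn_zero ℝ p (nu K))
  set b := stdOrthonormalBasis ℝ E
  have hac : (volume : Measure E).toSphere ≪ nu K := by
    rw [nu_eq b hK]
    exact withDensity_absolutelyContinuous'
      (continuous_density b hK).measurable.ennreal_ofReal.aemeasurable
      (.of_forall fun θ => by simpa using density_pos b hK θ)
  have h2 : lin K ξ = 0 :=
    ((isC2_lin hK ξ).continuous.ae_eq_iff_eq _ continuous_const).1 (hac.ae_le h1)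
  by_contra h0
  have h3 := lin_mul_supp hK ξ ⟨‖ξ‖⁻¹ • ξ, by simp [norm_smul, norm_ne_zero_iff.2 h0]⟩
  rw [h2, Pi.zero_apply, zero_mul, real_inner_smul_left, real_inner_self_eq_norm_sq] at h3
  have := norm_ne_zero_iff.2 h0
  field_simp at h3
  exact this h3.symm

lemma linLp_mem_eigenspace (hK : IsSmoothPos K) (ξ : E) :
    linLp hK 2 ξ ∈ eigenspace K ((Module.finrank ℝ E : ℝ) - 1) := by
  change ((linLp hK 2 ξ, ((Module.finrank ℝ E : ℝ) - 1) • linLp hK 2 ξ) :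
    Lp ℝ 2 (nu K) × Lp ℝ 2 (nu K)) ∈ negLaplacianGraph K
  rw [negLaplacianGraph_eq hK]
  refine Submodule.le_topologicalClosure _ ⟨lin K ξ, isC2_lin hK ξ, coeFn_linLp hK 2 ξ, ?_⟩
  filter_upwards [Lp.coeFn_smul ((Module.finrank ℝ E : ℝ) - 1) (linLp hK 2 ξ),
    coeFn_linLp hK 2 ξ] with θ h1 h2
  rw [h1, Pi.smul_apply, h2, laplacian_lin hK, neg_neg, smul_eq_mul]

/-- Take C² functions z_k → f with -Δ_K z_k → (n-1)f in L². Then Tz_k → 0, hence the integrals of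
`hessSq` tend to 0 by Bochner's formula, and z_k approaches the functions ⟨·, ξ_k⟩/h_K. That
approximation holds in L¹ only, so the limit is taken there, in the finite-dimensional and hence
closed range of `linLp` for the exponent 1. -/
lemma exists_eq_linLp (hE : 2 ≤ Module.finrank ℝ E) (hK : IsSmoothPos K) {f : Lp ℝ 2 (nu K)}
    (hf : f ∈ eigenspace K ((Module.finrank ℝ E : ℝ) - 1)) : ∃ ξ, linLp hK 2 ξ = f := by
  have hfin := isFiniteMeasure_nu hK
  set N : ℝ := (Module.finrank ℝ E : ℝ) with hN
  change ((f, (N - 1) • f) : Lp ℝ 2 (nu K) × Lp ℝ 2 (nu K)) ∈ negLaplacianGraph K at hf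
  rw [negLaplacianGraph_eq hK, ← SetLike.mem_coe, Submodule.topologicalClosure_coe,
    mem_closure_iff_seq_limit] at hf
  obtain ⟨p, hp, hlim⟩ := hf
  choose z hz hz1 hz2 using hp
  obtain ⟨C, hC, hCz⟩ := exists_lintegral_sub_lin_le hE hK
  choose ξ hξ using fun k => hCz (z k) (hz k)
  have hq : ∀ k, ((N - 1) • (p k).1 - (p k).2 : Lp ℝ 2 (nu K)) =ᵐ[nu K] hessTrace K (z k) := by
    intro k
    filter_upwards [Lp.coeFn_sub ((N - 1) • (p k).1) (p k).2,
      Lp.coeFn_smul (N - 1) (p k).1, hz1 k, hz2 k] with θ e1 e2 e3 e4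
    rw [e1, Pi.sub_apply, e2, Pi.smul_apply, e3, e4, hessTrace, smul_eq_mul]
    ring
  have hS : ∀ k, ∫ θ, hessSq K (z k) θ ∂nu K
      = inner ℝ ((N - 1) • (p k).1 - (p k).2) ((N - 1) • (p k).1 - (p k).2)
        - (N - 2) * inner ℝ (p k).1 ((N - 1) • (p k).1 - (p k).2) := by
    intro k
    rw [integral_hessSq hK (hz k), inner_eq_integral (hq k) (hq k),
      inner_eq_integral (hz1 k) (hq k)]
    simp only [sq, hN]
  have hS0 : Tendsto (fun k => ∫ θ, hessSq K (z k) θ ∂nu K) atTop (𝓝 0) := by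
    simp only [hS]
    have hc : Continuous fun p : Lp ℝ 2 (nu K) × Lp ℝ 2 (nu K) =>
        (inner ℝ ((N - 1) • p.1 - p.2) ((N - 1) • p.1 - p.2) : ℝ)
          - (N - 2) * inner ℝ p.1 ((N - 1) • p.1 - p.2) := by fun_prop
    have := (hc.tendsto _).comp hlim
    simpa [Function.comp_def] using this
  have hf1 : MemLp f 1 (nu K) := (Lp.memLp f).mono_exponent one_le_two
  have hT1 : Tendsto (fun k => eLpNorm (lin K (ξ k) - z k) 1 (nu K)) atTop (𝓝 0) := by
    have h0 : Tendsto (fun k => ENNReal.ofReal (C * √(∫ θ, hessSq K (z k) θ ∂nu K))) atTop (𝓝 0) := by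
      have := ENNReal.tendsto_ofReal ((hS0.sqrt).const_mul C)
      simpa using this
    refine tendsto_of_tendsto_of_tendsto_of_le_of_le tendsto_const_nhds h0 (fun _ => bot_le)
      fun k => ?_
    rw [eLpNorm_sub_comm, eLpNorm_one_eq_lintegral_enorm]
    exact hξ k
  have hT2 : Tendsto (fun k => eLpNorm (z k - ⇑f) 1 (nu K)) atTop (𝓝 0) := by
    have h1 : Tendsto (fun k => (p k).1) atTop (𝓝 f) :=
      (continuous_fst.tendsto (f, (N - 1) • f)).comp hlim
    rw [Lp.tendsto_Lp_iff_tendsto_eLpNorm'] at h1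
    have h2 := ENNReal.Tendsto.mul_const (b := nu K Set.univ ^ (1 / (1 : ENNReal).toReal -
      1 / (2 : ENNReal).toReal)) h1 (Or.inr (ENNReal.rpow_ne_top_of_nonneg (by norm_num)
        (measure_ne_top _ _)))
    rw [zero_mul] at h2
    refine tendsto_of_tendsto_of_tendsto_of_le_of_le tendsto_const_nhds h2 (fun _ => bot_le)
      fun k => ?_
    have h3 : eLpNorm (z k - ⇑f) 1 (nu K) = eLpNorm (⇑(p k).1 - ⇑f) 1 (nu K) :=
      eLpNorm_congr_ae ((hz1 k).symm.sub (ae_eq_refl _))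
    rw [h3]
    exact eLpNorm_le_eLpNorm_mul_rpow_measure_univ one_le_two
      ((Lp.aestronglyMeasurable _).sub (Lp.aestronglyMeasurable _))
  have hT : Tendsto (fun k => linLp hK 1 (ξ k)) atTop (𝓝 (hf1.toLp f)) := by
    refine (Lp.tendsto_Lp_iff_tendsto_eLpNorm'' _
      (fun k => memLp_nu hK (isC2_lin hK (ξ k)).continuous) _ hf1).2 ?_
    have h0 := hT1.add hT2
    rw [add_zero] at h0
    refine tendsto_of_tendsto_of_tendsto_of_le_of_le tendsto_const_nhds h0 (fun _ => bot_le)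
      fun k => ?_
    have h4 : lin K (ξ k) - ⇑f = (lin K (ξ k) - z k) + (z k - ⇑f) := by abel
    rw [h4]
    exact eLpNorm_add_le
      (((isC2_lin hK (ξ k)).continuous.sub (hz k).continuous).aestronglyMeasurable)
      ((hz k).continuous.aestronglyMeasurable.sub (Lp.aestronglyMeasurable _)) le_rfl
  have hclosed : IsClosed (LinearMap.range (linLp hK 1) : Set (Lp ℝ 1 (nu K))) :=
    Submodule.closed_of_finiteDimensional _
  obtain ⟨η, hη⟩ := hclosed.mem_of_tendsto hT (.of_forall fun k => ⟨ξ k, rfl⟩)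
  refine ⟨η, Lp.ext ?_⟩
  have h5 : linLp hK 1 η =ᵐ[nu K] f := hη ▸ hf1.coeFn_toLp
  exact (coeFn_linLp hK 2 η).trans ((coeFn_linLp hK 1 η).symm.trans h5)

lemma eigenspace_eq_range (hE : 2 ≤ Module.finrank ℝ E) (hK : IsSmoothPos K) :
    eigenspace K ((Module.finrank ℝ E : ℝ) - 1) = LinearMap.range (linLp hK 2) := by
  refine le_antisymm (fun f hf => exists_eq_linLp hE hK hf) ?_
  rintro _ ⟨ξ, rfl⟩
  exact linLp_mem_eigenspace hK ξ

lemma span_lin_eq_range (hK : IsSmoothPos K) :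
    Submodule.span ℝ {f : Lp ℝ 2 (nu K) | ∃ ξ : E, f =ᵐ[nu K] lin K ξ}
      = LinearMap.range (linLp hK 2) := by
  have : {f : Lp ℝ 2 (nu K) | ∃ ξ : E, f =ᵐ[nu K] lin K ξ}
      = (LinearMap.range (linLp hK 2) : Set (Lp ℝ 2 (nu K))) := by
    ext f
    constructor
    · rintro ⟨ξ, h⟩
      exact ⟨ξ, Lp.ext ((coeFn_linLp hK 2 ξ).trans h.symm)⟩
    · rintro ⟨ξ, rfl⟩
      exact ⟨ξ, coeFn_linLp hK 2 ξ⟩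
  rw [this, Submodule.span_eq]

end Closure

end HilbertBrunnMinkowski

end

/-! ### The theorem: least non-zero eigenvalue and its eigenspace -/

theorem theorem5p4 {E : Type*} [NormedAddCommGroup E] [InnerProductSpace ℝ E]
    [FiniteDimensional ℝ E] [MeasurableSpace E] [BorelSpace E]
    (n : ℕ) (hn : 2 ≤ n) (hE : Module.finrank ℝ E = n)
    (K : ConvexBody E) (hK : HilbertBrunnMinkowski.IsSmoothPos K) :
    IsLeast {c : ℝ | c ≠ 0 ∧ HilbertBrunnMinkowski.IsEigenvalue K c} ((n : ℝ) - 1) ∧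
    Module.finrank ℝ (HilbertBrunnMinkowski.eigenspace K ((n : ℝ) - 1)) = n ∧
    HilbertBrunnMinkowski.eigenspace K ((n : ℝ) - 1) =
      Submodule.span ℝ {f : MeasureTheory.Lp ℝ 2 (HilbertBrunnMinkowski.nu K) |
        ∃ ξ : E, f =ᵐ[HilbertBrunnMinkowski.nu K] HilbertBrunnMinkowski.lin K ξ} := by
  subst hE
  have hnt : Nontrivial E := Module.nontrivial_of_finrank_pos (R := ℝ) (by omega)
  have hfin : Module.finrank ℝ (HilbertBrunnMinkowski.eigenspace K ((Module.finrank ℝ E : ℝ) - 1))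
      = Module.finrank ℝ E := by
    rw [HilbertBrunnMinkowski.eigenspace_eq_range hn hK]
    exact LinearMap.finrank_range_of_inj (HilbertBrunnMinkowski.linLp_injective hK 2)
  refine ⟨⟨⟨?_, fun h => ?_⟩, ?_⟩, hfin, ?_⟩
  · have : (2 : ℝ) ≤ Module.finrank ℝ E := by exact_mod_cast hn
    linarith
  · rw [h, finrank_bot] at hfin
    omega
  · rintro c ⟨hc, hc'⟩
    obtain ⟨f, hf, hf0⟩ := Submodule.exists_mem_ne_zero_of_ne_bot hc'
    -- The planar case relies on Minkowski's inequality, all higher dimensions on Bochner's formula.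
    rcases hn.eq_or_lt with h2 | h3
    · exact HilbertBrunnMinkowski.finrank_sub_one_le_of_eq_two h2.symm hK hf hf0 hc
    · exact HilbertBrunnMinkowski.finrank_sub_one_le_of_three_le h3 hK hf hf0 hc
  · rw [HilbertBrunnMinkowski.eigenspace_eq_range hn hK,
      HilbertBrunnMinkowski.span_lin_eq_range hK]
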